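/- Let $\mu>0$. Let $\Omega$ be either $\mathbb R$ or $(0,\infty)$ and let $h=-\frac{d^2}{dx^2}-\mu$ on $L^2(\Omega)$, with Dirichlet boundary condition at $0$ if $\Omega=(0,\infty)$. On $L^2(\Omega\times\Omega)$ let $h_x,h_y$ denote $h$ acting on the first and on the second variable and define, through functional calculus, for $T>0$, $$L_T=\frac{h_x+h_y}{\tanh(h_x/2T)+\tanh(h_y/2T)},\qquad D_T=\frac12\,\frac{h_x}{\tanh(h_x/2T)}+\frac12\,\frac{h_y}{\tanh(h_y/2T)} .$$ For $\lambda>0$ let $L_T-\lambda\delta$ and $D_T-\lambda\delta$ be the self-adjoint operators defined, via the KLMN theorem, by the quadratic forms $\langle\alpha,L_T\alpha\rangle-\lambda\int_\Omega|\alpha(x,x)|^2\,dx$ and $\langle\alpha,D_T\alpha\rangle-\lambda\int_\Omega|\alpha(x,x)|^2\,dx$ (contact interaction $V=\lambda\delta(x-y)$), and let $\sigma_s$ denote their spectrum on the symmetric functions $\alpha(x,y)=\alpha(y,x)$. Put $$T_l(\lambda)=\inf\{T>0:\inf\sigma_s(L_T-\lambda\delta)\ge 0\},\qquad T_u(\lambda)=\sup\{T>0:\inf\sigma_s(D_T-\lambda\delta)\le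 0\},$$ and write $T_l^0,T_u^0$ for $\Omega=\mathbb R$, and $T_u^1$ for $T_u$ on $\Omega=(0,\infty)$ with Dirichlet boundary condition. Then for every $\lambda>0$ the system on $\mathbb R$ has a unique critical temperature $T_c^0(\lambda):=T_l^0(\lambda)=T_u^0(\lambda)>0$, and in the strong coupling limit $$\lim_{\lambda\to\infty}\frac{T_u^1(\lambda)-T_c^0(\lambda)}{T_c^0(\lambda)}=0 .$$ -/

import Mathlib

open MeasureTheory Filter Topology FourierTransform
open scoped SchwartzMap ENNReal

noncomputable section

namespace BCS

/-! ### Self-adjoint operators given by forms, and their spectrum -/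

section FormOperator

variable {H : Type*} [NormedAddCommGroup H] [InnerProductSpace ℂ H]

/-- Graph of the operator `A` associated with a Hermitian form `a` with form domain `Q` in the
Hilbert space `S` (a closed subspace of the ambient space `H`): `u ∈ dom A` and `A u = f` iff
`u ∈ Q` and `a(v, u) = ⟨v, f⟩` for all `v ∈ Q`.  For a closed, densely defined form that is bounded
from below this is the self-adjoint operator of the first representation theorem; for the form sum
of `D_T` and a form-bounded perturbation it is the operator of the KLMN theorem.
Forms and inner products are conjugate linear in the first argument. -/
def IsFormOperator (S Q : Set H) (a : H → H → ℂ) (u f : H) : Prop :=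
  u ∈ S ∩ Q ∧ f ∈ S ∧ ∀ v ∈ S ∩ Q, a v u = inner ℂ v f

/-- The spectrum of the self-adjoint operator `A` associated with the form `a`: all real `E` for
which `A - E : dom A → S` is not bijective.  (A self-adjoint operator is closed, so a bijective
`A - E` has a bounded inverse, and its spectrum is real.) -/
def formSpectrum (S Q : Set H) (a : H → H → ℂ) : Set ℝ :=
  {E | ¬ ∀ f ∈ S, ∃! u, IsFormOperator S Q a u (f + (E : ℂ) • u)}

/-- The infimum of the spectrum, as an extended real number. -/
def infSpectrum (S Q : Set H) (a : H → H → ℂ) : EReal :=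
  sInf ((fun E : ℝ => (E : EReal)) '' formSpectrum S Q a)

end FormOperator

/-! ### Symbols -/

/-- The function `x / tanh (x / 2T)`, with its limiting value `2T` at `x = 0`. -/
def kFun (T x : ℝ) : ℝ := if x = 0 then 2 * T else x / Real.tanh (x / (2 * T))

/-- `D_T` as a function of the two commuting one-particle operators `h_x`, `h_y`. -/
def dFun (T a b : ℝ) : ℝ := kFun T a / 2 + kFun T b / 2

/-- `L_T` as a function of the two commuting one-particle operators `h_x`, `h_y`:
`(a + b) / (tanh (a / 2T) + tanh (b / 2T))`, with its limiting value where `a + b = 0`. -/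
def lFun (T a b : ℝ) : ℝ :=
  if a + b = 0 then 2 * T * Real.cosh (a / (2 * T)) ^ 2
  else (a + b) / (Real.tanh (a / (2 * T)) + Real.tanh (b / (2 * T)))

/-! ### The contact interaction -/

/-- The plane, the configuration space of two particles on the line. -/
abbrev Plane : Type := EuclideanSpace ℝ (Fin 2)

/-- `L²(ℝ × ℝ)`. -/
abbrev L2Plane : Type := Lp ℂ 2 (volume : Measure Plane)

/-- The exchange of the two particles. -/
def exchange (x : Plane) : Plane := !₂[x 1, x 0]

/-- `g ∈ L²(ℝ)` is the trace `g(x) = U(x, x)` of `U ∈ H¹(ℝ²)` on the diagonal: there are Schwartz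
functions which converge to `U` in `H¹` and whose restrictions to the diagonal converge to `g`
in `L²`. -/
def IsDiagTrace (U : L2Plane) (g : Lp ℂ 2 (volume : Measure ℝ)) : Prop :=
  ∃ φ : ℕ → 𝓢(Plane, ℂ),
    Tendsto (fun n => ∫⁻ ξ : Plane,
      ENNReal.ofReal (1 + ‖ξ‖ ^ 2) * ‖𝓕 (φ n) ξ - (𝓕 U : L2Plane) ξ‖ₑ ^ 2) atTop (𝓝 0) ∧
    Tendsto (fun n => eLpNorm (fun x : ℝ => φ n !₂[x, x] - g x) 2 volume) atTop (𝓝 0)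

open scoped Classical in
/-- The trace of `U ∈ H¹(ℝ²)` on the diagonal (and `0` if there is none). -/
def diagTrace (U : L2Plane) : Lp ℂ 2 (volume : Measure ℝ) :=
  if h : ∃ g, IsDiagTrace U g then h.choose else 0

/-! ### Two-particle operators

The one-particle operator is `h = -d²/dx² - μ`.  A two-particle system is described by its Hilbert
space `H`, an extension map `J` from `H` to `L²(ℝ²)` and a set `P` of momenta, such that
`u ↦ 𝓕 (J u)`, restricted to `P`, is unitary from `H` onto `L²(P)` and turns `-∂²/∂x²` and
`-∂²/∂y²` into multiplication by `p²` and `q²`, where `(p, q) = 2π ξ`. -/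

section Forms

variable {H : Type*} (J : H → L2Plane) (P : Set Plane) (I : Set ℝ) (μ : ℝ) (m : ℝ → ℝ → ℝ)

/-- The multiplier of `m(h_x, h_y)` in the Fourier variable `ξ`, with momenta
`(p, q) = 2π ξ`. -/
def symbol (ξ : Plane) : ℝ :=
  m ((2 * Real.pi * ξ 0) ^ 2 - μ) ((2 * Real.pi * ξ 1) ^ 2 - μ)

/-- The form domain of the nonnegative operator `m(h_x, h_y)`. -/
def formDomain : Set H :=
  {u | IntegrableOn (fun ξ : Plane => symbol μ m ξ * ‖(𝓕 (J u) : L2Plane) ξ‖ ^ 2) P}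

/-- The form of `m(h_x, h_y) - lam * δ(x - y)`, that is
`⟨v, m(h_x, h_y) u⟩ - lam * ∫_I conj (v (x, x)) * u (x, x) dx`. -/
def contactForm (lam : ℝ) (v u : H) : ℂ :=
  (∫ ξ in P, (symbol μ m ξ : ℂ) *
    (starRingEnd ℂ ((𝓕 (J v) : L2Plane) ξ) * (𝓕 (J u) : L2Plane) ξ)) -
  (lam : ℂ) * ∫ x in I, starRingEnd ℂ (diagTrace (J v) x) * diagTrace (J u) x

end Forms

/-! ### The full line -/

/-- Symmetric functions in `L²(ℝ × ℝ)`. -/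
def lineSym : Set L2Plane := {u | (fun x => u (exchange x)) =ᵐ[volume] u}

/-- `inf σ_s (m(h_x, h_y) - lam * δ(x - y))` on the full line. -/
def lineInf (μ : ℝ) (m : ℝ → ℝ → ℝ) (lam : ℝ) : EReal :=
  infSpectrum lineSym (formDomain id Set.univ μ m) (contactForm id Set.univ Set.univ μ m lam)

/-- The lower temperature `T_l` of the full line. -/
def lineTl (μ lam : ℝ) : ℝ := sInf {T | 0 < T ∧ 0 ≤ lineInf μ (lFun T) lam}

/-- The upper temperature `T_u` of the full line. -/
def lineTu (μ lam : ℝ) : ℝ := sSup {T | 0 < T ∧ lineInf μ (dFun T) lam ≤ 0}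

/-! ### The half-line with Dirichlet boundary condition -/

/-- `(0, ∞) × (0, ∞)`. -/
def quadrant : Set Plane := {x | 0 < x 0 ∧ 0 < x 1}

/-- `L²((0, ∞) × (0, ∞))`. -/
abbrev L2Quadrant : Type := Lp ℂ 2 ((volume : Measure Plane).restrict quadrant)

/-- Reflection of the first coordinate (`i = 0`) or of the second coordinate (`i = 1`). -/
def mirror (i : Fin 2) : Plane ≃ₗᵢ[ℝ] Plane :=
  LinearIsometryEquiv.piLpCongrRight 2
    (fun j => if j = i then LinearIsometryEquiv.neg ℝ else LinearIsometryEquiv.refl ℝ ℝ)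

/-- The extension of a function on the quadrant to the plane which is odd in each variable. -/
def oddExt (u : Plane → ℂ) (x : Plane) : ℂ :=
  quadrant.indicator u x - quadrant.indicator u (mirror 0 x) - quadrant.indicator u (mirror 1 x) +
    quadrant.indicator u (mirror 0 (mirror 1 x))

lemma measurableSet_quadrant : MeasurableSet quadrant := by
  have h : ∀ i : Fin 2, Measurable fun x : Plane => x i := fun i => by fun_prop
  exact (measurableSet_lt measurable_const (h 0)).inter (measurableSet_lt measurable_const (h 1))

lemma memLp_oddExt (u : L2Quadrant) : MemLp (oddExt u) 2 (volume : Measure Plane) := by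
  have h : MemLp (quadrant.indicator u) 2 (volume : Measure Plane) :=
    (memLp_indicator_iff_restrict measurableSet_quadrant).2 (Lp.memLp u)
  have h0 := h.comp_measurePreserving (mirror 0).measurePreserving
  have h1 := h.comp_measurePreserving (mirror 1).measurePreserving
  have h01 := h0.comp_measurePreserving (mirror 1).measurePreserving
  exact ((h.sub h0).sub h1).add h01

/-- Odd extension, from `L²((0, ∞)²)` to `L²(ℝ²)`.  It turns the Dirichlet Laplacian in each
variable into the Laplacian on the line, and its Fourier transform is, up to a sign and restricted
to positive momenta, the unitary sine transform on `L²((0, ∞)²)`, which diagonalizes the Dirichlet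
Laplacian. -/
def oddExtLp (u : L2Quadrant) : L2Plane := (memLp_oddExt u).toLp (oddExt u)

/-- Symmetric functions in `L²((0, ∞) × (0, ∞))`. -/
def halfSym : Set L2Quadrant := {u | (fun x => u (exchange x)) =ᵐ[volume.restrict quadrant] u}

/-- `inf σ_s (m(h_x, h_y) - lam * δ(x - y))` on the half-line, Dirichlet boundary condition. -/
def halfInf (μ : ℝ) (m : ℝ → ℝ → ℝ) (lam : ℝ) : EReal :=
  infSpectrum halfSym (formDomain oddExtLp quadrant μ m)
    (contactForm oddExtLp quadrant (Set.Ioi 0) μ m lam)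

/-- The upper temperature `T_u` of the half-line with Dirichlet boundary condition. -/
def halfTu (μ lam : ℝ) : ℝ := sSup {T | 0 < T ∧ halfInf μ (dFun T) lam ≤ 0}

end BCS

end

/-! In momentum space the trace of a function on the diagonal becomes `fibre`, the integral over all
momenta with given total momentum s. On the line the form is therefore ∫ m|ψ|² - λ ∫ |fibre ψ|²,
with m the symbol of L_T or D_T. Conjugation with m^(-1/2) turns it into a bounded operator 1 - λ
m^(-1/2) δ m^(-1/2) (`FormModel`, `FormRep`). If this operator is coercive, the spectrum lies above
a positive number; if it has one negative expectation value, there is negative spectrum. Only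
quadratic form inequalities remain.

On the line, let g(T) = ∫ dt / K_T (`gapInt`). Cauchy-Schwarz on every fibre bounds ∫ |fibre ψ|² by
∫ m|ψ|² times a bound for ∫ dt / m(s - t, t) that is uniform in s. For D_T the inequality between
harmonic and arithmetic means gives the bound g(T), with equality at s = 0. Since L_T ≥ D_T, and
both equal K_T when the two energies coincide, as they do on the fibre s = 0, the same constant
serves L_T. Trial functions 1/m cut off to small total momentum show that it is sharp. Hence T_l and
T_u are both the temperature at which λ g(T), strictly decreasing in T with range reaching above and
below 1, passes through 1.

On the half-line, odd extension gives the same form on functions odd in each momentum, with coupling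
2λ. Antisymmetrising the previous trial function costs only the small overlap of a thin band with
its reflection, so T_u^1 ≥ T_c^0 as soon as the set defining T_u^1 is bounded (`halfInf_neg`).

For the reverse estimate the oddness must win back the factor 2 (`two_mul_integral_fibre_le`). With
G = fibre ψ, oddness gives 2∫|G|² = Re ∫ conj(G(p+q) - G(p-q)) ψ. Apply Cauchy-Schwarz with the
weight w = 1 / (k((p+q)/2) + k((p-q)/2) - 2c). The cross term between G(p+q) and G(p-q) has a
favourable sign, because w is a superposition of products u(p+q)u(p-q). For μ = 0 the lower bound
1/w ≤ m follows from convexity of x coth x. For μ > 0 the dispersion differs from the one at μ = 0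
by a relative error of at most μ/2T. As λ → ∞ the critical temperature tends to infinity, and by the
scaling g₀(cT) = c^(-1/2) g₀(T) any fixed factor c > 1 in the temperature eventually dominates this
error. -/

noncomputable section

namespace BCS

/-! ### Spectrum of a form operator through a bounded operator -/

section FormOperator

variable {H : Type*} [NormedAddCommGroup H] [InnerProductSpace ℂ H]
variable {V : Type*} [NormedAddCommGroup V] [InnerProductSpace ℂ V]

/-- A form with domain `S ∩ Q` in the Hilbert space `S` is represented by the bounded operator `K`
on a Hilbert space `V`, if `W` is a unitary map from `V` onto `S`, and `W ∘ T` maps `V` onto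
`S ∩ Q` and pulls the form back to `⟨φ, K ψ⟩`. -/
structure FormRep (S Q : Set H) (a : H → H → ℂ) (W : V →ₗᵢ[ℂ] H) (T K : V →L[ℂ] V) : Prop where
  range_eq : Set.range W = S
  range_comp : Set.range (fun φ => W (T φ)) = S ∩ Q
  inj : Function.Injective T
  symm_T : T.IsSymmetric
  symm_K : K.IsSymmetric
  form_eq : ∀ φ ψ, a (W (T φ)) (W (T ψ)) = inner ℂ φ (K ψ)

namespace FormRep

variable {S Q : Set H} {a : H → H → ℂ} {W : V →ₗᵢ[ℂ] H} {T K : V →L[ℂ] V}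

lemma inner_comp_self (h : FormRep S Q a W T K) (ψ : V) :
    inner ℂ ψ (T (T ψ)) = ((‖T ψ‖ ^ 2 : ℝ) : ℂ) := by
  have h1 : inner ℂ (T ψ) (T ψ) = inner ℂ ψ (T (T ψ)) := h.symm_T ψ (T ψ)
  rw [← h1, inner_self_eq_norm_sq_to_K]
  norm_cast

/-- Testing against `W (T φ)` and moving `T` across the inner product by symmetry turns the weak
equation into one identity between vectors of `V`. -/
lemma isFormOperator_iff (h : FormRep S Q a W T K) (ψ g : V) :
    IsFormOperator S Q a (W (T ψ)) (W g) ↔ K ψ = T g := by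
  have h1 : W (T ψ) ∈ S ∩ Q := h.range_comp ▸ ⟨ψ, rfl⟩
  have h2 : W g ∈ S := h.range_eq ▸ ⟨g, rfl⟩
  have hT : ∀ x y, inner ℂ (T x) y = inner ℂ x (T y) := h.symm_T
  simp only [IsFormOperator, h1, h2, true_and]
  rw [← h.range_comp, Set.forall_mem_range]
  simp only [h.form_eq, LinearIsometry.inner_map_map, hT]
  exact ⟨fun h => ext_inner_left ℂ h, fun h v => by rw [h]⟩

lemma mem_formSpectrum_iff (h : FormRep S Q a W T K) (E : ℝ) :
    E ∈ formSpectrum S Q a ↔ ¬ ∀ g, ∃! ψ, K ψ - (E : ℂ) • T (T ψ) = T g := by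
  have key : ∀ g ψ, IsFormOperator S Q a (W (T ψ)) (W g + (E : ℂ) • W (T ψ)) ↔
      K ψ - (E : ℂ) • T (T ψ) = T g := fun g ψ => by
    rw [← map_smul, ← map_add, h.isFormOperator_iff, map_add, map_smul, sub_eq_iff_eq_add]
  have hmem : ∀ u f, IsFormOperator S Q a u f → ∃ ψ, W (T ψ) = u := fun u f hu =>
    (Set.mem_range (f := fun φ => W (T φ))).1 (h.range_comp.symm ▸ hu.1)
  have hinj : Function.Injective fun φ => W (T φ) := W.injective.comp h.inj
  have hS : ∀ p : H → Prop, (∀ f ∈ S, p f) ↔ ∀ g, p (W g) := fun p => by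
    rw [← h.range_eq, Set.forall_mem_range]
  simp only [formSpectrum, Set.mem_ofPred_eq]
  rw [not_iff_not, hS]
  refine forall_congr' fun g => ⟨?_, ?_⟩
  · rintro ⟨u, hu, huniq⟩
    obtain ⟨ψ, rfl⟩ := hmem _ _ hu
    exact ⟨ψ, (key _ _).1 hu, fun ψ' h' => hinj (huniq _ ((key _ _).2 h'))⟩
  · rintro ⟨ψ, hψ, huniq⟩
    refine ⟨W (T ψ), (key _ _).2 hψ, fun u hu => ?_⟩
    obtain ⟨ψ', rfl⟩ := hmem _ _ hu
    rw [huniq ψ' ((key _ _).1 hu)]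

/-- For `E < c` the operator `K - E T²` is still coercive, hence invertible by Lax-Milgram, so `E`
is not in the spectrum. -/
lemma le_infSpectrum_of_coercive [CompleteSpace V] (h : FormRep S Q a W T K) {δ : ℝ} (hδ : 0 < δ)
    (hK : ∀ ψ, δ * ‖ψ‖ ^ 2 ≤ (inner ℂ ψ (K ψ)).re) :
    ∃ c : ℝ, 0 < c ∧ (c : EReal) ≤ infSpectrum S Q a := by
  have hT : ∀ x y, inner ℂ (T x) y = inner ℂ x (T y) := h.symm_T
  -- Half of the coercivity absorbs `E ‖T ψ‖²` for every `E < c`; the `+ 1` covers `T = 0`.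
  set c : ℝ := δ / (2 * (‖T‖ ^ 2 + 1)) with hc
  have hc0 : 0 < c := by positivity
  have hcT : c * ‖T‖ ^ 2 ≤ δ / 2 := by
    have h1 : c * (‖T‖ ^ 2 + 1) = δ / 2 := by rw [hc]; field_simp
    nlinarith
  refine ⟨c, hc0, le_sInf ?_⟩
  rintro _ ⟨E, hE, rfl⟩
  rw [EReal.coe_le_coe_iff]
  by_contra! hlt
  rw [h.mem_formSpectrum_iff] at hE
  refine hE fun g => ?_
  set L : V →L[ℂ] V := K - (E : ℂ) • (T ∘L T) with hL
  have hre : ∀ ψ, ‖ψ‖ ^ 2 * (δ / 2) ≤ (inner ℂ ψ (L ψ)).re := fun ψ => by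
    have h1 : inner ℂ ψ (L ψ) = inner ℂ ψ (K ψ) - (E : ℂ) * ((‖T ψ‖ ^ 2 : ℝ) : ℂ) := by
      simp only [hL, sub_apply, smul_apply, ContinuousLinearMap.comp_apply, inner_sub_right,
        inner_smul_right, h.inner_comp_self]
    have h2 : ‖T ψ‖ ^ 2 ≤ ‖T‖ ^ 2 * ‖ψ‖ ^ 2 := by
      rw [← mul_pow]; exact pow_le_pow_left₀ (norm_nonneg _) (T.le_opNorm ψ) 2
    rw [h1, Complex.sub_re, ← Complex.ofReal_mul, Complex.ofReal_re]
    have h3 := hK ψ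
    have h4 : E * ‖T ψ‖ ^ 2 ≤ c * ‖T ψ‖ ^ 2 := by gcongr
    have h5 : c * ‖T ψ‖ ^ 2 ≤ c * (‖T‖ ^ 2 * ‖ψ‖ ^ 2) := by gcongr
    have h6 : c * ‖T‖ ^ 2 * ‖ψ‖ ^ 2 ≤ δ / 2 * ‖ψ‖ ^ 2 := by gcongr
    linarith
  have hunit : IsUnit L := by
    refine ContinuousLinearMap.isUnit_of_forall_le_norm_inner_map L
      (c := ⟨δ / 2, by positivity⟩) (by change (0 : ℝ) < δ / 2; positivity) fun ψ => ?_
    rw [norm_inner_symm]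
    exact (hre ψ).trans (Complex.re_le_norm _)
  have hbij := ContinuousLinearMap.isUnit_iff_bijective.1 hunit
  obtain ⟨ψ, hψ, hu⟩ := hbij.existsUnique (T g)
  exact ⟨ψ, hψ, hu⟩

/-- Let `E₀ > 0` be the least shift for which `K + E₀ T²` is nonnegative. If `-E₀` were outside the
spectrum, the bounded resolvent there would leave room for a smaller shift. -/
lemma infSpectrum_neg [CompleteSpace V] (h : FormRep S Q a W T K) {φ : V}
    (hφ : (inner ℂ φ (K φ)).re < 0) {C : ℝ}
    (hC : ∀ ψ, 0 ≤ (inner ℂ ψ (K ψ)).re + C * ‖T ψ‖ ^ 2) : infSpectrum S Q a < 0 := by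
  have hT : ∀ x y, inner ℂ (T x) y = inner ℂ x (T y) := h.symm_T
  have hKs : ∀ x y, inner ℂ (K x) y = inner ℂ x (K y) := h.symm_K
  set A : Set ℝ := {E | ∀ ψ, 0 ≤ (inner ℂ ψ (K ψ)).re + E * ‖T ψ‖ ^ 2} with hA
  have hpos : ∀ E ∈ A, 0 ≤ E := fun E hE => by
    by_contra! hlt
    have := hE φ
    nlinarith [sq_nonneg ‖T φ‖]
  have hbdd : BddBelow A := ⟨0, hpos⟩
  have hne : A.Nonempty := ⟨C, hC⟩
  have hclosed : IsClosed A := by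
    have : A = ⋂ ψ, {E : ℝ | 0 ≤ (inner ℂ ψ (K ψ)).re + E * ‖T ψ‖ ^ 2} := by
      ext; simp [hA]
    rw [this]
    exact isClosed_iInter fun ψ => isClosed_le (by fun_prop) (by fun_prop)
  set E₀ := sInf A with hE₀
  have hmem : E₀ ∈ A := hclosed.csInf_mem hne hbdd
  have hE₀pos : 0 < E₀ := by
    refine lt_of_le_of_ne (hpos _ hmem) fun h0 => ?_
    have := hmem φ
    rw [← h0] at this
    linarith
  have hspec : -E₀ ∈ formSpectrum S Q a := by
    rw [h.mem_formSpectrum_iff]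
    intro hall
    set L : V →L[ℂ] V := K + (E₀ : ℂ) • (T ∘L T) with hL
    have hLapp : ∀ ψ, K ψ - ((-E₀ : ℝ) : ℂ) • T (T ψ) = L ψ := fun ψ => by simp [hL]
    have hLs : ∀ x y, inner ℂ (L x) y = inner ℂ x (L y) := fun x y => by
      simp only [hL, add_apply, smul_apply, ContinuousLinearMap.comp_apply, inner_add_left,
        inner_add_right, inner_smul_left, inner_smul_right, hT, hKs, Complex.conj_ofReal]
    have hLre : ∀ ψ, (inner ℂ ψ (L ψ)).re = (inner ℂ ψ (K ψ)).re + E₀ * ‖T ψ‖ ^ 2 := fun ψ => by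
      simp only [hL, add_apply, smul_apply, ContinuousLinearMap.comp_apply, inner_add_right,
        inner_smul_right, h.inner_comp_self, Complex.add_re, Complex.re_ofReal_mul,
        Complex.ofReal_re]
    simp only [hLapp] at hall
    choose r hr hru using hall
    let R : V →ₗ[ℂ] V :=
      { toFun := fun g => T (r g)
        map_add' := fun x y => by
          rw [← map_add, hru (x + y) (r x + r y) (by simp [hr])]
        map_smul' := fun z x => by
          rw [RingHom.id_apply, ← map_smul, hru (z • x) (z • r x) (by simp [hr])] }
    have hRs : R.IsSymmetric := fun x y => by
      change inner ℂ (T (r x)) y = inner ℂ x (T (r y))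
      rw [hT, ← hT x, ← hr y, ← hr x, hLs]
    -- An everywhere defined symmetric operator is bounded (Hellinger-Toeplitz), so algebraic
    -- bijectivity already yields a bounded resolvent.
    let Rc : V →L[ℂ] V := ⟨R, hRs.continuous⟩
    set B := ‖Rc‖ + 1 with hB
    have hB0 : 0 < B := by positivity
    have hbound : ∀ g, ‖T (r g)‖ ≤ B * ‖g‖ := fun g => by
      have := Rc.le_opNorm g
      change ‖T (r g)‖ ≤ _ at this
      nlinarith [norm_nonneg g]
    -- Expand the nonnegative form of `L` at `ψ - η / B`, where `L η = T (T ψ)`: the cross terms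
    -- give `-2 ‖T ψ‖² / B`, the quadratic term at most `‖T ψ‖² / B`.
    have hlow : E₀ - 1 / B ∈ A := fun ψ => by
      set η := r (T ψ) with hη
      have h1 : inner ℂ ψ (L η) = ((‖T ψ‖ ^ 2 : ℝ) : ℂ) := by
        rw [hη, hr, ← hT, inner_self_eq_norm_sq_to_K]; norm_cast
      have h1' : inner ℂ η (L ψ) = ((‖T ψ‖ ^ 2 : ℝ) : ℂ) := by
        rw [← hLs, ← inner_conj_symm, h1, Complex.conj_ofReal]
      have h2 : (inner ℂ η (L η)).re ≤ B * ‖T ψ‖ ^ 2 := by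
        rw [hη, hr, ← hT]
        calc _ ≤ ‖inner ℂ (T (r (T ψ))) (T ψ)‖ := Complex.re_le_norm _
          _ ≤ ‖T (r (T ψ))‖ * ‖T ψ‖ := norm_inner_le_norm _ _
          _ ≤ (B * ‖T ψ‖) * ‖T ψ‖ := by gcongr; exact hbound _
          _ = _ := by ring
      have h3 : 0 ≤ (inner ℂ (ψ - ((1 / B : ℝ) : ℂ) • η) (L (ψ - ((1 / B : ℝ) : ℂ) • η))).re := by
        rw [hLre]; exact hmem _
      rw [map_sub, map_smul, inner_sub_left, inner_sub_right, inner_sub_right, inner_smul_left,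
        inner_smul_left, inner_smul_right, inner_smul_right, h1, h1', Complex.conj_ofReal] at h3
      simp only [Complex.sub_re, Complex.re_ofReal_mul, Complex.ofReal_re] at h3
      have h4 : 1 / B * (1 / B * (inner ℂ η (L η)).re) ≤ 1 / B * ‖T ψ‖ ^ 2 := by
        have : 1 / B * (B * ‖T ψ‖ ^ 2) = ‖T ψ‖ ^ 2 := by field_simp
        gcongr
        rw [← this]
        gcongr
      rw [hLre] at h3
      linarith
    have := csInf_le hbdd hlow
    have : 0 < 1 / B := by positivity
    linarith
  have hle : infSpectrum S Q a ≤ ((-E₀ : ℝ) : EReal) := sInf_le ⟨_, hspec, rfl⟩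
  exact hle.trans_lt (by exact_mod_cast neg_lt_zero.2 hE₀pos)

end FormRep

end FormOperator

/-! ### Integration along lines of constant total momentum -/

/-- The coordinates `(s, t) ↦ (s - t, t)` of the momentum plane, with total momentum `s`. -/
def shear : ℝ × ℝ ≃ᵐ Plane where
  toFun z := !₂[z.1 - z.2, z.2]
  invFun ξ := (ξ 0 + ξ 1, ξ 1)
  left_inv z := by simp
  right_inv ξ := by ext i; fin_cases i <;> simp
  measurable_toFun := by
    change Measurable fun z : ℝ × ℝ => (!₂[z.1 - z.2, z.2] : Plane)
    fun_prop
  measurable_invFun := by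
    change Measurable fun ξ : Plane => ((ξ 0 + ξ 1, ξ 1) : ℝ × ℝ)
    fun_prop

lemma shear_apply (z : ℝ × ℝ) : shear z = !₂[z.1 - z.2, z.2] := rfl

@[simp] lemma shear_apply_zero (z : ℝ × ℝ) : shear z 0 = z.1 - z.2 := rfl

@[simp] lemma shear_apply_one (z : ℝ × ℝ) : shear z 1 = z.2 := rfl

lemma measurePreserving_pair :
    MeasurePreserving (fun z : ℝ × ℝ => (!₂[z.1, z.2] : Plane)) volume volume := by
  have h1 := (volume_preserving_finTwoArrow ℝ).symm
  exact (PiLp.volume_preserving_toLp (Fin 2)).comp h1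

lemma measurePreserving_shear : MeasurePreserving shear volume volume :=
  measurePreserving_pair.comp (measurePreserving_sub_prod volume volume)

lemma lintegral_shear (f : Plane → ℝ≥0∞) (hf : AEMeasurable f) :
    ∫⁻ s, ∫⁻ t, f (shear (s, t)) = ∫⁻ ξ, f ξ := by
  rw [← measurePreserving_shear.lintegral_comp_emb shear.measurableEmbedding f,
    Measure.volume_eq_prod, lintegral_prod]
  exact hf.comp_quasiMeasurePreserving measurePreserving_shear.quasiMeasurePreserving

/-- Integral over the momenta `(s - t, t)` with total momentum `s`. -/
def fibre (ψ : Plane → ℂ) (s : ℝ) : ℂ := ∫ t, ψ (shear (s, t))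

/-- Cauchy-Schwarz for the factorisation `f = w^(-1/2) · (w^(1/2) f)`. -/
lemma sq_lintegral_le {α : Type*} [MeasurableSpace α] {ν : Measure α} {f w : α → ℝ≥0∞}
    (hf : AEMeasurable f ν) (hw : AEMeasurable w ν) (h0 : ∀ x, w x ≠ 0) (ht : ∀ x, w x ≠ ⊤) :
    (∫⁻ x, f x ∂ν) ^ 2 ≤ (∫⁻ x, (w x)⁻¹ ∂ν) * ∫⁻ x, w x * f x ^ 2 ∂ν := by
  have h := ENNReal.lintegral_mul_le_Lp_mul_Lq ν Real.HolderConjugate.two_two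
    (f := fun x => (w x)⁻¹ ^ (1 / 2 : ℝ)) (g := fun x => w x ^ (1 / 2 : ℝ) * f x)
    (hw.inv.pow_const _) ((hw.pow_const _).mul hf)
  have e1 : (fun x => (w x)⁻¹ ^ (1 / 2 : ℝ)) * (fun x => w x ^ (1 / 2 : ℝ) * f x) = f := by
    ext x
    simp only [Pi.mul_apply]
    rw [← mul_assoc, ← ENNReal.mul_rpow_of_nonneg _ _ (by norm_num),
      ENNReal.inv_mul_cancel (h0 x) (ht x), ENNReal.one_rpow, one_mul]
  have e2 : ∀ x, ((w x)⁻¹ ^ (1 / 2 : ℝ)) ^ (2 : ℝ) = (w x)⁻¹ := fun x => by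
    rw [← ENNReal.rpow_mul]; norm_num
  have e3 : ∀ x, (w x ^ (1 / 2 : ℝ) * f x) ^ (2 : ℝ) = w x * f x ^ 2 := fun x => by
    rw [ENNReal.mul_rpow_of_nonneg _ _ (by norm_num), ← ENNReal.rpow_mul]; norm_num
  rw [e1] at h
  simp only [e2, e3] at h
  calc _ ≤ _ := pow_le_pow_left₀ (zero_le) h 2
    _ = _ := by
      rw [mul_pow, ← ENNReal.rpow_natCast, ← ENNReal.rpow_natCast, ← ENNReal.rpow_mul,
        ← ENNReal.rpow_mul]
      norm_num

section Bound

variable {ψ χ : Plane → ℂ} {w : Plane → ℝ≥0∞} {N : ℝ≥0∞}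

/-- Weighted Cauchy-Schwarz on each fibre, then Tonelli in the sheared coordinates. The constant is
a bound on the fibre integrals of `1 / w`; with the symbol as weight it decides the sign of the
form. -/
lemma lintegral_sq_fibre_le (hψ : AEStronglyMeasurable ψ) (hw : Measurable w) (h0 : ∀ ξ, w ξ ≠ 0)
    (ht : ∀ ξ, w ξ ≠ ⊤) (hN : ∀ s, ∫⁻ t, (w (shear (s, t)))⁻¹ ≤ N) :
    ∫⁻ s, (∫⁻ t, ‖ψ (shear (s, t))‖ₑ) ^ 2 ≤ N * ∫⁻ ξ, w ξ * ‖ψ ξ‖ₑ ^ 2 := by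
  have hm : AEStronglyMeasurable (fun z => ψ (shear z)) (volume.prod volume) :=
    hψ.comp_measurePreserving measurePreserving_shear
  rw [← lintegral_shear (fun ξ => w ξ * ‖ψ ξ‖ₑ ^ 2) (by fun_prop),
    ← lintegral_const_mul'' N]
  · refine lintegral_mono_ae ?_
    filter_upwards [hm.prodMk_left] with s hs
    refine (sq_lintegral_le hs.enorm (w := fun t => w (shear (s, t))) (by fun_prop)
      (fun t => h0 _) fun t => ht _).trans ?_
    gcongr
    exact hN s
  · have : AEMeasurable (fun z => w (shear z) * ‖ψ (shear z)‖ₑ ^ 2) (volume.prod volume) := by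
      have := hm.enorm
      fun_prop
    exact this.lintegral_prod_right'

/-- Since `fibre` is zero by convention where the integral diverges, its additivity requires
convergence on almost every fibre. -/
lemma ae_integrable_shear (hψ : AEStronglyMeasurable ψ) (hw : Measurable w) (h0 : ∀ ξ, w ξ ≠ 0)
    (ht : ∀ ξ, w ξ ≠ ⊤) (hNt : N ≠ ⊤) (hN : ∀ s, ∫⁻ t, (w (shear (s, t)))⁻¹ ≤ N)
    (hfin : ∫⁻ ξ, w ξ * ‖ψ ξ‖ₑ ^ 2 ≠ ⊤) :
    ∀ᵐ s, Integrable fun t => ψ (shear (s, t)) := by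
  have hm : AEStronglyMeasurable (fun z => ψ (shear z)) (volume.prod volume) :=
    hψ.comp_measurePreserving measurePreserving_shear
  have h1 := ((lintegral_sq_fibre_le hψ hw h0 ht hN).trans_lt
    (ENNReal.mul_lt_top hNt.lt_top hfin.lt_top)).ne
  have h2 := ae_lt_top' (hm.enorm.lintegral_prod_right'.pow_const 2) h1
  filter_upwards [hm.prodMk_left, h2] with s hs h3
  exact ⟨hs, by rw [HasFiniteIntegral]; simpa using h3⟩

lemma aestronglyMeasurable_fibre (hψ : AEStronglyMeasurable ψ) :
    AEStronglyMeasurable (fibre ψ) := by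
  have hm : AEStronglyMeasurable (fun z => ψ (shear z)) (volume.prod volume) :=
    hψ.comp_measurePreserving measurePreserving_shear
  exact hm.integral_prod_right'

lemma lintegral_fibre_le (hψ : AEStronglyMeasurable ψ) (hw : Measurable w) (h0 : ∀ ξ, w ξ ≠ 0)
    (ht : ∀ ξ, w ξ ≠ ⊤) (hN : ∀ s, ∫⁻ t, (w (shear (s, t)))⁻¹ ≤ N) :
    ∫⁻ s, ‖fibre ψ s‖ₑ ^ 2 ≤ N * ∫⁻ ξ, w ξ * ‖ψ ξ‖ₑ ^ 2 := by
  refine le_trans ?_ (lintegral_sq_fibre_le hψ hw h0 ht hN)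
  gcongr with s
  exact enorm_integral_le_lintegral_enorm _

lemma memLp_two_iff {α : Type*} [MeasurableSpace α] {ν : Measure α} {f : α → ℂ}
    (hf : AEStronglyMeasurable f ν) : MemLp f 2 ν ↔ ∫⁻ x, ‖f x‖ₑ ^ 2 ∂ν ≠ ⊤ := by
  rw [MemLp, and_iff_right hf, eLpNorm_lt_top_iff_lintegral_rpow_enorm_lt_top (by norm_num)
    (by norm_num), lt_top_iff_ne_top]
  norm_num

lemma memLp_fibre (hψ : AEStronglyMeasurable ψ) (hw : Measurable w) (h0 : ∀ ξ, w ξ ≠ 0)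
    (ht : ∀ ξ, w ξ ≠ ⊤) (hNt : N ≠ ⊤) (hN : ∀ s, ∫⁻ t, (w (shear (s, t)))⁻¹ ≤ N)
    (hfin : ∫⁻ ξ, w ξ * ‖ψ ξ‖ₑ ^ 2 ≠ ⊤) : MemLp (fibre ψ) 2 := by
  rw [memLp_two_iff (aestronglyMeasurable_fibre hψ)]
  exact ((lintegral_fibre_le hψ hw h0 ht hN).trans_lt
    (ENNReal.mul_lt_top hNt.lt_top hfin.lt_top)).ne

lemma fibre_congr (h : ψ =ᵐ[volume] χ) : fibre ψ =ᵐ[volume] fibre χ := by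
  have h1 : ∀ᵐ z ∂((volume : Measure ℝ).prod (volume : Measure ℝ)), ψ (shear z) = χ (shear z) :=
    measurePreserving_shear.quasiMeasurePreserving.ae h
  filter_upwards [Measure.ae_ae_of_ae_prod h1] with s hs
  exact integral_congr_ae hs

lemma fibre_sub (hψ : ∀ᵐ s, Integrable fun t => ψ (shear (s, t)))
    (hχ : ∀ᵐ s, Integrable fun t => χ (shear (s, t))) :
    fibre (fun ξ => ψ ξ - χ ξ) =ᵐ[volume] fun s => fibre ψ s - fibre χ s := by
  filter_upwards [hψ, hχ] with s h1 h2
  exact integral_sub h1 h2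

lemma fibre_add (hψ : ∀ᵐ s, Integrable fun t => ψ (shear (s, t)))
    (hχ : ∀ᵐ s, Integrable fun t => χ (shear (s, t))) :
    fibre (fun ξ => ψ ξ + χ ξ) =ᵐ[volume] fun s => fibre ψ s + fibre χ s := by
  filter_upwards [hψ, hχ] with s h1 h2
  exact integral_add h1 h2

lemma fibre_smul (c : ℂ) (ψ : Plane → ℂ) : fibre (fun ξ => c * ψ ξ) = fun s => c * fibre ψ s := by
  ext s
  exact integral_const_mul _ _

end Bound

/-! ### Traces of Sobolev functions on the diagonal -/

/-- The weight of the Sobolev space `H¹` in Fourier space. -/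
def sobWeight (ξ : Plane) : ℝ≥0∞ := ENNReal.ofReal (1 + ‖ξ‖ ^ 2)

lemma measurable_sobWeight : Measurable sobWeight := by
  unfold sobWeight; fun_prop

lemma sobWeight_ne_zero (ξ : Plane) : sobWeight ξ ≠ 0 := by
  rw [sobWeight, ne_eq, ENNReal.ofReal_eq_zero, not_le]; positivity

lemma sobWeight_ne_top (ξ : Plane) : sobWeight ξ ≠ ⊤ := ENNReal.ofReal_ne_top

lemma one_add_sq_le_norm_sq_shear (s t : ℝ) : 1 + t ^ 2 ≤ 1 + ‖shear (s, t)‖ ^ 2 := by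
  rw [EuclideanSpace.norm_sq_eq, Fin.sum_univ_two]
  simp [sq_nonneg]

lemma lintegral_inv_sobWeight_le (s : ℝ) :
    ∫⁻ t, (sobWeight (shear (s, t)))⁻¹ ≤ ENNReal.ofReal Real.pi := by
  rw [← integral_univ_inv_one_add_sq, ofReal_integral_eq_lintegral_ofReal
    integrable_inv_one_add_sq (ae_of_all _ fun t => by positivity)]
  refine lintegral_mono fun t => ?_
  rw [ENNReal.ofReal_inv_of_pos (by positivity)]
  exact ENNReal.inv_le_inv.2 (ENNReal.ofReal_le_ofReal (one_add_sq_le_norm_sq_shear s t))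

/-- Restriction of Schwartz functions to the diagonal. -/
def diagRestrict (φ : 𝓢(Plane, ℂ)) : 𝓢(ℝ, ℂ) :=
  let L : ℝ →ₗ[ℝ] Plane :=
    { toFun := fun x => !₂[x, x]
      map_add' := fun x y => by ext i; fin_cases i <;> simp
      map_smul' := fun c x => by ext i; fin_cases i <;> simp }
  SchwartzMap.compCLMOfAntilipschitz (K := 1) ℂ (g := L)
    (LinearMap.toContinuousLinearMap L).hasTemperateGrowth
    (AddMonoidHomClass.antilipschitz_of_bound L fun x => by
      simp only [NNReal.coe_one, one_mul]
      have h : ‖L x‖ ^ 2 = x ^ 2 + x ^ 2 := by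
        rw [EuclideanSpace.norm_sq_eq, Fin.sum_univ_two]
        simp [L]
      refine abs_le_of_sq_le_sq' ?_ (norm_nonneg _) |> fun h => abs_le.2 h
      nlinarith [sq_nonneg x]) φ

lemma diagRestrict_apply (φ : 𝓢(Plane, ℂ)) (x : ℝ) : diagRestrict φ x = φ !₂[x, x] := rfl

section Schwartz

variable (χ : 𝓢(Plane, ℂ))

/-- A majorant that is integrable in `t` and uniform in `s`; it makes `fibre χ` continuous by
dominated convergence. -/
lemma exists_shear_bound : ∃ C : ℝ, ∀ s t, ‖χ (shear (s, t))‖ ≤ C * (1 + t ^ 2)⁻¹ := by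
  obtain ⟨C₀, h0⟩ := χ.decay 0 0
  obtain ⟨C₂, h2⟩ := χ.decay 2 0
  refine ⟨C₀ + C₂, fun s t => ?_⟩
  have a := h0.2 (shear (s, t))
  have b := h2.2 (shear (s, t))
  simp only [norm_iteratedFDeriv_zero, pow_zero, one_mul] at a b
  rw [← div_eq_mul_inv, le_div_iff₀ (by positivity), mul_comm]
  calc _ ≤ (1 + ‖shear (s, t)‖ ^ 2) * ‖χ (shear (s, t))‖ := by
        gcongr ?_ * _; exact one_add_sq_le_norm_sq_shear s t
    _ ≤ _ := by linarith

lemma continuous_shear : Continuous shear := by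
  change Continuous fun z : ℝ × ℝ => (!₂[z.1 - z.2, z.2] : Plane)
  fun_prop

lemma continuous_fibre : Continuous (fibre χ) := by
  obtain ⟨C, hC⟩ := exists_shear_bound χ
  refine continuous_of_dominated (bound := fun t => C * (1 + t ^ 2)⁻¹) (fun s => ?_)
    (fun s => ae_of_all _ fun t => hC s t) (integrable_inv_one_add_sq.const_mul C)
    (ae_of_all _ fun t => ?_)
  · exact (χ.continuous.comp (continuous_shear.comp (by fun_prop))).aestronglyMeasurable
  · exact χ.continuous.comp (continuous_shear.comp (by fun_prop))

lemma integrable_comp_shear : Integrable (fun z => χ (shear z)) (volume.prod volume) :=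
  (measurePreserving_shear.integrable_comp_emb shear.measurableEmbedding).2 χ.integrable

lemma integrable_fibre : Integrable (fibre χ) := (integrable_comp_shear χ).integral_prod_left

lemma integrable_shear (s : ℝ) : Integrable fun t => χ (shear (s, t)) := by
  obtain ⟨C, hC⟩ := exists_shear_bound χ
  exact (integrable_inv_one_add_sq.const_mul C).mono'
    (χ.continuous.comp (continuous_shear.comp (by fun_prop))).aestronglyMeasurable
    (ae_of_all _ fun t => hC s t)

/-- At the point `(x, x)` the phase depends only on the total momentum, so Fubini in the sheared
coordinates integrates out `t`. -/
lemma fourierInv_fibre (x : ℝ) : 𝓕⁻ (fibre χ) x = (𝓕⁻ χ : 𝓢(Plane, ℂ)) !₂[x, x] := by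
  rw [SchwartzMap.fourierInv_coe, Real.fourierInv_eq, Real.fourierInv_eq,
    ← measurePreserving_shear.integral_comp', Measure.volume_eq_prod, integral_prod]
  · refine integral_congr_ae (ae_of_all _ fun s => ?_)
    simp only [fibre, Circle.smul_def, smul_eq_mul]
    rw [← integral_const_mul]
    refine integral_congr_ae (ae_of_all _ fun t => ?_)
    simp only
    congr 3
    simp [PiLp.inner_apply, Fin.sum_univ_two]
    ring
  · have h := (Real.fourierIntegral_convergent_iff (f := χ) (μ := volume)
      (-!₂[x, x] : Plane)).2 χ.integrable
    have h' : Integrable (fun ξ : Plane => Real.fourierChar (inner ℝ ξ !₂[x, x]) • χ ξ) := by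
      simpa using h
    exact (measurePreserving_shear.integrable_comp_emb shear.measurableEmbedding).2 h'

lemma fourier_diagRestrict (φ : 𝓢(Plane, ℂ)) (s : ℝ) :
    (𝓕 (diagRestrict φ) : 𝓢(ℝ, ℂ)) s = fibre (𝓕 φ : 𝓢(Plane, ℂ)) s := by
  have h1 : 𝓕⁻ (fibre (𝓕 φ : 𝓢(Plane, ℂ))) = diagRestrict φ := by
    ext x
    rw [fourierInv_fibre, FourierTransform.fourierInv_fourier_eq, diagRestrict_apply]
  -- Inversion needs an integrable transform; this transform is the reflected diagonal restriction
  -- of `φ`, which is Schwartz.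
  have h2 : Integrable (𝓕 (fibre (𝓕 φ : 𝓢(Plane, ℂ)))) := by
    have h3 : 𝓕 (fibre (𝓕 φ : 𝓢(Plane, ℂ))) = fun x => diagRestrict φ (-x) := by
      ext x
      rw [← h1, Real.fourierInv_eq_fourier_neg, neg_neg]
    rw [h3]
    exact (diagRestrict φ).integrable.comp_neg
  rw [SchwartzMap.fourier_coe, ← h1,
    (continuous_fibre _).fourier_fourierInv_eq (integrable_fibre _) h2]

end Schwartz

section Trace

/-- The measure with density `sobWeight`. -/
def sobMeasure : Measure Plane := volume.withDensity sobWeight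

instance : IsLocallyFiniteMeasure sobMeasure :=
  IsLocallyFiniteMeasure.withDensity_ofReal (by fun_prop)

instance : sobMeasure.HasTemperateGrowth := by
  -- The density grows quadratically, so decay of order five leaves order three, integrable in
  -- dimension two.
  refine ⟨5, ?_⟩
  rw [sobMeasure, integrable_withDensity_iff measurable_sobWeight
    (ae_of_all _ fun ξ => (sobWeight_ne_top ξ).lt_top)]
  have h : Integrable (fun ξ : Plane => (1 + ‖ξ‖) ^ (-(3 : ℝ))) :=
    integrable_one_add_norm (by norm_num)
  refine h.mono' (by unfold sobWeight; fun_prop) (ae_of_all _ fun ξ => ?_)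
  have h0 : 0 < 1 + ‖ξ‖ := by positivity
  rw [sobWeight, ENNReal.toReal_ofReal (by positivity), Real.norm_of_nonneg (by positivity),
    show (-(3 : ℝ)) = -((5 : ℕ) : ℝ) + 2 by norm_num, Real.rpow_add h0]
  gcongr
  norm_num
  nlinarith [norm_nonneg ξ]

lemma eLpNorm_two_sq {α : Type*} [MeasurableSpace α] {ν : Measure α} (f : α → ℂ) :
    eLpNorm f 2 ν ^ 2 = ∫⁻ x, ‖f x‖ₑ ^ 2 ∂ν := by
  simpa using eLpNorm_nnreal_pow_eq_lintegral (f := f) (μ := ν) (p := 2) (by norm_num)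

/-- In Fourier space `H¹` is the `L²` space of `sobMeasure`, a measure of temperate growth, in which
Schwartz functions are dense. -/
lemma exists_schwartz_tendsto {ψ : Plane → ℂ} (hψ : AEStronglyMeasurable ψ)
    (hfin : ∫⁻ ξ, sobWeight ξ * ‖ψ ξ‖ₑ ^ 2 ≠ ⊤) : ∃ χ : ℕ → 𝓢(Plane, ℂ),
      Tendsto (fun n => ∫⁻ ξ, sobWeight ξ * ‖χ n ξ - ψ ξ‖ₑ ^ 2) atTop (𝓝 0) := by
  have hac : sobMeasure ≪ volume := withDensity_absolutelyContinuous _ _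
  have key : ∀ f : Plane → ℂ, AEStronglyMeasurable f →
      ∫⁻ ξ, ‖f ξ‖ₑ ^ 2 ∂sobMeasure = ∫⁻ ξ, sobWeight ξ * ‖f ξ‖ₑ ^ 2 := fun f hf => by
    rw [sobMeasure, lintegral_withDensity_eq_lintegral_mul₀ measurable_sobWeight.aemeasurable
      (by fun_prop)]
    rfl
  have hmem : MemLp ψ 2 sobMeasure := by
    rw [memLp_two_iff (hψ.mono_ac hac), key ψ hψ]
    exact hfin
  obtain ⟨x, hx, hlim⟩ := mem_closure_iff_seq_limit.1
    ((SchwartzMap.denseRange_toLpCLM (μ := sobMeasure) (F := ℂ) (p := 2) (by simp)) hmem.toLp)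
  choose χ hχ using hx
  refine ⟨χ, ?_⟩
  have h1 := (Lp.tendsto_Lp_iff_tendsto_eLpNorm' x hmem.toLp).1 hlim
  have h2 : ∀ n, eLpNorm (⇑(x n) - ⇑hmem.toLp) 2 sobMeasure ^ 2 =
      ∫⁻ ξ, sobWeight ξ * ‖χ n ξ - ψ ξ‖ₑ ^ 2 := fun n => by
    have : ⇑(x n) - ⇑hmem.toLp =ᵐ[sobMeasure] fun ξ => χ n ξ - ψ ξ := by
      rw [← hχ n]
      filter_upwards [(χ n).coeFn_toLp 2 sobMeasure, hmem.coeFn_toLp] with ξ h3 h4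
      simp [h3, h4]
    have h5 := key (fun ξ => χ n ξ - ψ ξ) ((χ n).continuous.aestronglyMeasurable.sub hψ)
    rw [eLpNorm_congr_ae this, ← h5, eLpNorm_two_sq]
  simp only [← h2]
  simpa using ENNReal.Tendsto.pow (n := 2) h1

variable {U : L2Plane}

/-- By Plancherel the error of the trace is the `fibre` of the error in Fourier space, controlled by
the `H¹` norm. All approximating sequences thus give the same limit, so the choice made in
`diagTrace` is harmless. -/
lemma tendsto_fibre (hU : ∫⁻ ξ, sobWeight ξ * ‖(𝓕 U : L2Plane) ξ‖ₑ ^ 2 ≠ ⊤)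
    {φ : ℕ → 𝓢(Plane, ℂ)}
    (hφ : Tendsto (fun n => ∫⁻ ξ, sobWeight ξ * ‖𝓕 (φ n) ξ - (𝓕 U : L2Plane) ξ‖ₑ ^ 2)
      atTop (𝓝 0)) {g : Lp ℂ 2 (volume : Measure ℝ)}
    (hg : (𝓕 g : Lp ℂ 2 (volume : Measure ℝ)) =ᵐ[volume] fibre (𝓕 U : L2Plane)) :
    Tendsto (fun n => eLpNorm (fun x : ℝ => φ n !₂[x, x] - g x) 2 volume) atTop (𝓝 0) := by
  have hm := (Lp.aestronglyMeasurable (𝓕 U : L2Plane))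
  have hint := ae_integrable_shear hm measurable_sobWeight sobWeight_ne_zero sobWeight_ne_top
    ENNReal.ofReal_ne_top lintegral_inv_sobWeight_le hU
  have h1 : ∀ n, eLpNorm (fun x : ℝ => φ n !₂[x, x] - g x) 2 volume ^ 2 ≤
      ENNReal.ofReal Real.pi *
        ∫⁻ ξ, sobWeight ξ * ‖𝓕 (φ n) ξ - (𝓕 U : L2Plane) ξ‖ₑ ^ 2 := fun n => by
    set D : Lp ℂ 2 (volume : Measure ℝ) := (diagRestrict (φ n)).toLp 2 with hD
    set D' : Lp ℂ 2 (volume : Measure ℝ) := (𝓕 (diagRestrict (φ n))).toLp 2 with hD'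
    have e1 : eLpNorm (fun x : ℝ => φ n !₂[x, x] - g x) 2 volume = ‖D - g‖ₑ := by
      rw [Lp.enorm_def]
      refine eLpNorm_congr_ae ?_
      filter_upwards [(diagRestrict (φ n)).coeFn_toLp 2 volume, Lp.coeFn_sub D g] with x h3 h4
      rw [h4, Pi.sub_apply, h3, diagRestrict_apply]
    have e2 : ‖D - g‖ₑ = eLpNorm (fibre fun ξ => 𝓕 (φ n) ξ - (𝓕 U : L2Plane) ξ) 2 volume := by
      have e3 : ‖D - g‖ₑ = ‖D' - 𝓕 g‖ₑ := by
        have e4 : (𝓕 (D - g) : Lp ℂ 2 (volume : Measure ℝ)) = D' - 𝓕 g := by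
          rw [hD', ← SchwartzMap.toLp_fourier_eq]
          exact map_sub (Lp.fourierTransformₗᵢ ℝ ℂ) D g
        rw [← e4]
        exact ((Lp.fourierTransformₗᵢ ℝ ℂ).toLinearIsometry.enorm_map _).symm
      rw [e3, Lp.enorm_def]
      refine eLpNorm_congr_ae ?_
      filter_upwards [(𝓕 (diagRestrict (φ n))).coeFn_toLp 2 volume, hg, Lp.coeFn_sub D' (𝓕 g),
        fibre_sub (ae_of_all _ (integrable_shear (𝓕 (φ n)))) hint] with s h3 h4 h5 h6
      rw [h5, Pi.sub_apply, h3, h4, fourier_diagRestrict, ← h6]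
    rw [e1, e2, eLpNorm_two_sq]
    exact lintegral_fibre_le (ψ := fun ξ => 𝓕 (φ n) ξ - (𝓕 U : L2Plane) ξ)
      ((𝓕 (φ n)).continuous.aestronglyMeasurable.sub hm) measurable_sobWeight
      sobWeight_ne_zero sobWeight_ne_top lintegral_inv_sobWeight_le
  have h2 : Tendsto (fun n => eLpNorm (fun x : ℝ => φ n !₂[x, x] - g x) 2 volume ^ 2)
      atTop (𝓝 0) := by
    refine tendsto_of_tendsto_of_tendsto_of_le_of_le tendsto_const_nhds ?_
      (fun n => zero_le) h1
    simpa using ENNReal.Tendsto.const_mul hφ (Or.inr ENNReal.ofReal_ne_top)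
  have h3 := h2.ennrpow_const (1 / 2 : ℝ)
  have h4 : ∀ x : ℝ≥0∞, (x ^ 2) ^ (1 / 2 : ℝ) = x := fun x => by
    rw [← ENNReal.rpow_natCast, ← ENNReal.rpow_mul]
    norm_num
  simp only [h4] at h3
  rwa [ENNReal.zero_rpow_of_pos (by norm_num)] at h3

lemma memLp_fibre_fourier (hU : ∫⁻ ξ, sobWeight ξ * ‖(𝓕 U : L2Plane) ξ‖ₑ ^ 2 ≠ ⊤) :
    MemLp (fibre (𝓕 U : L2Plane)) 2 :=
  memLp_fibre (Lp.aestronglyMeasurable _) measurable_sobWeight sobWeight_ne_zero sobWeight_ne_top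
    ENNReal.ofReal_ne_top lintegral_inv_sobWeight_le hU

/-- The trace on the diagonal is given by integration over the fibres of constant total momentum. -/
theorem diagTrace_eq (hU : ∫⁻ ξ, sobWeight ξ * ‖(𝓕 U : L2Plane) ξ‖ₑ ^ 2 ≠ ⊤) :
    diagTrace U = 𝓕⁻ ((memLp_fibre_fourier hU).toLp : Lp ℂ 2 (volume : Measure ℝ)) := by
  set g₀ : Lp ℂ 2 (volume : Measure ℝ) := 𝓕⁻ (memLp_fibre_fourier hU).toLp with hg₀
  have hg : (𝓕 g₀ : Lp ℂ 2 (volume : Measure ℝ)) =ᵐ[volume] fibre (𝓕 U : L2Plane) := by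
    rw [hg₀, FourierTransform.fourier_fourierInv_eq]
    exact MemLp.coeFn_toLp _
  have hex : ∃ g, IsDiagTrace U g := by
    obtain ⟨χ, hχ⟩ := exists_schwartz_tendsto (Lp.aestronglyMeasurable (𝓕 U : L2Plane)) hU
    have hχ' : Tendsto (fun n => ∫⁻ ξ, sobWeight ξ *
        ‖𝓕 (𝓕⁻ (χ n) : 𝓢(Plane, ℂ)) ξ - (𝓕 U : L2Plane) ξ‖ₑ ^ 2) atTop (𝓝 0) := by
      simpa only [FourierTransform.fourier_fourierInv_eq] using hχ
    exact ⟨g₀, fun n => 𝓕⁻ (χ n), hχ', tendsto_fibre hU hχ' hg⟩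
  rw [diagTrace, dif_pos hex]
  obtain ⟨φ, hφ1, hφ2⟩ := hex.choose_spec
  have hlim := tendsto_fibre hU hφ1 hg
  have h1 : ∀ f : Lp ℂ 2 (volume : Measure ℝ),
      Tendsto (fun n => eLpNorm (fun x : ℝ => φ n !₂[x, x] - f x) 2 volume) atTop (𝓝 0) →
      Tendsto (fun n => (diagRestrict (φ n)).toLp 2) atTop (𝓝 f) := fun f hf => by
    rw [Lp.tendsto_Lp_iff_tendsto_eLpNorm']
    refine hf.congr fun n => eLpNorm_congr_ae ?_
    filter_upwards [(diagRestrict (φ n)).coeFn_toLp 2 volume] with x h3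
    rw [Pi.sub_apply, h3, diagRestrict_apply]
  exact tendsto_nhds_unique (h1 _ hφ2) (h1 _ hlim)

end Trace

/-! ### Multiplication operators on `L²` -/

section Multiplication

variable {α : Type*} [MeasurableSpace α] {ν : Measure α}

lemma memLp_mul_bounded {b : α → ℝ} (hb : Measurable b) {C : ℝ} (hC : ∀ x, |b x| ≤ C)
    {f : α → ℂ} (hf : MemLp f 2 ν) : MemLp (fun x => (b x : ℂ) * f x) 2 ν := by
  refine (hf.const_mul (C : ℂ)).mono ?_ (ae_of_all _ fun x => ?_)
  · exact (Complex.measurable_ofReal.comp hb).aestronglyMeasurable.mul hf.1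
  · rw [norm_mul, norm_mul, Complex.norm_real, Complex.norm_real]
    gcongr
    exact (hC x).trans (le_abs_self C)

/-- Multiplication by a bounded real function on `L²`. -/
def mulCLM (b : α → ℝ) (hb : Measurable b) (C : ℝ) (hC : ∀ x, |b x| ≤ C) :
    Lp ℂ 2 ν →L[ℂ] Lp ℂ 2 ν :=
  LinearMap.mkContinuous
    { toFun := fun f => (memLp_mul_bounded hb hC (Lp.memLp f)).toLp
      map_add' := fun f g => by
        ext1
        filter_upwards [(memLp_mul_bounded hb hC (Lp.memLp (f + g))).coeFn_toLp,
          (memLp_mul_bounded hb hC (Lp.memLp f)).coeFn_toLp,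
          (memLp_mul_bounded hb hC (Lp.memLp g)).coeFn_toLp, Lp.coeFn_add f g,
          Lp.coeFn_add (memLp_mul_bounded hb hC (Lp.memLp f)).toLp
            (memLp_mul_bounded hb hC (Lp.memLp g)).toLp] with x h1 h2 h3 h4 h5
        rw [h1, h5, Pi.add_apply, h2, h3, h4, Pi.add_apply, mul_add]
      map_smul' := fun c f => by
        ext1
        filter_upwards [(memLp_mul_bounded hb hC (Lp.memLp (c • f))).coeFn_toLp,
          (memLp_mul_bounded hb hC (Lp.memLp f)).coeFn_toLp, Lp.coeFn_smul c f,
          Lp.coeFn_smul c (memLp_mul_bounded hb hC (Lp.memLp f)).toLp] with x h1 h2 h3 h4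
        rw [h1, RingHom.id_apply, h4, Pi.smul_apply, h2, h3, Pi.smul_apply, smul_eq_mul,
          smul_eq_mul]
        ring } C
    (fun f => by
      refine Lp.norm_le_mul_norm_of_ae_le_mul ?_
      filter_upwards [(memLp_mul_bounded hb hC (Lp.memLp f)).coeFn_toLp] with x h1
      change ‖(memLp_mul_bounded hb hC (Lp.memLp f)).toLp _ x‖ ≤ _
      rw [h1, norm_mul, Complex.norm_real]
      gcongr
      exact hC x)

lemma coeFn_mulCLM (b : α → ℝ) (hb : Measurable b) (C : ℝ) (hC : ∀ x, |b x| ≤ C)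
    (f : Lp ℂ 2 ν) : mulCLM b hb C hC f =ᵐ[ν] fun x => (b x : ℂ) * f x :=
  (memLp_mul_bounded hb hC (Lp.memLp f)).coeFn_toLp

lemma mulCLM_symm (b : α → ℝ) (hb : Measurable b) (C : ℝ) (hC : ∀ x, |b x| ≤ C)
    (f g : Lp ℂ 2 ν) : inner ℂ (mulCLM b hb C hC f) g = inner ℂ f (mulCLM b hb C hC g) := by
  rw [L2.inner_def, L2.inner_def]
  refine integral_congr_ae ?_
  filter_upwards [coeFn_mulCLM b hb C hC f, coeFn_mulCLM b hb C hC g] with x h1 h2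
  simp only [h1, h2, RCLike.inner_apply, map_mul, Complex.conj_ofReal]
  ring

lemma L2_inner_eq (f g : Lp ℂ 2 ν) :
    inner ℂ f g = ∫ x, starRingEnd ℂ (f x) * g x ∂ν := by
  rw [L2.inner_def]
  refine integral_congr_ae (ae_of_all _ fun x => ?_)
  simp only [RCLike.inner_apply]
  ring

lemma L2_norm_sq_eq (f : Lp ℂ 2 ν) : ‖f‖ ^ 2 = ∫ x, ‖f x‖ ^ 2 ∂ν := by
  have h : (inner ℂ f f : ℂ) = ((∫ x, ‖f x‖ ^ 2 ∂ν : ℝ) : ℂ) := by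
    rw [L2_inner_eq, ← integral_complex_ofReal]
    refine integral_congr_ae (ae_of_all _ fun x => ?_)
    simp only
    rw [← Complex.normSq_eq_conj_mul_self, Complex.normSq_eq_norm_sq]
  rw [inner_self_eq_norm_sq_to_K] at h
  exact Complex.ofReal_injective (by rw [← h]; norm_cast)

lemma L2_norm_sq_toLp {f : α → ℂ} (hf : MemLp f 2 ν) : ‖hf.toLp‖ ^ 2 = ∫ x, ‖f x‖ ^ 2 ∂ν := by
  rw [L2_norm_sq_eq]
  refine integral_congr_ae ?_
  filter_upwards [hf.coeFn_toLp] with x hx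
  rw [hx]

lemma integrable_sq_of_memLp {f : α → ℂ} (hf : MemLp f 2 ν) :
    Integrable (fun x => ‖f x‖ ^ 2) ν := by
  simpa using hf.integrable_norm_rpow (by norm_num) (by norm_num)

lemma lintegral_mul_sq_eq {f : α → ℂ} {w : α → ℝ} (hw : ∀ x, 0 ≤ w x)
    (hi : Integrable (fun x => w x * ‖f x‖ ^ 2) ν) :
    ∫⁻ x, ENNReal.ofReal (w x) * ‖f x‖ₑ ^ 2 ∂ν = ENNReal.ofReal (∫ x, w x * ‖f x‖ ^ 2 ∂ν) := by
  rw [ofReal_integral_eq_lintegral_ofReal hi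
    (ae_of_all _ fun x => mul_nonneg (hw x) (sq_nonneg _))]
  refine lintegral_congr fun x => ?_
  rw [ENNReal.ofReal_mul (hw x), ENNReal.ofReal_pow (norm_nonneg _), ofReal_norm]

end Multiplication

/-! ### Elliptic symbols and the factors of the Birman-Schwinger operator -/

/-- A real function on momentum space that is comparable from below to `1 + |ξ|²`. -/
structure IsElliptic (m : Plane → ℝ) : Prop where
  measurable : Measurable m
  exists_le : ∃ c : ℝ, 0 < c ∧ ∀ ξ, c * (1 + ‖ξ‖ ^ 2) ≤ m ξ

namespace IsElliptic

variable {m : Plane → ℝ} (hm : IsElliptic m)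
include hm

lemma pos (ξ : Plane) : 0 < m ξ := by
  obtain ⟨c, hc, h⟩ := hm.exists_le
  exact lt_of_lt_of_le (by positivity) (h ξ)

lemma lintegral_sobWeight_ne_top {ψ : Plane → ℂ} (hψ : Integrable fun ξ => m ξ * ‖ψ ξ‖ ^ 2) :
    ∫⁻ ξ, sobWeight ξ * ‖ψ ξ‖ₑ ^ 2 ≠ ⊤ := by
  obtain ⟨c, hc, h⟩ := hm.exists_le
  have h1 : ∫⁻ ξ, ENNReal.ofReal (c⁻¹ * m ξ) * ‖ψ ξ‖ₑ ^ 2 ≠ ⊤ := by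
    rw [lintegral_mul_sq_eq (fun ξ => mul_nonneg (inv_nonneg.2 hc.le) (hm.pos ξ).le)]
    · exact ENNReal.ofReal_ne_top
    · simpa only [mul_assoc] using hψ.const_mul c⁻¹
  refine ne_top_of_le_ne_top h1 (lintegral_mono fun ξ => ?_)
  simp only [sobWeight]
  gcongr
  rw [le_inv_mul_iff₀ hc]
  exact h ξ

lemma exists_inv_sqrt_bound : ∃ C : ℝ, ∀ ξ, |(√(m ξ))⁻¹| ≤ C := by
  obtain ⟨c, hc, h⟩ := hm.exists_le
  refine ⟨(√c)⁻¹, fun ξ => ?_⟩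
  rw [abs_of_nonneg (by positivity)]
  gcongr
  nlinarith [h ξ, sq_nonneg ‖ξ‖]

/-- Multiplication by `m ^ (-1/2)`. -/
def invSqrt : L2Plane →L[ℂ] L2Plane :=
  mulCLM (fun ξ => (√(m ξ))⁻¹) (hm.measurable.sqrt.inv) hm.exists_inv_sqrt_bound.choose
    hm.exists_inv_sqrt_bound.choose_spec

lemma coeFn_invSqrt (φ : L2Plane) :
    hm.invSqrt φ =ᵐ[volume] fun ξ => (((√(m ξ))⁻¹ : ℝ) : ℂ) * φ ξ :=
  coeFn_mulCLM _ _ _ _ _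

lemma invSqrt_symm (φ ψ : L2Plane) :
    inner ℂ (hm.invSqrt φ) ψ = inner ℂ φ (hm.invSqrt ψ) :=
  mulCLM_symm _ hm.measurable.sqrt.inv hm.exists_inv_sqrt_bound.choose
    hm.exists_inv_sqrt_bound.choose_spec φ ψ

lemma mul_norm_sq_invSqrt (φ : L2Plane) :
    (fun ξ => m ξ * ‖hm.invSqrt φ ξ‖ ^ 2) =ᵐ[volume] fun ξ => ‖φ ξ‖ ^ 2 := by
  filter_upwards [hm.coeFn_invSqrt φ] with ξ h
  rw [h, norm_mul, Complex.norm_real, mul_pow, Real.norm_eq_abs, sq_abs, inv_pow,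
    Real.sq_sqrt (hm.pos ξ).le, mul_inv_cancel_left₀ (hm.pos ξ).ne']

lemma integrable_invSqrt (φ : L2Plane) : Integrable fun ξ => m ξ * ‖hm.invSqrt φ ξ‖ ^ 2 :=
  (integrable_sq_of_memLp (Lp.memLp φ)).congr (hm.mul_norm_sq_invSqrt φ).symm

lemma integral_invSqrt (φ : L2Plane) : ∫ ξ, m ξ * ‖hm.invSqrt φ ξ‖ ^ 2 = ‖φ‖ ^ 2 := by
  rw [L2_norm_sq_eq, integral_congr_ae (hm.mul_norm_sq_invSqrt φ)]

lemma integral_conj_invSqrt (φ ψ : L2Plane) :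
    ∫ ξ, (m ξ : ℂ) * (starRingEnd ℂ (hm.invSqrt φ ξ) * hm.invSqrt ψ ξ) = inner ℂ φ ψ := by
  rw [L2_inner_eq]
  refine integral_congr_ae ?_
  filter_upwards [hm.coeFn_invSqrt φ, hm.coeFn_invSqrt ψ] with ξ h1 h2
  rw [h1, h2, map_mul, Complex.conj_ofReal]
  have h3 : (m ξ : ℂ) * ((((√(m ξ))⁻¹ : ℝ) : ℂ) * (((√(m ξ))⁻¹ : ℝ) : ℂ)) = 1 := by
    rw [← Complex.ofReal_mul, ← Complex.ofReal_mul, ← mul_inv, Real.mul_self_sqrt (hm.pos ξ).le,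
      mul_inv_cancel₀ (hm.pos ξ).ne', Complex.ofReal_one]
  linear_combination (starRingEnd ℂ (φ ξ) * ψ ξ) * h3

lemma injective_invSqrt : Function.Injective hm.invSqrt := by
  intro φ ψ h
  ext1
  filter_upwards [hm.coeFn_invSqrt φ, hm.coeFn_invSqrt ψ] with ξ h1 h2
  rw [h, h2] at h1
  have h3 : (((√(m ξ))⁻¹ : ℝ) : ℂ) ≠ 0 := by
    have := Real.sqrt_pos.2 (hm.pos ξ)
    exact_mod_cast (inv_pos.2 this).ne'
  exact (mul_left_cancel₀ h3 h1).symm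

/-- The form domain is contained in the range of `m^(-1/2)`: finiteness of the form is square
integrability of the preimage `m^(1/2) ψ`. -/
lemma exists_invSqrt_eq {ψ : L2Plane} (hψ : Integrable fun ξ => m ξ * ‖ψ ξ‖ ^ 2) :
    ∃ φ : L2Plane, (φ =ᵐ[volume] fun ξ => ((√(m ξ) : ℝ) : ℂ) * ψ ξ) ∧ hm.invSqrt φ = ψ := by
  have hmem : MemLp (fun ξ => ((√(m ξ) : ℝ) : ℂ) * ψ ξ) 2 := by
    rw [memLp_two_iff]
    · have h1 := lintegral_mul_sq_eq (fun ξ => (hm.pos ξ).le) hψ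
      have h2 : ∀ ξ, ‖((√(m ξ) : ℝ) : ℂ) * ψ ξ‖ₑ ^ 2 = ENNReal.ofReal (m ξ) * ‖ψ ξ‖ₑ ^ 2 :=
        fun ξ => by
          rw [enorm_mul, mul_pow, ← ofReal_norm, Complex.norm_real, Real.norm_eq_abs,
            abs_of_nonneg (Real.sqrt_nonneg _), ← ENNReal.ofReal_pow (Real.sqrt_nonneg _),
            Real.sq_sqrt (hm.pos ξ).le]
      simp only [h2, h1]
      exact ENNReal.ofReal_ne_top
    · exact (Complex.measurable_ofReal.comp hm.measurable.sqrt).aestronglyMeasurable.mul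
        (Lp.aestronglyMeasurable ψ)
  refine ⟨hmem.toLp, hmem.coeFn_toLp, ?_⟩
  ext1
  filter_upwards [hm.coeFn_invSqrt hmem.toLp, hmem.coeFn_toLp] with ξ h1 h2
  rw [h1, h2, ← mul_assoc, ← Complex.ofReal_mul,
    inv_mul_cancel₀ (Real.sqrt_pos.2 (hm.pos ξ)).ne', Complex.ofReal_one, one_mul]

lemma ae_integrable_shear' {ψ : L2Plane} (hψ : Integrable fun ξ => m ξ * ‖ψ ξ‖ ^ 2) :
    ∀ᵐ s, Integrable fun t => ψ (shear (s, t)) :=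
  ae_integrable_shear (Lp.aestronglyMeasurable ψ) measurable_sobWeight sobWeight_ne_zero
    sobWeight_ne_top ENNReal.ofReal_ne_top lintegral_inv_sobWeight_le
    (hm.lintegral_sobWeight_ne_top hψ)

lemma memLp_fibre' {ψ : L2Plane} (hψ : Integrable fun ξ => m ξ * ‖ψ ξ‖ ^ 2) :
    MemLp (fibre ψ) 2 :=
  memLp_fibre (Lp.aestronglyMeasurable ψ) measurable_sobWeight sobWeight_ne_zero
    sobWeight_ne_top ENNReal.ofReal_ne_top lintegral_inv_sobWeight_le
    (hm.lintegral_sobWeight_ne_top hψ)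

/-- Here the weight is `m` itself rather than the Sobolev weight, which keeps the sharp constant. -/
lemma integral_fibre_le {ψ : L2Plane} (hψ : Integrable fun ξ => m ξ * ‖ψ ξ‖ ^ 2) {N : ℝ}
    (hN0 : 0 ≤ N)
    (hN : ∀ s, ∫⁻ t, (ENNReal.ofReal (m (shear (s, t))))⁻¹ ≤ ENNReal.ofReal N) :
    ∫ s, ‖fibre ψ s‖ ^ 2 ≤ N * ∫ ξ, m ξ * ‖ψ ξ‖ ^ 2 := by
  have h1 := lintegral_fibre_le (Lp.aestronglyMeasurable ψ) (w := fun ξ => ENNReal.ofReal (m ξ))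
    (by have := hm.measurable; fun_prop) (fun ξ => by simp [hm.pos ξ])
    (fun ξ => ENNReal.ofReal_ne_top) hN
  have h2 : ∫⁻ s, ‖fibre ψ s‖ₑ ^ 2 = ENNReal.ofReal (∫ s, ‖fibre ψ s‖ ^ 2) := by
    have := lintegral_mul_sq_eq (f := fibre ψ) (w := fun _ => (1 : ℝ)) (ν := volume)
      (fun _ => zero_le_one) (by simpa using integrable_sq_of_memLp (hm.memLp_fibre' hψ))
    simpa using this
  rw [h2, lintegral_mul_sq_eq (fun ξ => (hm.pos ξ).le) hψ, ← ENNReal.ofReal_mul hN0] at h1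
  exact (ENNReal.ofReal_le_ofReal_iff (mul_nonneg hN0
    (integral_nonneg fun ξ => mul_nonneg (hm.pos ξ).le (sq_nonneg _)))).1 h1

lemma exists_lintegral_inv_le : ∃ N : ℝ, 0 ≤ N ∧
    ∀ s, ∫⁻ t, (ENNReal.ofReal (m (shear (s, t))))⁻¹ ≤ ENNReal.ofReal N := by
  obtain ⟨c, hc, h⟩ := hm.exists_le
  refine ⟨c⁻¹ * Real.pi, by positivity, fun s => ?_⟩
  rw [ENNReal.ofReal_mul (inv_nonneg.2 hc.le)]
  refine le_trans ?_ (mul_le_mul_right (lintegral_inv_sobWeight_le s) _)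
  rw [← lintegral_const_mul _ (by have := measurable_sobWeight; fun_prop)]
  refine lintegral_mono fun t => ?_
  rw [ENNReal.ofReal_inv_of_pos hc, sobWeight,
    ← ENNReal.mul_inv (Or.inr ENNReal.ofReal_ne_top) (Or.inl ENNReal.ofReal_ne_top),
    ← ENNReal.ofReal_mul hc.le]
  exact ENNReal.inv_le_inv.2 (ENNReal.ofReal_le_ofReal (h _))

/-- The trace on the diagonal, in Fourier space, composed with `m ^ (-1/2)`. -/
def traceCLM : L2Plane →L[ℂ] Lp ℂ 2 (volume : Measure ℝ) :=
  LinearMap.mkContinuousOfExistsBound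
    { toFun := fun φ => (hm.memLp_fibre' (hm.integrable_invSqrt φ)).toLp
      map_add' := fun φ ψ => by
        have e1 := fibre_congr (by
          rw [map_add]; exact Lp.coeFn_add (hm.invSqrt φ) (hm.invSqrt ψ) :
            hm.invSqrt (φ + ψ) =ᵐ[volume] fun ξ => hm.invSqrt φ ξ + hm.invSqrt ψ ξ)
        rw [← MemLp.toLp_add, MemLp.toLp_eq_toLp_iff]
        exact e1.trans (fibre_add (hm.ae_integrable_shear' (hm.integrable_invSqrt φ))
          (hm.ae_integrable_shear' (hm.integrable_invSqrt ψ)))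
      map_smul' := fun c φ => by
        have e1 := fibre_congr (by
          rw [map_smul]; exact Lp.coeFn_smul c (hm.invSqrt φ) :
            hm.invSqrt (c • φ) =ᵐ[volume] fun ξ => c * hm.invSqrt φ ξ)
        rw [RingHom.id_apply, ← MemLp.toLp_const_smul, MemLp.toLp_eq_toLp_iff]
        rw [fibre_smul] at e1
        exact e1 }
    (by
      obtain ⟨N, hN0, hN⟩ := hm.exists_lintegral_inv_le
      refine ⟨√N, fun φ => ?_⟩
      have h1 := hm.integral_fibre_le (hm.integrable_invSqrt φ) hN0 hN
      rw [hm.integral_invSqrt, ← L2_norm_sq_toLp (hm.memLp_fibre' (hm.integrable_invSqrt φ))] at h1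
      refine (sq_le_sq₀ (norm_nonneg _) (by positivity)).1 ?_
      rw [mul_pow, Real.sq_sqrt hN0]
      exact h1)

lemma coeFn_traceCLM (φ : L2Plane) : hm.traceCLM φ =ᵐ[volume] fibre (hm.invSqrt φ) :=
  (hm.memLp_fibre' (hm.integrable_invSqrt φ)).coeFn_toLp

lemma norm_sq_traceCLM (φ : L2Plane) : ‖hm.traceCLM φ‖ ^ 2 = ∫ s, ‖fibre (hm.invSqrt φ) s‖ ^ 2 :=
  L2_norm_sq_toLp (hm.memLp_fibre' (hm.integrable_invSqrt φ))

/-- The trace is infinitesimally form bounded. -/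
lemma exists_integral_fibre_le {ε : ℝ} (hε : 0 < ε) : ∃ C : ℝ, ∀ ψ : L2Plane,
    (Integrable fun ξ => m ξ * ‖ψ ξ‖ ^ 2) →
    ∫ s, ‖fibre ψ s‖ ^ 2 ≤ ε * (∫ ξ, m ξ * ‖ψ ξ‖ ^ 2) + C * ‖ψ‖ ^ 2 := by
  obtain ⟨c, hc, h⟩ := hm.exists_le
  -- Adding `c r²` to `m` costs a multiple of `‖ψ‖²` and bounds the fibre integrals of the
  -- reciprocal by `π / (c r)`, which equals `ε` for this `r`.
  set r : ℝ := Real.pi / (c * ε) with hr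
  have hr0 : 0 < r := by positivity
  have hC : 0 < c * r ^ 2 := by positivity
  have hm' : IsElliptic fun ξ => m ξ + c * r ^ 2 :=
    ⟨hm.measurable.add_const _, c, hc, fun ξ => (h ξ).trans (by linarith)⟩
  refine ⟨ε * (c * r ^ 2), fun ψ hψ => ?_⟩
  have hψ2 := integrable_sq_of_memLp (Lp.memLp ψ)
  have hi : Integrable fun ξ => (m ξ + c * r ^ 2) * ‖ψ ξ‖ ^ 2 := by
    simp only [add_mul]
    exact hψ.add (hψ2.const_mul (c * r ^ 2))
  have key := hm'.integral_fibre_le hi hε.le fun s => ?_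
  · rw [L2_norm_sq_eq, mul_assoc, ← mul_add, ← integral_const_mul, ← integral_add hψ
      (hψ2.const_mul _)]
    simpa only [add_mul] using key
  · have hint : Integrable fun t : ℝ => (c * r ^ 2)⁻¹ * (1 + (t / r) ^ 2)⁻¹ :=
      (integrable_inv_one_add_sq.comp_div hr0.ne').const_mul _
    have e : ε = ∫ t : ℝ, (c * r ^ 2)⁻¹ * (1 + (t / r) ^ 2)⁻¹ := by
      rw [integral_const_mul, Measure.integral_comp_div (fun t : ℝ => (1 + t ^ 2)⁻¹) r,
        integral_univ_inv_one_add_sq, abs_of_pos hr0, smul_eq_mul, hr]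
      field_simp
    rw [e, ofReal_integral_eq_lintegral_ofReal hint (ae_of_all _ fun t => by positivity)]
    refine lintegral_mono fun t => ?_
    have h1 : c * r ^ 2 * (1 + (t / r) ^ 2) ≤ m (shear (s, t)) + c * r ^ 2 := by
      have h2 := h (shear (s, t))
      have h3 := one_add_sq_le_norm_sq_shear s t
      have h4 : c * r ^ 2 * (1 + (t / r) ^ 2) = c * r ^ 2 + c * t ^ 2 := by field_simp
      nlinarith
    simp only
    rw [← mul_inv, ENNReal.ofReal_inv_of_pos (by positivity)]
    exact ENNReal.inv_le_inv.2 (ENNReal.ofReal_le_ofReal h1)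

end IsElliptic

/-! ### Multiplication form minus fibre form: sign criteria -/

section Model

variable {H : Type*} [NormedAddCommGroup H] [InnerProductSpace ℂ H]

/-- A form that is unitarily equivalent to `∫ m |ψ|² - κ ∫ |fibre ψ|²` on a closed subspace `V`
of `L²(ℝ²)` in momentum space. -/
structure FormModel (V : Submodule ℂ L2Plane) (m : Plane → ℝ) (κ : ℝ) (S Q : Set H)
    (a : H → H → ℂ) (W : V →ₗᵢ[ℂ] H) : Prop where
  elliptic : IsElliptic m
  range_eq : Set.range W = S
  mem_iff : ∀ ψ : V, W ψ ∈ Q ↔ Integrable fun ξ => m ξ * ‖(ψ : L2Plane) ξ‖ ^ 2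
  form_eq : ∀ φ ψ : V, (Integrable fun ξ => m ξ * ‖(φ : L2Plane) ξ‖ ^ 2) →
    (Integrable fun ξ => m ξ * ‖(ψ : L2Plane) ξ‖ ^ 2) → a (W φ) (W ψ) =
      (∫ ξ, (m ξ : ℂ) * (starRingEnd ℂ ((φ : L2Plane) ξ) * (ψ : L2Plane) ξ)) -
        κ * ∫ s, starRingEnd ℂ (fibre (φ : L2Plane) s) * fibre (ψ : L2Plane) s
  mul_mem : ∀ r : ℝ → ℝ, ∀ ψ ∈ V, ∀ χ : L2Plane,
    (χ =ᵐ[volume] fun ξ => ((r (m ξ) : ℝ) : ℂ) * ψ ξ) → χ ∈ V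

namespace FormModel

variable {V : Submodule ℂ L2Plane} {m : Plane → ℝ} {κ : ℝ} {S Q : Set H}
  {a : H → H → ℂ} {W : V →ₗᵢ[ℂ] H} (h : FormModel V m κ S Q a W)
include h

/-- Stability of `V` under functions of `m` is used here for `m^(-1/2)`, and for `m^(1/2)` when
vectors of the form domain are pulled back. -/
lemma invSqrt_mem (φ : V) : h.elliptic.invSqrt φ ∈ V :=
  h.mul_mem (fun x => (√x)⁻¹) φ φ.2 _ (h.elliptic.coeFn_invSqrt φ)

/-- Multiplication by `m ^ (-1/2)` on `V`. -/
def rootCLM : V →L[ℂ] V :=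
  (h.elliptic.invSqrt ∘L V.subtypeL).codRestrict V h.invSqrt_mem

lemma coe_rootCLM (φ : V) : (h.rootCLM φ : L2Plane) = h.elliptic.invSqrt φ := rfl

variable [CompleteSpace V]

/-- The bounded operator `1 - κ m ^ (-1/2) δ m ^ (-1/2)` of the Birman-Schwinger principle. -/
def bsCLM : V →L[ℂ] V :=
  ContinuousLinearMap.id ℂ V -
    (h.elliptic.traceCLM ∘L V.subtypeL).adjoint ∘L ((κ : ℂ) • h.elliptic.traceCLM ∘L V.subtypeL)

lemma inner_bsCLM (φ ψ : V) : inner ℂ φ (h.bsCLM ψ) = inner ℂ (φ : L2Plane) (ψ : L2Plane) -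
    κ * inner ℂ (h.elliptic.traceCLM φ) (h.elliptic.traceCLM ψ) := by
  set L : V →L[ℂ] Lp ℂ 2 (volume : Measure ℝ) := h.elliptic.traceCLM ∘L V.subtypeL with hL
  have h1 : h.bsCLM ψ = ψ - L.adjoint ((κ : ℂ) • L ψ) := rfl
  rw [h1, inner_sub_right, ContinuousLinearMap.adjoint_inner_right, inner_smul_right]
  rfl

lemma re_inner_bsCLM (φ : V) : (inner ℂ φ (h.bsCLM φ)).re =
    (∫ ξ, m ξ * ‖(h.rootCLM φ : L2Plane) ξ‖ ^ 2) -
      κ * ∫ s, ‖fibre (h.rootCLM φ : L2Plane) s‖ ^ 2 := by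
  rw [h.inner_bsCLM, inner_self_eq_norm_sq_to_K, inner_self_eq_norm_sq_to_K, coe_rootCLM,
    h.elliptic.integral_invSqrt, ← h.elliptic.norm_sq_traceCLM, Complex.sub_re,
    Complex.re_ofReal_mul]
  norm_cast

lemma formRep : FormRep S Q a W h.rootCLM h.bsCLM where
  range_eq := h.range_eq
  range_comp := by
    ext u
    constructor
    · rintro ⟨φ, rfl⟩
      exact ⟨h.range_eq.subset ⟨_, rfl⟩, (h.mem_iff _).2 (h.elliptic.integrable_invSqrt _)⟩
    · rintro ⟨hS, hQ⟩
      rw [← h.range_eq] at hS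
      obtain ⟨ψ, rfl⟩ := hS
      obtain ⟨φ, h1, h2⟩ := h.elliptic.exists_invSqrt_eq ((h.mem_iff ψ).1 hQ)
      exact ⟨⟨φ, h.mul_mem Real.sqrt ψ ψ.2 φ h1⟩, congrArg W (Subtype.ext h2)⟩
  inj := fun φ ψ hφψ => Subtype.ext (h.elliptic.injective_invSqrt (congrArg Subtype.val hφψ))
  symm_T := fun φ ψ => h.elliptic.invSqrt_symm φ ψ
  symm_K := fun φ ψ => by
    change inner ℂ (h.bsCLM φ) ψ = inner ℂ φ (h.bsCLM ψ)
    rw [← inner_conj_symm (𝕜 := ℂ) (h.bsCLM φ) ψ, h.inner_bsCLM, h.inner_bsCLM, map_sub, map_mul,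
      Complex.conj_ofReal, inner_conj_symm, inner_conj_symm]
  form_eq := fun φ ψ => by
    rw [h.form_eq (h.rootCLM φ) (h.rootCLM ψ) (h.elliptic.integrable_invSqrt φ)
      (h.elliptic.integrable_invSqrt ψ), h.inner_bsCLM, coe_rootCLM, coe_rootCLM,
      h.elliptic.integral_conj_invSqrt, L2_inner_eq (h.elliptic.traceCLM φ)]
    congr 2
    refine integral_congr_ae ?_
    filter_upwards [h.elliptic.coeFn_traceCLM φ, h.elliptic.coeFn_traceCLM ψ] with s h1 h2
    rw [h1, h2]

/-- Substituting `ψ = m^(-1/2) φ` makes the kinetic term `‖φ‖²`, so the hypothesis is coercivity of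
`bsCLM` with constant `δ`. -/
theorem infSpectrum_pos {δ : ℝ} (hδ : 0 < δ) (hV : ∀ ψ ∈ V,
    (Integrable fun ξ => m ξ * ‖ψ ξ‖ ^ 2) →
      κ * ∫ s, ‖fibre ψ s‖ ^ 2 ≤ (1 - δ) * ∫ ξ, m ξ * ‖ψ ξ‖ ^ 2) :
    0 < infSpectrum S Q a := by
  obtain ⟨c, hc, hle⟩ := h.formRep.le_infSpectrum_of_coercive hδ fun φ => by
    rw [h.re_inner_bsCLM]
    have h1 := hV _ (h.invSqrt_mem φ) (h.elliptic.integrable_invSqrt φ)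
    have h2 := h.elliptic.integral_invSqrt φ
    rw [coe_rootCLM, show ‖φ‖ = ‖(φ : L2Plane)‖ from rfl]
    rw [h2] at h1 ⊢
    linarith
  exact lt_of_lt_of_le (by exact_mod_cast hc) hle

/-- The vector `m^(1/2) ψ` is a negative direction of `bsCLM`. Semiboundedness comes from the
infinitesimal form bound with relative constant `1 / κ`. -/
theorem infSpectrum_neg (hκ : 0 < κ) {ψ : L2Plane} (hψ : ψ ∈ V)
    (hψi : Integrable fun ξ => m ξ * ‖ψ ξ‖ ^ 2)
    (hlt : ∫ ξ, m ξ * ‖ψ ξ‖ ^ 2 < κ * ∫ s, ‖fibre ψ s‖ ^ 2) : infSpectrum S Q a < 0 := by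
  obtain ⟨φ, h1, h2⟩ := h.elliptic.exists_invSqrt_eq hψi
  obtain ⟨C, hC⟩ := h.elliptic.exists_integral_fibre_le (inv_pos.2 hκ)
  refine h.formRep.infSpectrum_neg (φ := ⟨φ, h.mul_mem Real.sqrt ψ hψ φ h1⟩) (C := κ * C) ?_ ?_
  · rw [h.re_inner_bsCLM, coe_rootCLM]
    simp only [h2]
    linarith
  · intro χ
    rw [h.re_inner_bsCLM]
    have h3 := mul_le_mul_of_nonneg_left
      (hC (h.rootCLM χ) (h.elliptic.integrable_invSqrt χ)) hκ.le
    rw [mul_add, mul_inv_cancel_left₀ hκ.ne'] at h3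
    rw [show ‖h.rootCLM χ‖ = ‖(h.rootCLM χ : L2Plane)‖ from rfl]
    linarith

end FormModel

end Model

/-! ### Isometries and the Fourier transform -/

section Isometry

variable {E : Type*} [NormedAddCommGroup E] [InnerProductSpace ℝ E] [FiniteDimensional ℝ E]
  [MeasurableSpace E] [BorelSpace E]

/-- Composition of square integrable functions with a linear isometry. -/
def compIso (A : E ≃ₗᵢ[ℝ] E) : Lp ℂ 2 (volume : Measure E) →ₗᵢ[ℂ] Lp ℂ 2 (volume : Measure E) :=
  Lp.compMeasurePreservingₗᵢ ℂ A A.measurePreserving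

lemma coeFn_compIso (A : E ≃ₗᵢ[ℝ] E) (f : Lp ℂ 2 (volume : Measure E)) :
    compIso A f =ᵐ[volume] fun x => f (A x) :=
  Lp.coeFn_compMeasurePreserving f A.measurePreserving

/-- For Schwartz functions this is a change of variables in the Fourier integral; density and
continuity extend it to `L²`. -/
lemma fourier_compIso (A : E ≃ₗᵢ[ℝ] E) (f : Lp ℂ 2 (volume : Measure E)) :
    (𝓕 (compIso A f) : Lp ℂ 2 (volume : Measure E)) = compIso A (𝓕 f) := by
  refine DenseRange.induction_on
    (SchwartzMap.denseRange_toLpCLM (E := E) (F := ℂ) (p := 2) (μ := volume) ENNReal.ofNat_ne_top) f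
    (isClosed_eq ?_ ?_) fun χ => ?_
  · exact (Lp.fourierTransformₗᵢ E ℂ).continuous.comp (compIso A).continuous
  · exact (compIso A).continuous.comp (Lp.fourierTransformₗᵢ E ℂ).continuous
  · set χA : 𝓢(E, ℂ) :=
      SchwartzMap.compCLMOfContinuousLinearEquiv ℂ A.toContinuousLinearEquiv χ with hχA
    have h1 : compIso A (χ.toLp 2) = χA.toLp 2 := by
      ext1
      filter_upwards [coeFn_compIso A (χ.toLp 2), χA.coeFn_toLp 2 volume,
        A.measurePreserving.quasiMeasurePreserving.ae (χ.coeFn_toLp 2 volume)] with x h2 h3 h4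
      rw [h2, h3, h4]
      rfl
    rw [SchwartzMap.toLpCLM_apply, h1, SchwartzMap.toLp_fourier_eq, SchwartzMap.toLp_fourier_eq]
    ext1
    filter_upwards [coeFn_compIso A ((𝓕 χ).toLp 2), (𝓕 χA).coeFn_toLp 2 volume,
      A.measurePreserving.quasiMeasurePreserving.ae ((𝓕 χ).coeFn_toLp 2 volume)] with x h2 h3 h4
    rw [h2, h3, h4, SchwartzMap.fourier_coe, SchwartzMap.fourier_coe]
    exact Real.fourier_comp_linearIsometry A χ x

lemma fourierInv_compIso (A : E ≃ₗᵢ[ℝ] E) (f : Lp ℂ 2 (volume : Measure E)) :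
    (𝓕⁻ (compIso A f) : Lp ℂ 2 (volume : Measure E)) = compIso A (𝓕⁻ f) := by
  have h := fourier_compIso A (𝓕⁻ f)
  rw [FourierTransform.fourier_fourierInv_eq] at h
  rw [← h, FourierTransform.fourierInv_fourier_eq]

/-- Square integrable functions with `f ∘ A = c f`. -/
def isoSpace (A : E ≃ₗᵢ[ℝ] E) (c : ℂ) : Submodule ℂ (Lp ℂ 2 (volume : Measure E)) :=
  LinearMap.ker ((compIso A).toLinearMap - c • LinearMap.id)

lemma mem_isoSpace {A : E ≃ₗᵢ[ℝ] E} {c : ℂ} {f : Lp ℂ 2 (volume : Measure E)} :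
    f ∈ isoSpace A c ↔ compIso A f = c • f := by
  simp [isoSpace, sub_eq_zero]

lemma mem_isoSpace_iff_ae {A : E ≃ₗᵢ[ℝ] E} {c : ℂ} {f : Lp ℂ 2 (volume : Measure E)} :
    f ∈ isoSpace A c ↔ (fun x => f (A x)) =ᵐ[volume] fun x => c * f x := by
  rw [mem_isoSpace, Lp.ext_iff]
  exact ⟨fun h => (coeFn_compIso A f).symm.trans (h.trans (Lp.coeFn_smul c f)),
    fun h => (coeFn_compIso A f).trans (h.trans (Lp.coeFn_smul c f).symm)⟩

lemma isClosed_isoSpace (A : E ≃ₗᵢ[ℝ] E) (c : ℂ) :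
    IsClosed (isoSpace A c : Set (Lp ℂ 2 (volume : Measure E))) := by
  have : (isoSpace A c : Set (Lp ℂ 2 (volume : Measure E))) = {f | compIso A f = c • f} := by
    ext f; exact mem_isoSpace
  rw [this]
  exact isClosed_eq (compIso A).continuous (continuous_const_smul c)

lemma fourierInv_mem_isoSpace {A : E ≃ₗᵢ[ℝ] E} {c : ℂ} {f : Lp ℂ 2 (volume : Measure E)} :
    (𝓕⁻ f : Lp ℂ 2 (volume : Measure E)) ∈ isoSpace A c ↔ f ∈ isoSpace A c := by
  rw [mem_isoSpace, mem_isoSpace, ← fourierInv_compIso]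
  exact ((Lp.fourierTransformₗᵢ E ℂ).symm.injective.eq_iff' (map_smul _ c f))

lemma mul_mem_isoSpace {A : E ≃ₗᵢ[ℝ] E} {c : ℂ} {f g : Lp ℂ 2 (volume : Measure E)}
    (hf : f ∈ isoSpace A c) {b : E → ℝ} (hb : ∀ x, b (A x) = b x)
    (hg : g =ᵐ[volume] fun x => (b x : ℂ) * f x) : g ∈ isoSpace A c := by
  rw [mem_isoSpace_iff_ae] at hf ⊢
  filter_upwards [hf, hg, A.measurePreserving.quasiMeasurePreserving.ae hg] with x h1 h2 h3
  rw [h3, h1, h2, hb]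
  ring

end Isometry

/-- The exchange of the two particles as a linear isometry. -/
def exchangeIso : Plane ≃ₗᵢ[ℝ] Plane :=
  LinearIsometryEquiv.piLpCongrLeft 2 ℝ ℝ (Equiv.swap 0 1)

lemma exchangeIso_apply (x : Plane) : exchangeIso x = exchange x := by
  ext i
  fin_cases i <;> simp [exchangeIso, exchange, LinearIsometryEquiv.piLpCongrLeft_apply,
    Equiv.piCongrLeft'_apply]

lemma integrable_conj_mul {α : Type*} [MeasurableSpace α] {ν : Measure α} (f g : Lp ℂ 2 ν) :
    Integrable (fun x => starRingEnd ℂ (f x) * g x) ν := by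
  refine (L2.integrable_inner (𝕜 := ℂ) f g).congr (ae_of_all _ fun x => ?_)
  simp only [RCLike.inner_apply]
  ring

/-! ### The contact term in momentum space -/

section Trace

variable {m : Plane → ℝ} (hm : IsElliptic m)
include hm

lemma IsElliptic.diagTrace_fourierInv {ψ : L2Plane} (hψ : Integrable fun ξ => m ξ * ‖ψ ξ‖ ^ 2) :
    diagTrace (𝓕⁻ ψ) = 𝓕⁻ ((hm.memLp_fibre' hψ).toLp : Lp ℂ 2 (volume : Measure ℝ)) := by
  have e : (𝓕 (𝓕⁻ ψ : L2Plane) : L2Plane) = ψ := FourierTransform.fourier_fourierInv_eq ψ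
  have h := hm.lintegral_sobWeight_ne_top hψ
  rw [← e] at h
  rw [diagTrace_eq h]
  congr 2
  rw [e]

lemma IsElliptic.integral_conj_diagTrace {φ ψ : L2Plane}
    (hφ : Integrable fun ξ => m ξ * ‖φ ξ‖ ^ 2) (hψ : Integrable fun ξ => m ξ * ‖ψ ξ‖ ^ 2) :
    ∫ x, starRingEnd ℂ (diagTrace (𝓕⁻ φ) x) * diagTrace (𝓕⁻ ψ) x =
      ∫ s, starRingEnd ℂ (fibre φ s) * fibre ψ s := by
  rw [← L2_inner_eq, hm.diagTrace_fourierInv hφ, hm.diagTrace_fourierInv hψ]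
  refine ((Lp.fourierTransformₗᵢ ℝ ℂ).symm.inner_map_map _ _).trans ?_
  rw [L2_inner_eq]
  refine integral_congr_ae ?_
  filter_upwards [(hm.memLp_fibre' hφ).coeFn_toLp, (hm.memLp_fibre' hψ).coeFn_toLp] with s h1 h2
  rw [h1, h2]

end Trace

section Symbol

variable {μ : ℝ} {mm : ℝ → ℝ → ℝ}

lemma symbol_exchangeIso (hsym : ∀ a b, mm a b = mm b a) (ξ : Plane) :
    symbol μ mm (exchangeIso ξ) = symbol μ mm ξ := by
  rw [exchangeIso_apply, symbol, symbol, hsym]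
  simp [exchange]

end Symbol

/-! ### The model of the line -/

/-- Symmetric functions of two momenta. -/
def lineSpace : Submodule ℂ L2Plane := isoSpace exchangeIso 1

lemma coe_lineSpace : (lineSpace : Set L2Plane) = lineSym := by
  ext u
  rw [SetLike.mem_coe, lineSpace, mem_isoSpace_iff_ae]
  simp only [one_mul, exchangeIso_apply]
  rfl

instance : CompleteSpace lineSpace := (isClosed_isoSpace exchangeIso 1).completeSpace_coe

/-- The inverse Fourier transform on symmetric functions. -/
def lineUnitary : lineSpace →ₗᵢ[ℂ] L2Plane :=
  (Lp.fourierTransformₗᵢ Plane ℂ).symm.toLinearIsometry.comp lineSpace.subtypeₗᵢ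

lemma lineUnitary_apply (ψ : lineSpace) : lineUnitary ψ = 𝓕⁻ (ψ : L2Plane) := rfl

theorem line_formModel {μ : ℝ} {mm : ℝ → ℝ → ℝ} (hell : IsElliptic (symbol μ mm))
    (hsym : ∀ a b, mm a b = mm b a) (lam : ℝ) :
    FormModel lineSpace (symbol μ mm) lam lineSym (formDomain id Set.univ μ mm)
      (contactForm id Set.univ Set.univ μ mm lam) lineUnitary where
  elliptic := hell
  range_eq := by
    rw [← coe_lineSpace]
    ext u
    constructor
    · rintro ⟨ψ, rfl⟩
      exact fourierInv_mem_isoSpace.2 ψ.2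
    · intro hu
      refine ⟨⟨𝓕 u, fourierInv_mem_isoSpace.1 ?_⟩, ?_⟩
      · rw [FourierTransform.fourierInv_fourier_eq]
        exact hu
      · rw [lineUnitary_apply]
        exact FourierTransform.fourierInv_fourier_eq u
  mem_iff ψ := by
    rw [formDomain, lineUnitary_apply, Set.mem_ofPred_eq, id, integrableOn_univ,
      FourierTransform.fourier_fourierInv_eq]
  form_eq φ ψ hφ hψ := by
    rw [contactForm, lineUnitary_apply, lineUnitary_apply, id, id, Measure.restrict_univ,
      Measure.restrict_univ, hell.integral_conj_diagTrace hφ hψ,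
      FourierTransform.fourier_fourierInv_eq, FourierTransform.fourier_fourierInv_eq]
  mul_mem r ψ hψ χ hχ :=
    mul_mem_isoSpace hψ (b := fun ξ => r (symbol μ mm ξ))
      (fun ξ => by simp only [symbol_exchangeIso hsym]) hχ

/-! ### Reflections -/

lemma mirror_apply (i j : Fin 2) (x : Plane) : mirror i x j = if j = i then -x j else x j := by
  simp only [mirror, LinearIsometryEquiv.piLpCongrRight_apply]
  split_ifs <;> simp

lemma mirror_mirror (i : Fin 2) (x : Plane) : mirror i (mirror i x) = x := by
  ext j
  rw [mirror_apply, mirror_apply]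
  split_ifs <;> simp

lemma mirror_comm (x : Plane) : mirror 0 (mirror 1 x) = mirror 1 (mirror 0 x) := by
  ext j
  fin_cases j <;> simp [mirror_apply]

lemma mirror_zero_exchange (x : Plane) : mirror 0 (exchange x) = exchange (mirror 1 x) := by
  ext j
  fin_cases j <;> simp [mirror_apply, exchange]

lemma mirror_one_exchange (x : Plane) : mirror 1 (exchange x) = exchange (mirror 0 x) := by
  ext j
  fin_cases j <;> simp [mirror_apply, exchange]

lemma measurable_coord (i : Fin 2) : Measurable fun x : Plane => x i := by fun_prop

lemma measurableEmbedding_mirror (i : Fin 2) : MeasurableEmbedding (mirror i) :=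
  (mirror i).toHomeomorph.measurableEmbedding

/-- The half-plane where the `i`-th coordinate is positive. -/
def halfPlane (i : Fin 2) : Set Plane := {x | 0 < x i}

lemma measurableSet_halfPlane (i : Fin 2) : MeasurableSet (halfPlane i) :=
  measurableSet_lt measurable_const (measurable_coord i)

lemma ae_coord_ne_zero (i : Fin 2) : ∀ᵐ x : Plane, x i ≠ 0 := by
  have h : ∀ᵐ y : Fin 2 → ℝ, y i ≠ 0 := Measure.ae_eval_ne _ i 0
  exact (PiLp.volume_preserving_ofLp (Fin 2)).quasiMeasurePreserving.ae h

/-- The reflection exchanges the half-plane with its complement up to the null set `x i = 0`.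
Applied once per coordinate, this folds the plane onto the quadrant. -/
lemma measure_eq_restrict_add_map {ν : Measure Plane} (i : Fin 2)
    (hν : MeasurePreserving (mirror i) ν ν) (h0 : ∀ᵐ x ∂ν, x i ≠ 0) :
    ν = ν.restrict (halfPlane i) + (ν.restrict (halfPlane i)).map (mirror i) := by
  have hmeas : Measurable (mirror i) := (mirror i).continuous.measurable
  have h1 : (ν.restrict (halfPlane i)).map (mirror i) = ν.restrict (halfPlane i)ᶜ := by
    have h2 : (mirror i) ⁻¹' (halfPlane i)ᶜ =ᵐ[ν] halfPlane i := by
      filter_upwards [h0] with x hx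
      refine propext ?_
      change ¬ (0 < mirror i x i) ↔ 0 < x i
      rw [mirror_apply, if_pos rfl, not_lt, neg_nonpos]
      exact ⟨fun h => lt_of_le_of_ne h (Ne.symm hx), le_of_lt⟩
    rw [← Measure.restrict_congr_set h2,
      (hν.restrict_preimage (measurableSet_halfPlane i).compl).map_eq]
  rw [h1, Measure.restrict_add_restrict_compl (measurableSet_halfPlane i)]

lemma quadrant_eq : quadrant = halfPlane 1 ∩ halfPlane 0 := by
  ext x; exact and_comm

lemma volume_eq_restrict_add_map :
    (volume : Measure Plane) = volume.restrict (halfPlane 0) +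
      (volume.restrict (halfPlane 0)).map (mirror 0) :=
  measure_eq_restrict_add_map 0 (mirror 0).measurePreserving (ae_coord_ne_zero 0)

lemma restrict_eq_restrict_add_map :
    (volume : Measure Plane).restrict (halfPlane 0) = volume.restrict quadrant +
      (volume.restrict quadrant).map (mirror 1) := by
  have hmp : MeasurePreserving (mirror 1) (volume.restrict (halfPlane 0))
      (volume.restrict (halfPlane 0)) := by
    have h := (mirror 1).measurePreserving.restrict_preimage (measurableSet_halfPlane 0)
    have h2 : (mirror 1) ⁻¹' (halfPlane 0) = halfPlane 0 := by
      ext x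
      simp [halfPlane, mirror_apply]
    rwa [h2] at h
  have h := measure_eq_restrict_add_map 1 hmp (ae_restrict_of_ae (ae_coord_ne_zero 1))
  rwa [Measure.restrict_restrict (measurableSet_halfPlane 1), ← quadrant_eq] at h

section Even

variable {F : Type*} [NormedAddCommGroup F] {f : Plane → F}

lemma integrableOn_of_reflection {ν κ : Measure Plane} {i : Fin 2}
    (hν : ν = κ + κ.map (mirror i)) (hf : ∀ᵐ x ∂ν, f (mirror i x) = f x) :
    Integrable f ν ↔ Integrable f κ := by
  have hle : κ ≤ ν := hν ▸ Measure.le_add_right le_rfl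
  have hf' : ∀ᵐ x ∂κ, f (mirror i x) = f x := ae_mono hle hf
  have h1 : Integrable f (κ.map (mirror i)) ↔ Integrable f κ := by
    rw [(measurableEmbedding_mirror i).integrable_map_iff]
    exact integrable_congr hf'
  rw [hν, integrable_add_measure, h1, and_self]

lemma integral_of_reflection [NormedSpace ℝ F] {ν κ : Measure Plane} {i : Fin 2}
    (hν : ν = κ + κ.map (mirror i)) (hf : ∀ᵐ x ∂ν, f (mirror i x) = f x)
    (hi : Integrable f ν) : ∫ x, f x ∂ν = (2 : ℝ) • ∫ x, f x ∂κ := by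
  have hle : κ ≤ ν := hν ▸ Measure.le_add_right le_rfl
  have hf' : ∀ᵐ x ∂κ, f (mirror i x) = f x := ae_mono hle hf
  rw [hν, integrable_add_measure] at hi
  rw [hν, integral_add_measure hi.1 hi.2,
    (measurableEmbedding_mirror i).integral_map, two_smul]
  congr 1
  exact integral_congr_ae hf'

lemma integrableOn_quadrant_iff (h0 : ∀ᵐ x, f (mirror 0 x) = f x)
    (h1 : ∀ᵐ x, f (mirror 1 x) = f x) : IntegrableOn f quadrant ↔ Integrable f := by
  rw [integrableOn_of_reflection volume_eq_restrict_add_map h0,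
    integrableOn_of_reflection restrict_eq_restrict_add_map (ae_restrict_of_ae h1)]
  rfl

lemma integral_quadrant [NormedSpace ℝ F] (h0 : ∀ᵐ x, f (mirror 0 x) = f x)
    (h1 : ∀ᵐ x, f (mirror 1 x) = f x) (hi : Integrable f) :
    ∫ x, f x = (4 : ℝ) • ∫ x in quadrant, f x := by
  rw [integral_of_reflection volume_eq_restrict_add_map h0 hi,
    integral_of_reflection restrict_eq_restrict_add_map (ae_restrict_of_ae h1) hi.integrableOn,
    smul_smul]
  norm_num

end Even

/-! ### The model of the half-line -/

/-- Symmetric functions of two momenta that are odd in each momentum. -/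
def halfSpace : Submodule ℂ L2Plane :=
  isoSpace exchangeIso 1 ⊓ (isoSpace (mirror 0) (-1) ⊓ isoSpace (mirror 1) (-1))

instance : CompleteSpace halfSpace :=
  ((isClosed_isoSpace exchangeIso 1).inter ((isClosed_isoSpace (mirror 0) (-1)).inter
    (isClosed_isoSpace (mirror 1) (-1)))).completeSpace_coe

lemma fourierInv_mem_halfSpace {ψ : L2Plane} : (𝓕⁻ ψ : L2Plane) ∈ halfSpace ↔ ψ ∈ halfSpace := by
  simp only [halfSpace, Submodule.mem_inf, fourierInv_mem_isoSpace]

lemma odd_of_mem_halfSpace {ψ : L2Plane} (hψ : ψ ∈ halfSpace) (i : Fin 2) :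
    ∀ᵐ x, ψ (mirror i x) = -ψ x := by
  have h : ψ ∈ isoSpace (mirror i) (-1) := by
    fin_cases i
    · exact hψ.2.1
    · exact hψ.2.2
  filter_upwards [mem_isoSpace_iff_ae.1 h] with x hx
  rw [hx, neg_one_mul]

lemma integral_quadrant_conj_mul {φ ψ : L2Plane} (hφ : φ ∈ halfSpace) (hψ : ψ ∈ halfSpace)
    {b : Plane → ℂ} (hb : ∀ i ξ, b (mirror i ξ) = b ξ)
    (hi : Integrable fun ξ => b ξ * (starRingEnd ℂ (φ ξ) * ψ ξ)) :
    ∫ ξ, b ξ * (starRingEnd ℂ (φ ξ) * ψ ξ) =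
      4 * ∫ ξ in quadrant, b ξ * (starRingEnd ℂ (φ ξ) * ψ ξ) := by
  have h : ∀ i, ∀ᵐ ξ, b (mirror i ξ) * (starRingEnd ℂ (φ (mirror i ξ)) * ψ (mirror i ξ)) =
      b ξ * (starRingEnd ℂ (φ ξ) * ψ ξ) := fun i => by
    filter_upwards [odd_of_mem_halfSpace hφ i, odd_of_mem_halfSpace hψ i] with ξ h1 h2
    rw [h1, h2, hb, map_neg, neg_mul_neg]
  rw [integral_quadrant (h 0) (h 1) hi]
  simp [Complex.real_smul]

/-- Restriction to the quadrant. -/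
def restrictCLM : L2Plane →L[ℂ] L2Quadrant := LpToLpRestrictCLM Plane ℂ ℂ volume 2 quadrant

lemma coeFn_restrictCLM (U : L2Plane) : restrictCLM U =ᵐ[volume.restrict quadrant] U :=
  LpToLpRestrictCLM_coeFn ℂ quadrant U

/-- The signs from oddness cancel in the product, so the four quadrants contribute equally. This is
the origin of the factor 2 in `halfUnitary`. -/
lemma inner_restrictCLM {U V : L2Plane} (hU : U ∈ halfSpace) (hV : V ∈ halfSpace) :
    4 * inner ℂ (restrictCLM U) (restrictCLM V) = inner ℂ U V := by
  have h := integral_quadrant_conj_mul hU hV (b := fun _ => 1) (fun _ _ => rfl)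
    (by simpa using integrable_conj_mul U V)
  simp only [one_mul] at h
  rw [L2_inner_eq U V, h, L2_inner_eq]
  congr 1
  refine integral_congr_ae ?_
  filter_upwards [coeFn_restrictCLM U, coeFn_restrictCLM V] with x h1 h2
  rw [h1, h2]

/-- The inverse sine transform, onto symmetric functions on the quadrant. -/
def halfUnitary : halfSpace →ₗᵢ[ℂ] L2Quadrant :=
  LinearMap.isometryOfInner
    ((2 : ℂ) • (restrictCLM.toLinearMap ∘ₗ
      (Lp.fourierTransformₗᵢ Plane ℂ).symm.toLinearEquiv.toLinearMap ∘ₗ halfSpace.subtype))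
    fun φ ψ => by
      change inner ℂ ((2 : ℂ) • restrictCLM (𝓕⁻ (φ : L2Plane)))
        ((2 : ℂ) • restrictCLM (𝓕⁻ (ψ : L2Plane))) = inner ℂ (φ : L2Plane) (ψ : L2Plane)
      rw [inner_smul_left, inner_smul_right, ← mul_assoc]
      have h := inner_restrictCLM (fourierInv_mem_halfSpace.2 φ.2) (fourierInv_mem_halfSpace.2 ψ.2)
      have h2 : inner ℂ (𝓕⁻ (φ : L2Plane) : L2Plane) (𝓕⁻ (ψ : L2Plane)) =
        inner ℂ (φ : L2Plane) (ψ : L2Plane) :=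
        (Lp.fourierTransformₗᵢ Plane ℂ).symm.inner_map_map _ _
      have h3 : starRingEnd ℂ 2 * 2 = 4 := by rw [map_ofNat]; norm_num
      rw [← h2, ← h, h3]

lemma halfUnitary_apply (ψ : halfSpace) :
    halfUnitary ψ = (2 : ℂ) • restrictCLM (𝓕⁻ (ψ : L2Plane)) := rfl

lemma coeFn_oddExtLp (u : L2Quadrant) : oddExtLp u =ᵐ[volume] oddExt u :=
  (memLp_oddExt u).coeFn_toLp

lemma oddExt_mirror_zero (u : Plane → ℂ) (x : Plane) : oddExt u (mirror 0 x) = -oddExt u x := by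
  simp only [oddExt, mirror_mirror, mirror_comm]
  ring

lemma oddExt_mirror_one (u : Plane → ℂ) (x : Plane) : oddExt u (mirror 1 x) = -oddExt u x := by
  simp only [oddExt, mirror_mirror, mirror_comm]
  ring

lemma mirror_mem_quadrant (i : Fin 2) {x : Plane} (hx : x ∈ quadrant) : mirror i x ∉ quadrant := by
  intro h
  have h1 := hx.1
  have h2 := hx.2
  have h3 := h.1
  have h4 := h.2
  fin_cases i <;> simp [mirror_apply] at h3 h4 <;> linarith

lemma mirror_mirror_mem_quadrant {x : Plane} (hx : x ∈ quadrant) :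
    mirror 0 (mirror 1 x) ∉ quadrant := by
  intro h
  have h1 := hx.1
  have h3 := h.1
  simp [mirror_apply] at h3
  linarith

lemma oddExt_of_mem (u : Plane → ℂ) {x : Plane} (hx : x ∈ quadrant) : oddExt u x = u x := by
  rw [oddExt, Set.indicator_of_mem hx, Set.indicator_of_notMem (mirror_mem_quadrant 0 hx),
    Set.indicator_of_notMem (mirror_mem_quadrant 1 hx),
    Set.indicator_of_notMem (mirror_mirror_mem_quadrant hx)]
  ring

/-- Functions that are odd in each variable agree if they agree on the quadrant. -/
lemma ae_eq_of_odd {f g : Plane → ℂ} (hf : ∀ i, ∀ᵐ x, f (mirror i x) = -f x)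
    (hg : ∀ i, ∀ᵐ x, g (mirror i x) = -g x) (h : ∀ᵐ x, x ∈ quadrant → f x = g x) :
    f =ᵐ[volume] g := by
  have hm : ∀ i : Fin 2, ∀ {p : Plane → Prop}, (∀ᵐ x, p x) → ∀ᵐ x, p (mirror i x) :=
    fun i p hp => (mirror i).measurePreserving.quasiMeasurePreserving.ae hp
  have h0 := hm 0 h
  have h1 := hm 1 h
  have h2 := hm 1 h0
  filter_upwards [ae_coord_ne_zero 0, ae_coord_ne_zero 1, h, h0, h1, h2, hf 0, hf 1, hg 0, hg 1,
    hm 1 (hf 0), hm 1 (hg 0)] with x x0 x1 e e0 e1 e2 f0 f1 g0 g1 f2 g2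
  rcases lt_or_gt_of_ne x0 with a | a <;> rcases lt_or_gt_of_ne x1 with b | b
  · have := e2 ⟨by simp [mirror_apply, a], by simp [mirror_apply, b]⟩
    rwa [f2, g2, f1, g1, neg_neg, neg_neg] at this
  · have := e0 ⟨by simp [mirror_apply, a], by simp [mirror_apply, b]⟩
    rwa [f0, g0, neg_inj] at this
  · have := e1 ⟨by simp [mirror_apply, a], by simp [mirror_apply, b]⟩
    rwa [f1, g1, neg_inj] at this
  · exact e ⟨a, b⟩

lemma odd_oddExt (u : Plane → ℂ) (i : Fin 2) : ∀ᵐ x, oddExt u (mirror i x) = -oddExt u x := by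
  refine ae_of_all _ fun x => ?_
  fin_cases i
  · exact oddExt_mirror_zero u x
  · exact oddExt_mirror_one u x

lemma oddExtLp_restrictCLM {U : L2Plane} (hU : U ∈ halfSpace) (c : ℂ) :
    oddExtLp (c • restrictCLM U) = c • U := by
  have h1 : oddExt (c • restrictCLM U : L2Quadrant) =ᵐ[volume] fun x => c * U x := by
    refine ae_eq_of_odd (odd_oddExt _) (fun i => ?_) ?_
    · filter_upwards [odd_of_mem_halfSpace hU i] with x hx
      rw [hx, mul_neg]
    · rw [← ae_restrict_iff' measurableSet_quadrant]
      filter_upwards [coeFn_restrictCLM U, Lp.coeFn_smul c (restrictCLM U),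
        ae_restrict_mem measurableSet_quadrant] with x h1 h2 h3
      rw [oddExt_of_mem _ h3, h2, Pi.smul_apply, h1, smul_eq_mul]
  ext1
  exact (coeFn_oddExtLp _).trans (h1.trans (Lp.coeFn_smul c U).symm)

lemma exchange_mem_quadrant {x : Plane} : exchange x ∈ quadrant ↔ x ∈ quadrant := by
  simp [quadrant, exchange, and_comm]

lemma measurePreserving_exchange : MeasurePreserving exchange (volume : Measure Plane) volume := by
  have h : (exchangeIso : Plane → Plane) = exchange := funext exchangeIso_apply
  rw [← h]
  exact exchangeIso.measurePreserving

lemma oddExtLp_mem_halfSpace {u : L2Quadrant} (hu : u ∈ halfSym) : oddExtLp u ∈ halfSpace := by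
  have hodd : ∀ i, ∀ᵐ x, oddExtLp u (mirror i x) = -oddExtLp u x := fun i => by
    filter_upwards [odd_oddExt u i, coeFn_oddExtLp u,
      (mirror i).measurePreserving.quasiMeasurePreserving.ae (coeFn_oddExtLp u)] with x h1 h2 h3
    rw [h3, h1, h2]
  have hmem : ∀ i, oddExtLp u ∈ isoSpace (mirror i) (-1) := fun i => by
    rw [mem_isoSpace_iff_ae]
    filter_upwards [hodd i] with x hx
    rw [hx, neg_one_mul]
  refine ⟨?_, hmem 0, hmem 1⟩
  rw [SetLike.mem_coe, mem_isoSpace_iff_ae]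
  simp only [exchangeIso_apply, one_mul]
  have hq := measurePreserving_exchange.quasiMeasurePreserving
  refine ae_eq_of_odd (fun i => ?_) hodd ?_
  · fin_cases i
    · filter_upwards [hq.ae (hodd 1)] with x hx
      change oddExtLp u (exchange (mirror 0 x)) = -oddExtLp u (exchange x)
      rw [← mirror_one_exchange, hx]
    · filter_upwards [hq.ae (hodd 0)] with x hx
      change oddExtLp u (exchange (mirror 1 x)) = -oddExtLp u (exchange x)
      rw [← mirror_zero_exchange, hx]
  · filter_upwards [(ae_restrict_iff' measurableSet_quadrant).1 hu, coeFn_oddExtLp u,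
      hq.ae (coeFn_oddExtLp u)] with x h1 h2 h3 hx
    rw [h2, h3, oddExt_of_mem _ hx, oddExt_of_mem _ (exchange_mem_quadrant.2 hx), h1 hx]

lemma restrictCLM_oddExtLp (u : L2Quadrant) : restrictCLM (oddExtLp u) = u := by
  ext1
  filter_upwards [coeFn_restrictCLM (oddExtLp u), ae_restrict_of_ae (coeFn_oddExtLp u),
    ae_restrict_mem measurableSet_quadrant] with x h1 h2 h3
  rw [h1, h2, oddExt_of_mem _ h3]

lemma smul_restrictCLM_mem_halfSym {U : L2Plane} (hU : U ∈ halfSpace) (c : ℂ) :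
    c • restrictCLM U ∈ halfSym := by
  have h1 := mem_isoSpace_iff_ae.1 hU.1
  have h2 : ∀ᵐ x, x ∈ quadrant → (c • restrictCLM U : L2Quadrant) x = c * U x := by
    rw [← ae_restrict_iff' measurableSet_quadrant]
    filter_upwards [coeFn_restrictCLM U, Lp.coeFn_smul c (restrictCLM U)] with x h1 h2
    rw [h2, Pi.smul_apply, h1, smul_eq_mul]
  refine (ae_restrict_iff' measurableSet_quadrant).2 ?_
  filter_upwards [h1, h2, measurePreserving_exchange.quasiMeasurePreserving.ae h2] with x a b c hx
  rw [b hx, c (exchange_mem_quadrant.2 hx), ← exchangeIso_apply, a, one_mul]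

lemma range_halfUnitary : Set.range halfUnitary = halfSym := by
  ext u
  constructor
  · rintro ⟨ψ, rfl⟩
    exact smul_restrictCLM_mem_halfSym (fourierInv_mem_halfSpace.2 ψ.2) 2
  · intro hu
    have h1 : (𝓕⁻ (𝓕 (oddExtLp u) : L2Plane) : L2Plane) = oddExtLp u :=
      FourierTransform.fourierInv_fourier_eq _
    have h2 : (𝓕 (oddExtLp u) : L2Plane) ∈ halfSpace := by
      rw [← fourierInv_mem_halfSpace, h1]
      exact oddExtLp_mem_halfSpace hu
    refine ⟨(2⁻¹ : ℂ) • ⟨_, h2⟩, ?_⟩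
    rw [map_smul, halfUnitary_apply, h1, restrictCLM_oddExtLp, smul_smul]
    norm_num

lemma fourier_oddExtLp_halfUnitary (ψ : halfSpace) :
    (𝓕 (oddExtLp (halfUnitary ψ)) : L2Plane) = (2 : ℂ) • (ψ : L2Plane) := by
  rw [halfUnitary_apply, oddExtLp_restrictCLM (fourierInv_mem_halfSpace.2 ψ.2),
    FourierTransform.fourier_smul, FourierTransform.fourier_fourierInv_eq]

/-- Two sign changes cancel, so `ψ` is invariant under total reflection, which maps the fibre of
`-s` to that of `s`. The trace is then even, and the half-line carries half of its norm squared. -/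
lemma fibre_even {ψ : L2Plane} (hψ : ψ ∈ halfSpace) : ∀ᵐ s, fibre ψ (-s) = fibre ψ s := by
  have h : ∀ᵐ ξ, ψ (mirror 0 (mirror 1 ξ)) = ψ ξ := by
    filter_upwards [odd_of_mem_halfSpace hψ 1,
      (mirror 1).measurePreserving.quasiMeasurePreserving.ae (odd_of_mem_halfSpace hψ 0)]
      with ξ h1 h2
    rw [h2, h1, neg_neg]
  have h2 : ∀ᵐ z ∂((volume : Measure ℝ).prod (volume : Measure ℝ)),
      ψ (mirror 0 (mirror 1 (shear z))) = ψ (shear z) :=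
    measurePreserving_shear.quasiMeasurePreserving.ae h
  filter_upwards [Measure.ae_ae_of_ae_prod h2] with s hs
  rw [fibre, ← integral_neg_eq_self]
  refine integral_congr_ae ?_
  filter_upwards [hs] with t ht
  rw [← ht]
  congr 1
  ext i
  fin_cases i <;> simp [mirror_apply, shear_apply]
  ring

lemma integral_eq_two_mul_Ioi {f : ℝ → ℂ} (hf : ∀ᵐ x, f (-x) = f x) (hi : Integrable f) :
    ∫ x, f x = 2 * ∫ x in Set.Ioi 0, f x := by
  rw [← intervalIntegral.integral_Iic_add_Ioi (b := 0) hi.integrableOn hi.integrableOn, two_mul]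
  congr 1
  rw [← neg_zero, ← integral_comp_neg_Ioi, neg_zero]
  exact integral_congr_ae (ae_restrict_of_ae hf)

lemma diagTrace_even {m : Plane → ℝ} (hm : IsElliptic m) {ψ : L2Plane} (hψ : ψ ∈ halfSpace)
    (hi : Integrable fun ξ => m ξ * ‖ψ ξ‖ ^ 2) :
    ∀ᵐ x, diagTrace (𝓕⁻ ψ) (-x) = diagTrace (𝓕⁻ ψ) x := by
  have h1 : ((hm.memLp_fibre' hi).toLp : Lp ℂ 2 (volume : Measure ℝ)) ∈
      isoSpace (LinearIsometryEquiv.neg ℝ) 1 := by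
    rw [mem_isoSpace_iff_ae]
    filter_upwards [(hm.memLp_fibre' hi).coeFn_toLp, fibre_even hψ,
      (LinearIsometryEquiv.neg ℝ (E := ℝ)).measurePreserving.quasiMeasurePreserving.ae
        (hm.memLp_fibre' hi).coeFn_toLp] with s h2 h3 h4
    rw [h4, h2, one_mul]
    exact h3
  rw [← fourierInv_mem_isoSpace, ← hm.diagTrace_fourierInv hi, mem_isoSpace_iff_ae] at h1
  filter_upwards [h1] with x hx
  rw [one_mul] at hx
  exact hx

lemma symbol_mirror (μ : ℝ) (mm : ℝ → ℝ → ℝ) (i : Fin 2) (ξ : Plane) :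
    symbol μ mm (mirror i ξ) = symbol μ mm ξ := by
  fin_cases i <;> simp [symbol, mirror_apply]

lemma IsElliptic.integrable_mul_conj_mul {m : Plane → ℝ} (hm : IsElliptic m) {φ ψ : L2Plane}
    (hφ : Integrable fun ξ => m ξ * ‖φ ξ‖ ^ 2) (hψ : Integrable fun ξ => m ξ * ‖ψ ξ‖ ^ 2) :
    Integrable fun ξ => (m ξ : ℂ) * (starRingEnd ℂ (φ ξ) * ψ ξ) := by
  obtain ⟨φ', h1, -⟩ := hm.exists_invSqrt_eq hφ
  obtain ⟨ψ', h2, -⟩ := hm.exists_invSqrt_eq hψ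
  refine (integrable_conj_mul φ' ψ').congr ?_
  filter_upwards [h1, h2] with ξ h3 h4
  have h5 : ((√(m ξ) : ℝ) : ℂ) * ((√(m ξ) : ℝ) : ℂ) = m ξ := by
    rw [← Complex.ofReal_mul, Real.mul_self_sqrt (hm.pos ξ).le]
  rw [h3, h4, map_mul, Complex.conj_ofReal, ← h5]
  ring

/-- The odd extension of `halfUnitary ψ` is twice the inverse Fourier transform of `ψ`, so quadratic
terms gain a factor 4. Passing to the quadrant divides the kinetic term by 4, whereas passing to the
half-line divides the contact term only by 2: hence the coupling `2 * lam`. -/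
theorem half_formModel {μ : ℝ} {mm : ℝ → ℝ → ℝ} (hell : IsElliptic (symbol μ mm))
    (hsym : ∀ a b, mm a b = mm b a) (lam : ℝ) :
    FormModel halfSpace (symbol μ mm) (2 * lam) halfSym (formDomain oddExtLp quadrant μ mm)
      (contactForm oddExtLp quadrant (Set.Ioi 0) μ mm lam) halfUnitary where
  elliptic := hell
  range_eq := range_halfUnitary
  mem_iff ψ := by
    have h2 : (fun ξ => symbol μ mm ξ * ‖((2 : ℂ) • (ψ : L2Plane) : L2Plane) ξ‖ ^ 2) =ᵐ[volume]
        fun ξ => 4 * (symbol μ mm ξ * ‖(ψ : L2Plane) ξ‖ ^ 2) := by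
      filter_upwards [Lp.coeFn_smul (2 : ℂ) (ψ : L2Plane)] with ξ h1
      rw [h1, Pi.smul_apply, norm_smul, Complex.norm_ofNat]
      ring
    have h3 : ∀ i, ∀ᵐ ξ, 4 * (symbol μ mm (mirror i ξ) * ‖(ψ : L2Plane) (mirror i ξ)‖ ^ 2) =
        4 * (symbol μ mm ξ * ‖(ψ : L2Plane) ξ‖ ^ 2) := fun i => by
      filter_upwards [odd_of_mem_halfSpace ψ.2 i] with ξ h1
      rw [h1, norm_neg, symbol_mirror]
    rw [formDomain, Set.mem_ofPred_eq, fourier_oddExtLp_halfUnitary, IntegrableOn,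
      integrable_congr (ae_restrict_of_ae h2), ← IntegrableOn,
      integrableOn_quadrant_iff (h3 0) (h3 1)]
    exact integrable_const_mul_iff (by norm_num) _
  form_eq φ ψ hφ hψ := by
    have hscale : ∀ χ : halfSpace, diagTrace (oddExtLp (halfUnitary χ)) =
        diagTrace (𝓕⁻ ((2 : ℂ) • χ : halfSpace).1) := fun χ => by
      rw [halfUnitary_apply, oddExtLp_restrictCLM (fourierInv_mem_halfSpace.2 χ.2)]
      congr 1
      exact (FourierTransform.fourierInv_smul (2 : ℂ) (χ : L2Plane)).symm
    have hsmul : ∀ χ : halfSpace,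
        (((2 : ℂ) • χ : halfSpace).1 : L2Plane) =ᵐ[volume] fun ξ => 2 * (χ : L2Plane) ξ :=
      fun χ => Lp.coeFn_smul (2 : ℂ) (χ : L2Plane)
    have hint : ∀ χ : halfSpace, (Integrable fun ξ => symbol μ mm ξ * ‖(χ : L2Plane) ξ‖ ^ 2) →
        Integrable fun ξ => symbol μ mm ξ * ‖((2 : ℂ) • χ : halfSpace).1 ξ‖ ^ 2 := fun χ hχ => by
      refine (hχ.const_mul 4).congr ?_
      filter_upwards [hsmul χ] with ξ h1
      rw [h1, norm_mul, Complex.norm_ofNat]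
      ring
    have htrace := hell.integral_conj_diagTrace (hint φ hφ) (hint ψ hψ)
    rw [integral_eq_two_mul_Ioi (by
      filter_upwards [diagTrace_even hell ((2 : ℂ) • φ).2 (hint φ hφ),
        diagTrace_even hell ((2 : ℂ) • ψ).2 (hint ψ hψ)] with x h1 h2
      rw [h1, h2]) (integrable_conj_mul _ _)] at htrace
    have hfib : ∫ s, starRingEnd ℂ (fibre ((2 : ℂ) • φ : halfSpace).1 s) *
        fibre ((2 : ℂ) • ψ : halfSpace).1 s =
        4 * ∫ s, starRingEnd ℂ (fibre (φ : L2Plane) s) * fibre (ψ : L2Plane) s := by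
      rw [← integral_const_mul]
      refine integral_congr_ae ?_
      filter_upwards [fibre_congr (hsmul φ), fibre_congr (hsmul ψ)] with s h1 h2
      rw [h1, h2, fibre_smul, fibre_smul, map_mul, map_ofNat]
      ring
    have hkin : ∫ ξ in quadrant, (symbol μ mm ξ : ℂ) *
        (starRingEnd ℂ ((𝓕 (oddExtLp (halfUnitary φ)) : L2Plane) ξ) *
          (𝓕 (oddExtLp (halfUnitary ψ)) : L2Plane) ξ) =
        ∫ ξ, (symbol μ mm ξ : ℂ) * (starRingEnd ℂ ((φ : L2Plane) ξ) * (ψ : L2Plane) ξ) := by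
      rw [integral_quadrant_conj_mul φ.2 ψ.2 (b := fun ξ => (symbol μ mm ξ : ℂ))
        (fun i ξ => by rw [symbol_mirror]) (hell.integrable_mul_conj_mul hφ hψ),
        ← integral_const_mul]
      refine integral_congr_ae (ae_restrict_of_ae ?_)
      rw [fourier_oddExtLp_halfUnitary, fourier_oddExtLp_halfUnitary]
      filter_upwards [Lp.coeFn_smul (2 : ℂ) (φ : L2Plane),
        Lp.coeFn_smul (2 : ℂ) (ψ : L2Plane)] with ξ h1 h2
      rw [h1, h2, Pi.smul_apply, Pi.smul_apply, smul_eq_mul, smul_eq_mul, map_mul, map_ofNat]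
      ring
    rw [contactForm, hkin, hscale, hscale]
    rw [hfib] at htrace
    have h4 : ∫ x in Set.Ioi 0, starRingEnd ℂ (diagTrace (𝓕⁻ ((2 : ℂ) • φ : halfSpace).1) x) *
        diagTrace (𝓕⁻ ((2 : ℂ) • ψ : halfSpace).1) x =
        2 * ∫ s, starRingEnd ℂ (fibre (φ : L2Plane) s) * fibre (ψ : L2Plane) s := by
      linear_combination htrace / 2
    rw [h4]
    push_cast
    ring
  mul_mem r ψ hψ χ hχ :=
    ⟨mul_mem_isoSpace hψ.1 (b := fun ξ => r (symbol μ mm ξ))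
      (fun ξ => by simp only [symbol_exchangeIso hsym]) hχ,
      mul_mem_isoSpace hψ.2.1 (b := fun ξ => r (symbol μ mm ξ))
      (fun ξ => by simp only [symbol_mirror]) hχ,
      mul_mem_isoSpace hψ.2.2 (b := fun ξ => r (symbol μ mm ξ))
      (fun ξ => by simp only [symbol_mirror]) hχ⟩

/-! ### Hyperbolic functions -/

lemma tanh_add_tanh (x y : ℝ) :
    Real.tanh x + Real.tanh y = Real.sinh (x + y) / (Real.cosh x * Real.cosh y) := by
  rw [Real.tanh_eq_sinh_div_cosh, Real.tanh_eq_sinh_div_cosh, Real.sinh_add]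
  have := Real.cosh_pos x
  have := Real.cosh_pos y
  field_simp

lemma strictMono_tanh : StrictMono Real.tanh := fun x y hxy => by
  have h := tanh_add_tanh y (-x)
  rw [Real.tanh_neg] at h
  have h1 : 0 < Real.sinh (y + -x) := Real.sinh_pos_iff.2 (by linarith)
  have := Real.cosh_pos y
  have := Real.cosh_pos (-x)
  have h2 : 0 < Real.tanh y + -Real.tanh x := h ▸ by positivity
  linarith

lemma tanh_pos {x : ℝ} (hx : 0 < x) : 0 < Real.tanh x := by
  simpa using strictMono_tanh hx

lemma sinh_le_mul_cosh {x : ℝ} (hx : 0 ≤ x) : Real.sinh x ≤ x * Real.cosh x := by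
  have hd : ∀ y : ℝ, HasDerivAt (fun y => y * Real.cosh y - Real.sinh y) (y * Real.sinh y) y :=
    fun y => by
      convert! ((hasDerivAt_id y).mul (Real.hasDerivAt_cosh y)).sub (Real.hasDerivAt_sinh y) using 1
      simp
  have hm : MonotoneOn (fun y => y * Real.cosh y - Real.sinh y) (Set.Ici 0) := by
    refine monotoneOn_of_deriv_nonneg (convex_Ici 0)
      (fun y _ => (hd y).continuousAt.continuousWithinAt)
      (fun y _ => (hd y).differentiableAt.differentiableWithinAt) fun y hy => ?_
    rw [interior_Ici] at hy
    rw [(hd y).deriv]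
    exact mul_nonneg (le_of_lt hy) (Real.sinh_nonneg_iff.2 (le_of_lt hy))
  have := hm (Set.mem_Ici.2 le_rfl) (Set.mem_Ici.2 hx) hx
  simp at this
  linarith

lemma le_sinh_mul_cosh {x : ℝ} (hx : 0 ≤ x) : x ≤ Real.sinh x * Real.cosh x := by
  have h1 := Real.self_le_sinh_iff.2 hx
  have h2 := Real.one_le_cosh x
  nlinarith

/-! ### The function `x coth x` -/

/-- The function `x / tanh x`, with its limiting value at `0`. -/
def xcoth (x : ℝ) : ℝ := if x = 0 then 1 else x / Real.tanh x

lemma kFun_eq {T : ℝ} (hT : 0 < T) (x : ℝ) : kFun T x = 2 * T * xcoth (x / (2 * T)) := by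
  rw [kFun, xcoth]
  by_cases hx : x = 0
  · simp [hx]
  · have h : x / (2 * T) ≠ 0 := div_ne_zero hx (by positivity)
    rw [if_neg hx, if_neg h]
    field_simp

@[simp] lemma xcoth_zero : xcoth 0 = 1 := if_pos rfl

lemma xcoth_neg (x : ℝ) : xcoth (-x) = xcoth x := by
  simp only [xcoth, neg_eq_zero, Real.tanh_neg, neg_div_neg_eq]

lemma xcoth_abs (x : ℝ) : xcoth |x| = xcoth x := by
  rcases abs_choice x with h | h <;> rw [h]
  exact xcoth_neg x

lemma xcoth_of_pos {x : ℝ} (hx : 0 < x) : xcoth x = x * Real.cosh x / Real.sinh x := by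
  rw [xcoth, if_neg hx.ne', Real.tanh_eq_sinh_div_cosh, div_div_eq_mul_div]

lemma one_le_xcoth (x : ℝ) : 1 ≤ xcoth x := by
  rw [← xcoth_abs]
  rcases (abs_nonneg x).eq_or_lt with h | h
  · rw [← h, xcoth_zero]
  · rw [xcoth_of_pos h, one_le_div (Real.sinh_pos_iff.2 h)]
    exact sinh_le_mul_cosh h.le

lemma abs_le_xcoth (x : ℝ) : |x| ≤ xcoth x := by
  rw [← xcoth_abs]
  rcases (abs_nonneg x).eq_or_lt with h | h
  · rw [← h, xcoth_zero]; exact zero_le_one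
  · rw [xcoth, if_neg h.ne', le_div_iff₀ (tanh_pos h)]
    have := Real.tanh_lt_one |x|
    nlinarith

lemma xcoth_le (x : ℝ) : xcoth x ≤ 1 + |x| := by
  rw [← xcoth_abs]
  rcases (abs_nonneg x).eq_or_lt with h | h
  · rw [← h, xcoth_zero]; simp
  · set y := |x|
    rw [xcoth_of_pos h, div_le_iff₀ (Real.sinh_pos_iff.2 h), Real.cosh_eq, Real.sinh_eq]
    have h1 := Real.add_one_le_exp (2 * y)
    have h2 : Real.exp y = Real.exp (2 * y) * Real.exp (-y) := by
      rw [← Real.exp_add]; congr 1; ring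
    have h3 := Real.exp_pos (-y)
    nlinarith

lemma hasDerivAt_xcoth {x : ℝ} (hx : 0 < x) :
    HasDerivAt xcoth ((Real.sinh x * Real.cosh x - x) / Real.sinh x ^ 2) x := by
  have hs := Real.sinh_pos_iff.2 hx
  have h := (((hasDerivAt_id x).mul (Real.hasDerivAt_cosh x)).div (Real.hasDerivAt_sinh x) hs.ne')
  have h2 : HasDerivAt (fun x => x * Real.cosh x / Real.sinh x)
      ((Real.sinh x * Real.cosh x - x) / Real.sinh x ^ 2) x := by
    convert! h using 1
    have := Real.cosh_sq x
    simp only [id, one_mul, Pi.mul_apply]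
    congr 1
    nlinarith
  refine h2.congr_of_eventuallyEq ?_
  filter_upwards [lt_mem_nhds hx] with y hy using xcoth_of_pos hy

lemma continuousOn_xcoth : ContinuousOn xcoth (Set.Ici 0) := by
  intro x hx
  rcases (Set.mem_Ici.1 hx).eq_or_lt with h | h
  · subst h
    refine ContinuousAt.continuousWithinAt ?_
    rw [ContinuousAt, xcoth_zero]
    refine tendsto_of_tendsto_of_tendsto_of_le_of_le tendsto_const_nhds ?_ one_le_xcoth xcoth_le
    have : Continuous fun x : ℝ => 1 + |x| := by fun_prop
    simpa using this.tendsto 0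
  · exact (hasDerivAt_xcoth h).continuousAt.continuousWithinAt

/-- On the positive axis the second derivative is `2 (x cosh x - sinh x) / sinh³ x`, which is
nonnegative. -/
lemma convexOn_xcoth : ConvexOn ℝ (Set.Ici 0) xcoth := by
  refine MonotoneOn.convexOn_of_deriv (convex_Ici 0) continuousOn_xcoth ?_ ?_
  · rw [interior_Ici]
    exact fun x hx => (hasDerivAt_xcoth hx).differentiableAt.differentiableWithinAt
  · rw [interior_Ici]
    have hd : ∀ x : ℝ, 0 < x → HasDerivAt (fun x => (Real.sinh x * Real.cosh x - x) /
        Real.sinh x ^ 2) (2 * (x * Real.cosh x - Real.sinh x) / Real.sinh x ^ 3) x := fun x hx => by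
      have hs := Real.sinh_pos_iff.2 hx
      convert! ((((Real.hasDerivAt_sinh x).mul (Real.hasDerivAt_cosh x)).sub (hasDerivAt_id x)).div
        ((Real.hasDerivAt_sinh x).pow 2) (pow_ne_zero 2 hs.ne')) using 1
      simp only [Pi.mul_apply, Pi.sub_apply, Pi.pow_apply, id]
      rw [div_eq_div_iff (by positivity) (by positivity)]
      have h1 := Real.cosh_sq x
      push_cast
      have h2 : Real.cosh x * Real.cosh x = Real.sinh x ^ 2 + 1 := by rw [← h1]; ring
      rw [h2]
      linear_combination (2 * Real.sinh x ^ 5) * h1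
    have hm : MonotoneOn (fun x => (Real.sinh x * Real.cosh x - x) / Real.sinh x ^ 2)
        (Set.Ioi 0) := by
      refine monotoneOn_of_deriv_nonneg (convex_Ioi 0)
        (fun y hy => (hd y hy).continuousAt.continuousWithinAt)
        (fun y hy => ?_) fun y hy => ?_
      · rw [interior_Ioi] at hy
        exact (hd y hy).differentiableAt.differentiableWithinAt
      · rw [interior_Ioi] at hy
        have hs := Real.sinh_pos_iff.2 hy
        rw [(hd y hy).deriv]
        have := sinh_le_mul_cosh (le_of_lt hy)
        exact div_nonneg (by linarith) (by positivity)
    exact hm.congr fun x hx => (hasDerivAt_xcoth hx).deriv.symm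

/-- The derivative is at most 1, because `sinh x (cosh x - sinh x) = (1 - exp (-2x)) / 2 ≤ x`. The
resulting Lipschitz bound later controls the effect of the chemical potential. -/
lemma xcoth_sub_le {x y : ℝ} (hx : 0 ≤ x) (hxy : x ≤ y) : xcoth y - xcoth x ≤ y - x := by
  have hm : MonotoneOn (fun x => x - xcoth x) (Set.Ici 0) := by
    refine monotoneOn_of_deriv_nonneg (convex_Ici 0) (continuousOn_id.sub continuousOn_xcoth) ?_ ?_
    · rw [interior_Ici]
      exact fun y hy => ((hasDerivAt_id y).sub
        (hasDerivAt_xcoth hy)).differentiableAt.differentiableWithinAt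
    · rw [interior_Ici]
      intro y hy
      have hs := Real.sinh_pos_iff.2 (Set.mem_Ioi.1 hy)
      have h1 : HasDerivAt (fun x => x - xcoth x) _ y :=
        (hasDerivAt_id y).sub (hasDerivAt_xcoth hy)
      rw [h1.deriv, sub_nonneg, div_le_one (by positivity)]
      have h2 := Real.add_one_le_exp (-(2 * y))
      have h3 : Real.sinh y * (Real.cosh y - Real.sinh y) = (1 - Real.exp (-(2 * y))) / 2 := by
        rw [Real.cosh_sub_sinh, Real.sinh_eq, sub_div, sub_mul, div_mul_eq_mul_div,
          ← Real.exp_add, div_mul_eq_mul_div, ← Real.exp_add]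
        simp
        ring_nf
      nlinarith
  have := hm (Set.mem_Ici.2 hx) (Set.mem_Ici.2 (hx.trans hxy)) hxy
  simp only at this
  linarith

lemma xcoth_mono {x y : ℝ} (hx : 0 ≤ x) (hxy : x ≤ y) : xcoth x ≤ xcoth y := by
  have hm : MonotoneOn xcoth (Set.Ici 0) := by
    refine monotoneOn_of_deriv_nonneg (convex_Ici 0) continuousOn_xcoth ?_ ?_
    · rw [interior_Ici]
      exact fun y hy => (hasDerivAt_xcoth hy).differentiableAt.differentiableWithinAt
    · rw [interior_Ici]
      intro y hy
      rw [(hasDerivAt_xcoth hy).deriv]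
      have := le_sinh_mul_cosh (le_of_lt hy)
      exact div_nonneg (by linarith) (by positivity)
  exact hm (Set.mem_Ici.2 hx) (Set.mem_Ici.2 (hx.trans hxy)) hxy

lemma abs_xcoth_sub_le (x y : ℝ) : |xcoth x - xcoth y| ≤ |x - y| := by
  refine le_trans ?_ (abs_abs_sub_abs_le_abs_sub x y)
  rw [← xcoth_abs x, ← xcoth_abs y]
  rcases le_total |x| |y| with h | h
  · rw [abs_sub_comm, abs_sub_comm |x|, abs_of_nonneg (sub_nonneg.2 (xcoth_mono (abs_nonneg x) h)),
      abs_of_nonneg (sub_nonneg.2 h)]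
    exact xcoth_sub_le (abs_nonneg x) h
  · rw [abs_of_nonneg (sub_nonneg.2 (xcoth_mono (abs_nonneg y) h)),
      abs_of_nonneg (sub_nonneg.2 h)]
    exact xcoth_sub_le (abs_nonneg y) h

lemma continuous_xcoth : Continuous xcoth := by
  refine (LipschitzWith.of_dist_le_mul (K := 1) fun x y => ?_).continuous
  rw [Real.dist_eq, Real.dist_eq, NNReal.coe_one, one_mul]
  exact abs_xcoth_sub_le x y

/-- Convexity of `x coth x` in the form of an estimate for its sums and differences of squares. -/
lemma xcoth_sq_add_le (x y : ℝ) :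
    xcoth (x ^ 2) + xcoth (y ^ 2) - 1 ≤ (xcoth ((x + y) ^ 2) + xcoth ((x - y) ^ 2)) / 2 := by
  -- Midpoint convexity: `x² + y²` is the mean of `(x + y)²` and `(x - y)²`.
  have h1 : xcoth (x ^ 2 + y ^ 2) ≤ (xcoth ((x + y) ^ 2) + xcoth ((x - y) ^ 2)) / 2 := by
    have h := convexOn_xcoth.2 (Set.mem_Ici.2 (sq_nonneg (x + y)))
      (Set.mem_Ici.2 (sq_nonneg (x - y))) (show (0 : ℝ) ≤ 1 / 2 by norm_num)
      (show (0 : ℝ) ≤ 1 / 2 by norm_num) (by norm_num)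
    simp only [smul_eq_mul] at h
    rw [show 1 / 2 * (x + y) ^ 2 + 1 / 2 * (x - y) ^ 2 = x ^ 2 + y ^ 2 by ring] at h
    linarith
  -- A convex function minus its value at 0 is superadditive: `x²` and `y²` are convex combinations
  -- of 0 and their sum, with complementary weights.
  have h2 : xcoth (x ^ 2) + xcoth (y ^ 2) - 1 ≤ xcoth (x ^ 2 + y ^ 2) := by
    rcases eq_or_ne (x ^ 2 + y ^ 2) 0 with h | h
    · have hx : x ^ 2 = 0 := by nlinarith [sq_nonneg x, sq_nonneg y]
      have hy : y ^ 2 = 0 := by nlinarith [sq_nonneg x, sq_nonneg y]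
      rw [hx, hy, add_zero, xcoth_zero]; norm_num
    · have h0 : 0 < x ^ 2 + y ^ 2 := lt_of_le_of_ne (by positivity) (Ne.symm h)
      set S := x ^ 2 + y ^ 2 with hS
      have key : ∀ u v : ℝ, u ^ 2 + v ^ 2 = S →
          xcoth (u ^ 2) ≤ u ^ 2 / S * xcoth S + v ^ 2 / S := fun u v huv => by
        have h3 := convexOn_xcoth.2 (Set.mem_Ici.2 h0.le) (Set.mem_Ici.2 le_rfl)
          (show 0 ≤ u ^ 2 / S by positivity) (show 0 ≤ v ^ 2 / S by positivity)
          (by rw [← add_div, huv, div_self h])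
        simp only [smul_eq_mul, mul_zero, add_zero, xcoth_zero, mul_one] at h3
        rwa [div_mul_cancel₀ _ h] at h3
      have h4 := key x y rfl
      have h5 := key y x (by rw [hS]; ring)
      have h6 : x ^ 2 / S + y ^ 2 / S = 1 := by rw [← add_div, ← hS, div_self h]
      have h7 : x ^ 2 / S * xcoth S + y ^ 2 / S * xcoth S = xcoth S := by rw [← add_mul, h6, one_mul]
      linarith
  linarith

/-! ### The symbols -/

section KFun

variable {T : ℝ}

lemma two_mul_le_kFun (hT : 0 < T) (x : ℝ) : 2 * T ≤ kFun T x := by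
  rw [kFun_eq hT]
  have := one_le_xcoth (x / (2 * T))
  nlinarith

lemma kFun_pos (hT : 0 < T) (x : ℝ) : 0 < kFun T x :=
  lt_of_lt_of_le (by positivity) (two_mul_le_kFun hT x)

lemma mul_abs_div (hT : 0 < T) (x : ℝ) : 2 * T * |x / (2 * T)| = |x| := by
  rw [abs_div, abs_of_pos (show 0 < 2 * T by positivity), mul_div_cancel₀ _ (by positivity)]

lemma abs_le_kFun (hT : 0 < T) (x : ℝ) : |x| ≤ kFun T x := by
  rw [kFun_eq hT, ← mul_abs_div hT]
  have := abs_le_xcoth (x / (2 * T))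
  gcongr

lemma kFun_le (hT : 0 < T) (x : ℝ) : kFun T x ≤ 2 * T + |x| := by
  rw [kFun_eq hT, ← mul_abs_div hT]
  have := xcoth_le (x / (2 * T))
  nlinarith

lemma abs_kFun_sub_le (hT : 0 < T) (x y : ℝ) : |kFun T x - kFun T y| ≤ |x - y| := by
  rw [kFun_eq hT, kFun_eq hT, ← mul_sub, abs_mul, abs_of_pos (show 0 < 2 * T by positivity),
    ← mul_abs_div hT (x - y), sub_div]
  have := abs_xcoth_sub_le (x / (2 * T)) (y / (2 * T))
  gcongr

lemma continuous_kFun (hT : 0 < T) : Continuous (kFun T) := by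
  rw [show kFun T = fun x => 2 * T * xcoth (x / (2 * T)) from funext (kFun_eq hT)]
  have := continuous_xcoth
  fun_prop

lemma kFun_neg (hT : 0 < T) (x : ℝ) : kFun T (-x) = kFun T x := by
  rw [kFun_eq hT, kFun_eq hT, neg_div, xcoth_neg]

lemma kFun_strictMono {T' : ℝ} (hT : 0 < T) (h : T < T') (x : ℝ) : kFun T x < kFun T' x := by
  have hT' := hT.trans h
  have key : ∀ y : ℝ, 0 < y → kFun T y < kFun T' y := fun y hy => by
    rw [kFun, kFun, if_neg hy.ne', if_neg hy.ne']
    refine div_lt_div_of_pos_left hy (tanh_pos (by positivity)) (strictMono_tanh ?_)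
    gcongr
  rcases lt_trichotomy x 0 with hx | hx | hx
  · rw [← kFun_neg hT, ← kFun_neg hT']
    exact key _ (neg_pos.2 hx)
  · rw [hx, kFun, kFun, if_pos rfl, if_pos rfl]
    linarith
  · exact key x hx

lemma kFun_mul {c : ℝ} (hc : 0 < c) (x : ℝ) : kFun (c * T) (c * x) = c * kFun T x := by
  by_cases hx : x = 0
  · rw [hx, mul_zero, kFun, kFun, if_pos rfl, if_pos rfl]
    ring
  · rw [kFun, kFun, if_neg hx, if_neg (mul_ne_zero hc.ne' hx), mul_left_comm 2 c T,
      mul_div_mul_left _ _ hc.ne', mul_div_assoc]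

lemma tanh_eq_div_kFun (x : ℝ) : Real.tanh (x / (2 * T)) = x / kFun T x := by
  by_cases hx : x = 0
  · simp [hx]
  · rw [kFun, if_neg hx, div_div_cancel₀ hx]

lemma dFun_comm (T a b : ℝ) : dFun T a b = dFun T b a := add_comm _ _

lemma lFun_comm (a b : ℝ) : lFun T a b = lFun T b a := by
  rw [lFun, lFun, add_comm b a]
  split_ifs with h
  · rw [eq_neg_of_add_eq_zero_left h, neg_div, Real.cosh_neg]
  · rw [add_comm (Real.tanh _)]

/-- The two energies agree at zero total momentum, so L_T and D_T have the same symbol on the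
critical fibre; this is why the two temperatures coincide. -/
lemma lFun_self (a : ℝ) : lFun T a a = kFun T a := by
  rw [lFun, kFun]
  by_cases h : a = 0
  · simp [h]
  · rw [if_neg h, if_neg (by rwa [← two_mul, mul_eq_zero, or_iff_right two_ne_zero]), ← two_mul,
      ← two_mul, mul_div_mul_left _ _ two_ne_zero]

lemma kFun_le_cosh_sq (hT : 0 < T) (x : ℝ) : kFun T x ≤ 2 * T * Real.cosh (x / (2 * T)) ^ 2 := by
  rw [kFun_eq hT]
  gcongr
  set y := x / (2 * T)
  rw [← xcoth_abs, ← Real.cosh_abs y]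
  rcases (abs_nonneg y).eq_or_lt with h | h
  · rw [← h]; simp
  · have hs := Real.sinh_pos_iff.2 h
    rw [xcoth_of_pos h, div_le_iff₀ hs]
    have h1 := le_sinh_mul_cosh h.le
    have h2 := Real.cosh_pos |y|
    nlinarith

/-- Chebyshev's inequality: writing `a = α A`, `b = β B` with `A`, `B` the values of `kFun` and `α`,
`β` those of `tanh`, the claim is `(A - B) (α - β) ≥ 0`. While `α`, `β` are ordered by value and
`A`, `B` by absolute value, positivity of `a + b` makes the orders agree. -/
lemma dFun_le_lFun_of_pos (hT : 0 < T) {a b : ℝ} (hab : 0 < a + b) : dFun T a b ≤ lFun T a b := by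
  rw [lFun, if_neg hab.ne', dFun, tanh_eq_div_kFun, tanh_eq_div_kFun]
  set A := kFun T a with hA
  set B := kFun T b with hB
  have hA0 : 0 < A := kFun_pos hT a
  have hB0 : 0 < B := kFun_pos hT b
  have hpos : 0 < a / A + b / B := by
    have h := tanh_add_tanh (a / (2 * T)) (b / (2 * T))
    rw [tanh_eq_div_kFun, tanh_eq_div_kFun] at h
    rw [h]
    have h1 : 0 < Real.sinh (a / (2 * T) + b / (2 * T)) := by
      rw [Real.sinh_pos_iff, ← add_div]; positivity
    have h2 := Real.cosh_pos (a / (2 * T))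
    have h3 := Real.cosh_pos (b / (2 * T))
    positivity
  rw [le_div_iff₀ hpos]
  have mono : ∀ x y : ℝ, 0 < x + y → y ≤ x → kFun T y ≤ kFun T x := fun x y h1 h2 => by
    rw [kFun_eq hT, kFun_eq hT, ← xcoth_abs, ← xcoth_abs (x / _)]
    have h3 : |y / (2 * T)| ≤ |x / (2 * T)| := by
      rw [abs_div, abs_div]
      exact div_le_div_of_nonneg_right (abs_le_abs h2 (by linarith)) (abs_nonneg _)
    have := xcoth_mono (abs_nonneg _) h3
    gcongr
  have key : 0 ≤ (A - B) * (a / A - b / B) := by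
    have ta := tanh_eq_div_kFun (T := T) a
    have tb := tanh_eq_div_kFun (T := T) b
    rcases le_total b a with h | h
    · have h1 := mono a b hab h
      have h2 := strictMono_tanh.monotone (show b / (2 * T) ≤ a / (2 * T) by gcongr)
      rw [ta, tb] at h2
      exact mul_nonneg (sub_nonneg.2 h1) (sub_nonneg.2 h2)
    · have h1 := mono b a (by linarith) h
      have h2 := strictMono_tanh.monotone (show a / (2 * T) ≤ b / (2 * T) by gcongr)
      rw [ta, tb] at h2
      exact mul_nonneg_of_nonpos_of_nonpos (sub_nonpos.2 h1) (sub_nonpos.2 h2)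
  have e1 : a / A * A = a := div_mul_cancel₀ _ hA0.ne'
  have e2 : b / B * B = b := div_mul_cancel₀ _ hB0.ne'
  nlinarith

lemma lFun_neg (a b : ℝ) : lFun T (-a) (-b) = lFun T a b := by
  have h : -a + -b = -(a + b) := by ring
  rw [lFun, lFun, h, neg_div _ a, neg_div _ b, Real.tanh_neg, Real.tanh_neg, Real.cosh_neg,
    ← neg_add, neg_div_neg_eq]
  simp only [neg_eq_zero]

lemma dFun_le_lFun (hT : 0 < T) (a b : ℝ) : dFun T a b ≤ lFun T a b := by
  rcases lt_trichotomy (a + b) 0 with h | h | h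
  · have h1 := dFun_le_lFun_of_pos hT (a := -a) (b := -b) (by linarith)
    rwa [dFun, kFun_neg hT, kFun_neg hT, lFun_neg] at h1
  · rw [lFun, if_pos h, dFun, eq_neg_of_add_eq_zero_right h, kFun_neg hT, add_halves]
    exact kFun_le_cosh_sq hT a
  · exact dFun_le_lFun_of_pos hT h

lemma measurable_tanh : Measurable Real.tanh := strictMono_tanh.monotone.measurable

lemma continuous_tanh : Continuous Real.tanh := by
  rw [show Real.tanh = fun x => Real.sinh x / Real.cosh x from funext Real.tanh_eq_sinh_div_cosh]
  exact Real.continuous_sinh.div Real.continuous_cosh fun x => (Real.cosh_pos x).ne'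

end KFun

/-! ### Dispersion relation and gap integral -/

/-- The one-particle energy `K_T` as a function of the momentum variable. -/
def dispersion (μ T t : ℝ) : ℝ := kFun T ((2 * Real.pi * t) ^ 2 - μ)

section Dispersion

variable {μ T : ℝ}

lemma dispersion_pos (hT : 0 < T) (t : ℝ) : 0 < dispersion μ T t := kFun_pos hT _

lemma dispersion_neg (μ T t : ℝ) : dispersion μ T (-t) = dispersion μ T t := by
  rw [dispersion, dispersion, mul_neg, neg_sq]

lemma continuous_dispersion (μ : ℝ) (hT : 0 < T) : Continuous (dispersion μ T) :=
  (continuous_kFun hT).comp (by fun_prop)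

lemma exists_le_dispersion (hμ : 0 ≤ μ) (hT : 0 < T) :
    ∃ c : ℝ, 0 < c ∧ ∀ t, c * (1 + t ^ 2) ≤ dispersion μ T t := by
  -- Chosen so that `(1 - θ) 2T + θ ((2πt)² - μ) = T + θ (2πt)²`, a convex combination of two lower
  -- bounds for `kFun`.
  set θ : ℝ := T / (2 * T + μ) with hθ
  have hθ0 : 0 < θ := by positivity
  have hθ1 : θ ≤ 1 := by rw [hθ, div_le_one (by positivity)]; linarith
  have hθT : θ * (2 * T + μ) = T := div_mul_cancel₀ _ (by positivity)
  refine ⟨min T θ, lt_min hT hθ0, fun t => ?_⟩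
  have h1 := two_mul_le_kFun hT ((2 * Real.pi * t) ^ 2 - μ)
  have h2 := (le_abs_self _).trans (abs_le_kFun hT ((2 * Real.pi * t) ^ 2 - μ))
  have h3 : t ^ 2 ≤ (2 * Real.pi * t) ^ 2 := by
    rw [mul_pow]
    have h : 1 ≤ (2 * Real.pi) ^ 2 := by nlinarith [Real.pi_gt_three]
    exact le_mul_of_one_le_left (sq_nonneg t) h
  rw [dispersion]
  set k := kFun T ((2 * Real.pi * t) ^ 2 - μ)
  have h4 : T + θ * (2 * Real.pi * t) ^ 2 ≤ k := by nlinarith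
  have h5 : min T θ * (1 + t ^ 2) ≤ T + θ * t ^ 2 := by
    have := min_le_left T θ
    have := min_le_right T θ
    nlinarith [sq_nonneg t]
  nlinarith

lemma integrable_inv_dispersion (hμ : 0 ≤ μ) (hT : 0 < T) :
    Integrable fun t => (dispersion μ T t)⁻¹ := by
  obtain ⟨c, hc, h⟩ := exists_le_dispersion hμ hT
  refine (integrable_inv_one_add_sq.const_mul c⁻¹).mono'
    ((continuous_dispersion μ hT).inv₀ fun t => (dispersion_pos hT t).ne').aestronglyMeasurable
    (ae_of_all _ fun t => ?_)
  rw [Real.norm_of_nonneg (inv_nonneg.2 (dispersion_pos hT t).le), ← mul_inv]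
  exact inv_anti₀ (by positivity) (h t)

/-- The integral of `1 / K_T` over all momenta. -/
def gapInt (μ T : ℝ) : ℝ := ∫ t, (dispersion μ T t)⁻¹

lemma gapInt_nonneg (hT : 0 < T) : 0 ≤ gapInt μ T :=
  integral_nonneg fun t => inv_nonneg.2 (dispersion_pos hT t).le

lemma gapInt_strictAnti (hμ : 0 ≤ μ) {T' : ℝ} (hT : 0 < T) (h : T < T') :
    gapInt μ T' < gapInt μ T := by
  have hT' := hT.trans h
  have hlt : ∀ t, (dispersion μ T' t)⁻¹ < (dispersion μ T t)⁻¹ := fun t =>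
    inv_strictAnti₀ (dispersion_pos hT t) (kFun_strictMono hT h _)
  have hi := integrable_inv_dispersion hμ hT
  have hi' := integrable_inv_dispersion hμ hT'
  rw [← sub_pos, gapInt, gapInt, ← integral_sub hi hi',
    integral_pos_iff_support_of_nonneg (fun t => sub_nonneg.2 (hlt t).le) (hi.sub hi')]
  have : (Function.support fun t => (dispersion μ T t)⁻¹ - (dispersion μ T' t)⁻¹) = Set.univ := by
    ext t
    simpa using (sub_pos.2 (hlt t)).ne'
  rw [this]
  simp

lemma exists_gapInt_lt (hμ : 0 ≤ μ) {ε : ℝ} (hε : 0 < ε) : ∃ T : ℝ, 0 < T ∧ gapInt μ T < ε := by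
  have h : Tendsto (fun T => gapInt μ T) atTop (𝓝 (∫ _ : ℝ, (0 : ℝ))) := by
    refine tendsto_integral_filter_of_dominated_convergence (fun t => (dispersion μ 1 t)⁻¹) ?_ ?_
      (integrable_inv_dispersion hμ one_pos) (ae_of_all _ fun t => ?_)
    · filter_upwards [eventually_gt_atTop 0] with T hT
      exact (integrable_inv_dispersion hμ hT).1
    · filter_upwards [eventually_gt_atTop 1] with T hT
      refine ae_of_all _ fun t => ?_
      have h0 : 0 < T := one_pos.trans hT
      rw [Real.norm_of_nonneg (inv_nonneg.2 (dispersion_pos h0 t).le)]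
      exact inv_anti₀ (dispersion_pos one_pos t) (kFun_strictMono one_pos hT _).le
    · refine tendsto_inv_atTop_zero.comp (tendsto_atTop_mono' _ ?_ tendsto_id)
      filter_upwards [eventually_gt_atTop 0] with T hT
      have := two_mul_le_kFun hT ((2 * Real.pi * t) ^ 2 - μ)
      simp only [id, dispersion]
      linarith
  rw [integral_zero] at h
  obtain ⟨T, h1, h2⟩ := ((h.eventually (gt_mem_nhds hε)).and (eventually_gt_atTop 0)).exists
  exact ⟨T, h2, h1⟩

/-- Logarithmic divergence at the Fermi momentum `t₀ = √μ / 2π`: just above it the dispersion is at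
most `2T + C (t - t₀)`, whose reciprocal integrates over a unit interval to `log (1 + C / 2T) / C`.
-/
lemma exists_lt_gapInt (hμ : 0 ≤ μ) (M : ℝ) : ∃ T : ℝ, 0 < T ∧ M < gapInt μ T := by
  set t₀ : ℝ := √μ / (2 * Real.pi) with ht₀
  have ht₀0 : 0 ≤ t₀ := by positivity
  set C : ℝ := (2 * Real.pi) ^ 2 * (2 * t₀ + 1) with hC
  have hC0 : 0 < C := by positivity
  -- This makes `C / (2T) = exp (C M)`, so the logarithm exceeds `C M`.
  set T : ℝ := C / (2 * Real.exp (C * M)) with hT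
  have hT0 : 0 < T := by positivity
  refine ⟨T, hT0, ?_⟩
  have hsq : (2 * Real.pi * t₀) ^ 2 = μ := by
    rw [ht₀, mul_div_cancel₀ _ (by positivity), Real.sq_sqrt hμ]
  have hbound : ∀ t ∈ Set.Icc t₀ (t₀ + 1), dispersion μ T t ≤ C * t + (2 * T - C * t₀) :=
    fun t ht => by
      have h1 := kFun_le hT0 ((2 * Real.pi * t) ^ 2 - μ)
      have h2 : (2 * Real.pi * t) ^ 2 - μ = (2 * Real.pi) ^ 2 * ((t + t₀) * (t - t₀)) := by
        rw [← hsq]; ring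
      have h3 : 0 ≤ (t + t₀) * (t - t₀) :=
        mul_nonneg (by linarith [ht.1]) (sub_nonneg.2 ht.1)
      have h4 : (t + t₀) * (t - t₀) ≤ (2 * t₀ + 1) * (t - t₀) :=
        mul_le_mul_of_nonneg_right (by linarith [ht.2]) (sub_nonneg.2 ht.1)
      rw [h2, abs_of_nonneg (by positivity)] at h1
      have h5 := mul_le_mul_of_nonneg_left h4 (sq_nonneg (2 * Real.pi))
      rw [dispersion, h2, hC]
      linarith
  have hpos : ∀ t ∈ Set.Icc t₀ (t₀ + 1), 0 < C * t + (2 * T - C * t₀) := fun t ht =>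
    (dispersion_pos hT0 t).trans_le (hbound t ht)
  have hint : ∫ t in t₀..(t₀ + 1), (C * t + (2 * T - C * t₀))⁻¹ =
      C⁻¹ * Real.log ((2 * T + C) / (2 * T)) := by
    rw [intervalIntegral.integral_comp_mul_add (fun x => x⁻¹) hC0.ne',
      integral_inv_of_pos (by nlinarith) (by nlinarith), smul_eq_mul]
    congr 3 <;> ring
  have hle : ∫ t in t₀..(t₀ + 1), (C * t + (2 * T - C * t₀))⁻¹ ≤ gapInt μ T := by
    rw [intervalIntegral.integral_of_le (by linarith), gapInt]
    refine le_trans ?_ (setIntegral_le_integral (s := Set.Ioc t₀ (t₀ + 1))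
      (integrable_inv_dispersion hμ hT0) (ae_of_all _ fun t =>
        inv_nonneg.2 (dispersion_pos hT0 t).le))
    refine setIntegral_mono_on ?_ (integrable_inv_dispersion hμ hT0).integrableOn measurableSet_Ioc
      fun t ht => inv_anti₀ (dispersion_pos hT0 t) (hbound t (Set.Ioc_subset_Icc_self ht))
    refine (ContinuousOn.integrableOn_Icc ?_).mono_set Set.Ioc_subset_Icc_self
    exact ContinuousOn.inv₀ (by fun_prop) fun t ht => (hpos t ht).ne'
  refine lt_of_lt_of_le ?_ hle
  rw [hint, lt_inv_mul_iff₀ hC0, Real.lt_log_iff_exp_lt (by positivity), add_div,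
    div_self (by positivity)]
  have : C / (2 * T) = Real.exp (C * M) := by
    rw [hT]; field_simp
  rw [this]
  linarith

end Dispersion

/-! ### Ellipticity -/

section Elliptic

variable {μ T : ℝ}

lemma symbol_dFun (μ T : ℝ) (ξ : Plane) :
    symbol μ (dFun T) ξ = dispersion μ T (ξ 0) / 2 + dispersion μ T (ξ 1) / 2 := rfl

lemma isElliptic_of_dFun_le (hμ : 0 ≤ μ) (hT : 0 < T) {mm : ℝ → ℝ → ℝ}
    (hm : Measurable (symbol μ mm)) (hle : ∀ a b, dFun T a b ≤ mm a b) :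
    IsElliptic (symbol μ mm) := by
  obtain ⟨c, hc, h⟩ := exists_le_dispersion hμ hT
  refine ⟨hm, c / 2, by positivity, fun ξ => ?_⟩
  refine le_trans ?_ (hle _ _)
  have h0 := h (ξ 0)
  have h1 := h (ξ 1)
  change _ ≤ dispersion μ T (ξ 0) / 2 + dispersion μ T (ξ 1) / 2
  rw [EuclideanSpace.norm_sq_eq, Fin.sum_univ_two, Real.norm_eq_abs, Real.norm_eq_abs, sq_abs,
    sq_abs]
  linarith

lemma isElliptic_dFun (hμ : 0 ≤ μ) (hT : 0 < T) : IsElliptic (symbol μ (dFun T)) := by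
  refine isElliptic_of_dFun_le hμ hT ?_ fun _ _ => le_rfl
  have := (continuous_dispersion μ hT).measurable
  simp only [funext (symbol_dFun μ T)]
  fun_prop

lemma isElliptic_lFun (hμ : 0 ≤ μ) (hT : 0 < T) : IsElliptic (symbol μ (lFun T)) := by
  refine isElliptic_of_dFun_le hμ hT ?_ (dFun_le_lFun hT)
  have h1 := measurable_tanh
  have h2 : Measurable fun z : ℝ × ℝ => lFun T z.1 z.2 := by
    unfold lFun
    refine Measurable.ite (measurableSet_eq_fun (by fun_prop) measurable_const) ?_ ?_
    · exact (Real.continuous_cosh.measurable.comp (by fun_prop)).pow_const 2 |>.const_mul _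
    · exact Measurable.div (by fun_prop)
        ((h1.comp (by fun_prop)).add (h1.comp (by fun_prop)))
  exact h2.comp (g := fun z : ℝ × ℝ => lFun T z.1 z.2)
    (f := fun ξ : Plane => ((2 * Real.pi * ξ 0) ^ 2 - μ, (2 * Real.pi * ξ 1) ^ 2 - μ)) (by fun_prop)

lemma integral_inv_dispersion_sub (s : ℝ) : ∫ t, (dispersion μ T (s - t))⁻¹ = gapInt μ T :=
  integral_sub_left_eq_self (fun t => (dispersion μ T t)⁻¹) volume s

/-- The reciprocal of a mean is at most the mean of the reciprocals, and by translation invariance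
both reciprocals integrate to `gapInt`, whatever `s` is. Only the lower bound by `dFun` enters, so
the same constant serves `lFun`. -/
lemma lintegral_inv_symbol_le (hμ : 0 ≤ μ) (hT : 0 < T) {mm : ℝ → ℝ → ℝ}
    (hle : ∀ a b, dFun T a b ≤ mm a b) (s : ℝ) :
    ∫⁻ t, (ENNReal.ofReal (symbol μ mm (shear (s, t))))⁻¹ ≤ ENNReal.ofReal (gapInt μ T) := by
  have hi := integrable_inv_dispersion hμ hT
  have hi' : Integrable fun t => (dispersion μ T (s - t))⁻¹ := hi.comp_sub_left s
  have hsum : gapInt μ T = ∫ t, ((dispersion μ T (s - t))⁻¹ + (dispersion μ T t)⁻¹) / 2 := by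
    rw [integral_div, integral_add hi' hi, integral_inv_dispersion_sub, gapInt]
    ring
  have hpos : ∀ t, 0 < dispersion μ T t := dispersion_pos hT
  have hi2 : Integrable fun t => ((dispersion μ T (s - t))⁻¹ + (dispersion μ T t)⁻¹) / 2 :=
    (hi'.add hi).div_const 2
  rw [hsum, ofReal_integral_eq_lintegral_ofReal hi2
    (ae_of_all _ fun t => by have := hpos (s - t); have := hpos t; positivity)]
  refine lintegral_mono fun t => ?_
  have ha := hpos (s - t)
  have hb := hpos t
  have hm : dispersion μ T (s - t) / 2 + dispersion μ T t / 2 ≤ symbol μ mm (shear (s, t)) :=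
    hle _ _
  have hm0 : 0 < symbol μ mm (shear (s, t)) := lt_of_lt_of_le (by positivity) hm
  rw [← ENNReal.ofReal_inv_of_pos hm0]
  refine ENNReal.ofReal_le_ofReal ?_
  refine (inv_anti₀ (by positivity) hm).trans ?_
  set A := dispersion μ T (s - t)
  set B := dispersion μ T t
  rw [inv_le_iff_one_le_mul₀ (by positivity)]
  have h1 : (A⁻¹ + B⁻¹) / 2 * (A / 2 + B / 2) = (A + B) ^ 2 / (4 * (A * B)) := by
    field_simp; ring
  rw [h1, le_div_iff₀ (by positivity)]
  nlinarith [sq_nonneg (A - B)]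

end Elliptic

/-! ### The line above the critical temperature -/

lemma lineInf_pos {μ T lam : ℝ} (hμ : 0 ≤ μ) (hT : 0 < T) (hlam : 0 < lam) {mm : ℝ → ℝ → ℝ}
    (hell : IsElliptic (symbol μ mm)) (hsym : ∀ a b, mm a b = mm b a)
    (hle : ∀ a b, dFun T a b ≤ mm a b) (h : lam * gapInt μ T < 1) : 0 < lineInf μ mm lam := by
  refine (line_formModel hell hsym lam).infSpectrum_pos (δ := 1 - lam * gapInt μ T) (by linarith)
    fun ψ _ hi => ?_
  have h1 := hell.integral_fibre_le hi (gapInt_nonneg hT) (lintegral_inv_symbol_le hμ hT hle)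
  rw [sub_sub_cancel, mul_assoc]
  exact mul_le_mul_of_nonneg_left h1 hlam.le

/-! ### Trial functions -/

/-- Cauchy-Schwarz on an interval of length `2ε`, obtained from nonnegativity of the variance of
`‖g‖` about its mean `a`. -/
lemma sq_norm_setIntegral_le {g : ℝ → ℂ} (hg : MemLp g 2) {ε : ℝ} (hε : 0 < ε) :
    ‖∫ s in Set.Icc (-ε) ε, g s‖ ^ 2 ≤ 2 * ε * ∫ s, ‖g s‖ ^ 2 := by
  have h2 := integrable_sq_of_memLp hg
  have h1 : Integrable (fun s => ‖g s‖) (volume.restrict (Set.Icc (-ε) ε)) :=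
    ((hg.restrict _).integrable one_le_two).norm
  set n := ∫ s in Set.Icc (-ε) ε, ‖g s‖ with hn
  have hle : ‖∫ s in Set.Icc (-ε) ε, g s‖ ≤ n := norm_integral_le_integral_norm _
  have h3 : ∫ s in Set.Icc (-ε) ε, ‖g s‖ ^ 2 ≤ ∫ s, ‖g s‖ ^ 2 :=
    setIntegral_le_integral h2 (ae_of_all _ fun s => sq_nonneg _)
  set a := n / (2 * ε) with ha
  have h4 : 0 ≤ ∫ s in Set.Icc (-ε) ε, (‖g s‖ - a) ^ 2 := integral_nonneg fun s => sq_nonneg _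
  have h5 : ∫ s in Set.Icc (-ε) ε, (‖g s‖ - a) ^ 2 =
      (∫ s in Set.Icc (-ε) ε, ‖g s‖ ^ 2) - 2 * a * n + 2 * ε * a ^ 2 := by
    have e : ∀ s, (‖g s‖ - a) ^ 2 = ‖g s‖ ^ 2 - 2 * a * ‖g s‖ + a ^ 2 := fun s => by ring
    simp only [e]
    have h6 : Integrable (fun s => ‖g s‖ ^ 2 - 2 * a * ‖g s‖) (volume.restrict (Set.Icc (-ε) ε)) :=
      h2.integrableOn.sub (h1.const_mul _)
    rw [integral_add h6 (integrable_const _),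
      integral_sub h2.integrableOn (h1.const_mul _), integral_const_mul, ← hn]
    simp [Measure.real, hε.le, two_mul]
  have hna : n = 2 * ε * a := by rw [ha]; field_simp
  have hn2 : n ^ 2 = 2 * ε * (2 * a * n - 2 * ε * a ^ 2) := by rw [hna]; ring
  refine (pow_le_pow_left₀ (norm_nonneg _) hle 2).trans ?_
  rw [hn2]
  have : 0 < 2 * ε := by positivity
  exact mul_le_mul_of_nonneg_left (by linarith) this.le

/-- Momenta with total momentum at most `ε`. -/
def band (ε : ℝ) : Set Plane := {ξ | |ξ 0 + ξ 1| ≤ ε}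

lemma measurableSet_band (ε : ℝ) : MeasurableSet (band ε) := by
  have := measurable_coord
  exact measurableSet_le (by fun_prop) measurable_const

lemma shear_mem_band {ε s t : ℝ} : shear (s, t) ∈ band ε ↔ s ∈ Set.Icc (-ε) ε := by
  simp [band, abs_le]

lemma integrable_prod_shear {E : Type*} [NormedAddCommGroup E] {f : Plane → E} (hf : Integrable f) :
    Integrable (fun z : ℝ × ℝ => f (shear z)) (volume.prod volume) :=
  (measurePreserving_shear.integrable_comp_emb shear.measurableEmbedding).2 hf

lemma integral_shear {E : Type*} [NormedAddCommGroup E] [NormedSpace ℝ E] {f : Plane → E}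
    (hf : Integrable f) :
    ∫ ξ, f ξ = ∫ s, ∫ t, f (shear (s, t)) := by
  rw [← measurePreserving_shear.integral_comp shear.measurableEmbedding, Measure.volume_eq_prod,
    integral_prod _ (integrable_prod_shear hf)]

lemma setIntegral_band {f : Plane → ℝ} (hf : Integrable f) (ε : ℝ) :
    ∫ ξ in band ε, f ξ = ∫ s in Set.Icc (-ε) ε, ∫ t, f (shear (s, t)) := by
  rw [← integral_indicator (measurableSet_band ε), ← integral_indicator measurableSet_Icc,
    integral_shear (hf.indicator (measurableSet_band ε))]
  congr 1
  ext s
  by_cases hs : s ∈ Set.Icc (-ε) ε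
  · rw [Set.indicator_of_mem hs]
    simp only [Set.indicator_of_mem (shear_mem_band.2 hs)]
  · rw [Set.indicator_of_notMem hs]
    simp [Set.indicator_of_notMem (mt shear_mem_band.1 hs)]

section Elliptic

variable {m : Plane → ℝ} (hm : IsElliptic m)
include hm

lemma IsElliptic.integrable_indicator_band (ε : ℝ) :
    Integrable ((band ε).indicator fun ξ => (m ξ)⁻¹) := by
  obtain ⟨N, hN0, hN⟩ := hm.exists_lintegral_inv_le
  have hmeas : Measurable ((band ε).indicator fun ξ => (m ξ)⁻¹) :=
    hm.measurable.inv.indicator (measurableSet_band ε)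
  refine ⟨hmeas.aestronglyMeasurable, ?_⟩
  rw [HasFiniteIntegral, ← lintegral_shear _ hmeas.enorm.aemeasurable]
  have h : ∀ s, ∫⁻ t, ‖(band ε).indicator (fun ξ => (m ξ)⁻¹) (shear (s, t))‖ₑ ≤
      (Set.Icc (-ε) ε).indicator (fun _ => ENNReal.ofReal N) s := fun s => by
    by_cases hs : s ∈ Set.Icc (-ε) ε
    · rw [Set.indicator_of_mem hs]
      refine le_trans (le_of_eq ?_) (hN s)
      refine lintegral_congr fun t => ?_
      rw [Set.indicator_of_mem (shear_mem_band.2 hs), ← ENNReal.ofReal_inv_of_pos (hm.pos _),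
        Real.enorm_of_nonneg (inv_nonneg.2 (hm.pos _).le)]
    · rw [Set.indicator_of_notMem hs]
      simp [Set.indicator_of_notMem (mt shear_mem_band.1 hs)]
  refine (lintegral_mono h).trans_lt ?_
  rw [lintegral_indicator measurableSet_Icc, lintegral_const]
  exact ENNReal.mul_lt_top ENNReal.ofReal_lt_top (by simp)

lemma IsElliptic.measurable_inv_shear (s : ℝ) : Measurable fun t => (m (shear (s, t)))⁻¹ :=
  (hm.measurable.comp (shear.measurable.comp measurable_prodMk_left)).inv

lemma IsElliptic.integrable_inv_shear (s : ℝ) : Integrable fun t => (m (shear (s, t)))⁻¹ := by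
  obtain ⟨N, hN0, hN⟩ := hm.exists_lintegral_inv_le
  refine ⟨(hm.measurable_inv_shear s).aestronglyMeasurable, ?_⟩
  rw [HasFiniteIntegral]
  refine lt_of_le_of_lt (le_of_eq ?_) ((hN s).trans_lt ENNReal.ofReal_lt_top)
  refine lintegral_congr fun t => ?_
  rw [← ENNReal.ofReal_inv_of_pos (hm.pos _), Real.enorm_of_nonneg (inv_nonneg.2 (hm.pos _).le)]

/-- Ellipticity gives a majorant uniform in `s`. Continuity is required only for almost every `t`,
which suits `lFun` and its exceptional Fermi momenta. -/
lemma IsElliptic.continuousAt_integral_inv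
    (hc : ∀ᵐ t, ContinuousAt (fun s => m (shear (s, t))) 0) :
    ContinuousAt (fun s => ∫ t, (m (shear (s, t)))⁻¹) 0 := by
  obtain ⟨c, hc0, h⟩ := hm.exists_le
  refine continuousAt_of_dominated (bound := fun t => c⁻¹ * (1 + t ^ 2)⁻¹)
    (Eventually.of_forall fun s => (hm.integrable_inv_shear s).1)
    (Eventually.of_forall fun s => ae_of_all _ fun t => ?_)
    (integrable_inv_one_add_sq.const_mul _) ?_
  · rw [Real.norm_of_nonneg (inv_nonneg.2 (hm.pos _).le), ← mul_inv]
    refine inv_anti₀ (by positivity) (le_trans ?_ (h _))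
    exact mul_le_mul_of_nonneg_left (one_add_sq_le_norm_sq_shear s t) hc0.le
  · filter_upwards [hc] with t ht
    exact ht.inv₀ (hm.pos _).ne'

end Elliptic

section Model

variable {H : Type*} [NormedAddCommGroup H] [InnerProductSpace ℂ H]
  {V : Submodule ℂ L2Plane} {m : Plane → ℝ} {κ : ℝ} {S Q : Set H}
  {a : H → H → ℂ} {W : V →ₗᵢ[ℂ] H}

/-- Take `ψ = η / m` and let `b` be the integral of its fibre over `|s| ≤ ε`. The kinetic term is `n
b`, Cauchy-Schwarz gives `b² ≤ 2ε ∫ |fibre ψ|²`, and `b ≥ 2ε w`; so the contact term is at least `n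
lam w b > n b`. The parameter `n` is 1 on the line and 2 on the half-line. -/
lemma FormModel.infSpectrum_neg_of_trial [CompleteSpace V] (h : FormModel V m κ S Q a W)
    {n lam ε w : ℝ} (hn : 0 < n) (hlam : 0 < lam) (hκ : κ = n * lam) (hε : 0 < ε) {η : Plane → ℝ}
    (hη : ∀ ξ, |η ξ| ≤ 1) (hi : Integrable fun ξ => η ξ / m ξ)
    (hV : ∀ ψ : L2Plane, (ψ =ᵐ[volume] fun ξ => ((η ξ / m ξ : ℝ) : ℂ)) → ψ ∈ V)
    (hA : ∫ ξ, η ξ * (η ξ / m ξ) = n * ∫ ξ in band ε, η ξ / m ξ)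
    (hw : ∀ s ∈ Set.Icc (-ε) ε, w ≤ ∫ t, η (shear (s, t)) / m (shear (s, t)))
    (hlw : 1 < lam * w) : infSpectrum S Q a < 0 := by
  have hm := h.elliptic
  obtain ⟨c, hc, hcm⟩ := hm.exists_le
  have hcm' : ∀ ξ, c ≤ m ξ := fun ξ => le_trans (by nlinarith [sq_nonneg ‖ξ‖]) (hcm ξ)
  have hmem : MemLp (fun ξ => ((η ξ / m ξ : ℝ) : ℂ)) 2 := by
    rw [memLp_two_iff_integrable_sq_norm hi.ofReal.1]
    refine (hi.norm.const_mul c⁻¹).mono' (hi.ofReal.1.norm.pow 2) (ae_of_all _ fun ξ => ?_)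
    rw [Real.norm_of_nonneg (sq_nonneg _), Complex.norm_real, sq]
    refine mul_le_mul_of_nonneg_right ?_ (norm_nonneg _)
    rw [norm_div, Real.norm_eq_abs, Real.norm_of_nonneg (hm.pos ξ).le, div_eq_mul_inv]
    exact (mul_le_mul (hη ξ) (inv_anti₀ hc (hcm' ξ)) (inv_nonneg.2 (hm.pos ξ).le)
      zero_le_one).trans_eq (one_mul _)
  set ψ : L2Plane := hmem.toLp with hψ
  have hψe : ψ =ᵐ[volume] fun ξ => ((η ξ / m ξ : ℝ) : ℂ) := hmem.coeFn_toLp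
  have hsq : (fun ξ => m ξ * ‖ψ ξ‖ ^ 2) =ᵐ[volume] fun ξ => η ξ * (η ξ / m ξ) := by
    filter_upwards [hψe] with ξ hξ
    rw [hξ, Complex.norm_real, Real.norm_eq_abs, sq_abs]
    have := (hm.pos ξ).ne'
    field_simp
  have hint : Integrable fun ξ => η ξ * (η ξ / m ξ) := by
    have hmη : AEStronglyMeasurable η := by
      refine (hi.1.mul hm.measurable.aestronglyMeasurable).congr (ae_of_all _ fun ξ => ?_)
      exact div_mul_cancel₀ _ (hm.pos ξ).ne'
    exact hi.bdd_mul hmη (ae_of_all _ hη)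
  have hψi : Integrable fun ξ => m ξ * ‖ψ ξ‖ ^ 2 := hint.congr hsq.symm
  refine h.infSpectrum_neg (by rw [hκ]; positivity) (hV ψ hψe) hψi ?_
  set b := ∫ s in Set.Icc (-ε) ε, ∫ t, η (shear (s, t)) / m (shear (s, t)) with hb
  rw [integral_congr_ae hsq, hA, setIntegral_band hi, ← hb]
  have hfib : ∫ s in Set.Icc (-ε) ε, fibre ψ s = (b : ℂ) := by
    rw [hb]
    refine Eq.trans ?_ integral_ofReal
    refine integral_congr_ae (ae_restrict_of_ae ?_)
    filter_upwards [fibre_congr hψe] with s hs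
    rw [hs, fibre]
    exact integral_ofReal
  have h1 := sq_norm_setIntegral_le (hm.memLp_fibre' hψi) hε
  rw [hfib, Complex.norm_real, Real.norm_eq_abs, sq_abs] at h1
  have hbw : 2 * ε * w ≤ b := by
    have hG : Integrable fun s => ∫ t, η (shear (s, t)) / m (shear (s, t)) :=
      (integrable_prod_shear hi).integral_prod_left
    have h2 : ∫ _ in Set.Icc (-ε) ε, w = 2 * ε * w := by
      simp [Measure.real, hε.le, two_mul]
    rw [← h2]
    exact setIntegral_mono_on (by simp) hG.integrableOn measurableSet_Icc hw
  have hw0 : 0 < w := by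
    by_contra hcon
    nlinarith
  have hb0 : 0 < b := lt_of_lt_of_le (by positivity) hbw
  have h3 : 2 * ε < lam * b := by
    calc 2 * ε < 2 * ε * (lam * w) := lt_mul_of_one_lt_right (by positivity) hlw
      _ = lam * (2 * ε * w) := by ring
      _ ≤ lam * b := mul_le_mul_of_nonneg_left hbw hlam.le
  have h4 : 2 * ε * (n * b) < 2 * ε * (κ * ∫ s, ‖fibre ψ s‖ ^ 2) := by
    calc 2 * ε * (n * b) = n * b * (2 * ε) := by ring
      _ < n * b * (lam * b) := mul_lt_mul_of_pos_left h3 (by positivity)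
      _ = κ * b ^ 2 := by rw [hκ]; ring
      _ ≤ κ * (2 * ε * ∫ s, ‖fibre ψ s‖ ^ 2) :=
        mul_le_mul_of_nonneg_left h1 (by rw [hκ]; positivity)
      _ = _ := by ring
  exact lt_of_mul_lt_mul_left h4 (by positivity)

end Model

/-! ### Trial function on the line -/

section Line

variable {μ : ℝ} {mm : ℝ → ℝ → ℝ} {lam : ℝ}

lemma exists_lt_integral_inv {m : Plane → ℝ} (hm : IsElliptic m)
    (hc : ∀ᵐ t, ContinuousAt (fun s => m (shear (s, t))) 0) {v : ℝ}
    (hv : v < ∫ t, (m (shear (0, t)))⁻¹) :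
    ∃ r : ℝ, 0 < r ∧ ∀ s, |s| ≤ r → v < ∫ t, (m (shear (s, t)))⁻¹ := by
  obtain ⟨r, hr, h⟩ := Metric.eventually_nhds_iff.1
    ((hm.continuousAt_integral_inv hc).eventually (lt_mem_nhds hv))
  refine ⟨r / 2, by positivity, fun s hs => h ?_⟩
  rw [Real.dist_eq, sub_zero]
  linarith

lemma exists_one_lt_mul {lam x : ℝ} (hlam : 0 < lam) (h : 1 < lam * x) :
    ∃ v < x, 1 < lam * v := by
  obtain ⟨v, h1, h2⟩ := exists_between ((div_lt_iff₀' hlam).2 h)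
  exact ⟨v, h2, (div_lt_iff₀' hlam).1 h1⟩

lemma exchange_mem_band {ε : ℝ} {ξ : Plane} : exchange ξ ∈ band ε ↔ ξ ∈ band ε := by
  simp [band, exchange, add_comm]

/-- On each fibre `1 / m` is the case of equality in Cauchy-Schwarz. It is cut off to small total
momentum, where by continuity the fibre integrals still exceed `v`. -/
lemma lineInf_neg (hell : IsElliptic (symbol μ mm)) (hsym : ∀ a b, mm a b = mm b a)
    (hc : ∀ᵐ t, ContinuousAt (fun s => symbol μ mm (shear (s, t))) 0) (hlam : 0 < lam)
    (h : 1 < lam * ∫ t, (symbol μ mm (shear (0, t)))⁻¹) : lineInf μ mm lam < 0 := by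
  obtain ⟨v, hv, hlv⟩ := exists_one_lt_mul hlam h
  obtain ⟨ε, hε, hs⟩ := exists_lt_integral_inv hell hc hv
  have e : ∀ ξ, (band ε).indicator (fun _ => (1 : ℝ)) ξ / symbol μ mm ξ =
      (band ε).indicator (fun ξ => (symbol μ mm ξ)⁻¹) ξ := fun ξ => by
    by_cases hξ : ξ ∈ band ε <;> simp [hξ]
  refine (line_formModel hell hsym lam).infSpectrum_neg_of_trial (n := 1) one_pos hlam
    (one_mul _).symm hε (w := v) (η := (band ε).indicator fun _ => 1) (fun ξ => ?_) ?_
    (fun ψ hψ => ?_) ?_ (fun s hs' => ?_) hlv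
  · by_cases hξ : ξ ∈ band ε <;> simp [hξ]
  · simp only [e]
    exact hell.integrable_indicator_band ε
  · rw [lineSpace, mem_isoSpace_iff_ae]
    filter_upwards [hψ, exchangeIso.measurePreserving.quasiMeasurePreserving.ae hψ] with ξ h1 h2
    rw [h1, h2, symbol_exchangeIso hsym, one_mul, exchangeIso_apply]
    by_cases hξ : ξ ∈ band ε
    · rw [Set.indicator_of_mem hξ, Set.indicator_of_mem (exchange_mem_band.2 hξ)]
    · rw [Set.indicator_of_notMem hξ, Set.indicator_of_notMem (mt exchange_mem_band.1 hξ)]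
  · rw [one_mul, ← integral_indicator (measurableSet_band ε)]
    congr 1
    ext ξ
    by_cases hξ : ξ ∈ band ε <;> simp [hξ]
  · simp only [Set.indicator_of_mem (shear_mem_band.2 hs'), one_div]
    exact (hs s (abs_le.2 hs')).le

end Line

/-! ### Trial function on the half-line -/

section Half

variable {μ : ℝ} {mm : ℝ → ℝ → ℝ} {lam : ℝ}

lemma mirror_zero_mem_band {ε : ℝ} {ξ : Plane} : mirror 0 ξ ∈ band ε ↔ mirror 1 ξ ∈ band ε := by
  simp only [band, Set.mem_ofPred_eq, mirror_apply]
  rw [← abs_neg]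
  simp [add_comm]

/-- The numerator of the trial function on the half-line. -/
def oddBand (ε : ℝ) (ξ : Plane) : ℝ :=
  (band ε).indicator 1 ξ - (band ε).indicator 1 (mirror 1 ξ)

lemma indicator_congr_mem {A : Set Plane} {x y : Plane} (h : x ∈ A ↔ y ∈ A) :
    A.indicator (1 : Plane → ℝ) x = A.indicator 1 y := by
  by_cases hx : x ∈ A
  · rw [Set.indicator_of_mem hx, Set.indicator_of_mem (h.1 hx)]; rfl
  · rw [Set.indicator_of_notMem hx, Set.indicator_of_notMem (mt h.2 hx)]

lemma oddBand_mirror_one (ε : ℝ) (ξ : Plane) : oddBand ε (mirror 1 ξ) = -oddBand ε ξ := by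
  rw [oddBand, oddBand, mirror_mirror, neg_sub]

lemma oddBand_mirror_zero (ε : ℝ) (ξ : Plane) : oddBand ε (mirror 0 ξ) = -oddBand ε ξ := by
  have h1 : mirror 1 (mirror 0 ξ) ∈ band ε ↔ ξ ∈ band ε := by
    rw [← mirror_zero_mem_band, mirror_mirror]
  rw [oddBand, oddBand, indicator_congr_mem h1, indicator_congr_mem mirror_zero_mem_band, neg_sub]

lemma oddBand_exchange (ε : ℝ) (ξ : Plane) : oddBand ε (exchange ξ) = oddBand ε ξ := by
  rw [oddBand, oddBand, indicator_congr_mem exchange_mem_band, mirror_one_exchange,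
    indicator_congr_mem exchange_mem_band, indicator_congr_mem mirror_zero_mem_band]

/-- The numerator is the indicator of the band around `p + q = 0` minus that of its reflection
around `p - q = 0`. On a fibre inside the first band the second occupies only `|t| ≤ ε`, so it costs
little, while oddness doubles the kinetic term in step with the coupling `2 * lam`. -/
lemma halfInf_neg (hell : IsElliptic (symbol μ mm)) (hsym : ∀ a b, mm a b = mm b a)
    (hc : ∀ᵐ t, ContinuousAt (fun s => symbol μ mm (shear (s, t))) 0) (hlam : 0 < lam)
    (h : 1 < lam * ∫ t, (symbol μ mm (shear (0, t)))⁻¹) : halfInf μ mm lam < 0 := by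
  obtain ⟨v, hv, hlv⟩ := exists_one_lt_mul hlam h
  obtain ⟨w, hw, hlw⟩ := exists_one_lt_mul hlam hlv
  obtain ⟨r, hr, hs⟩ := exists_lt_integral_inv hell hc hv
  obtain ⟨c, hc0, hcm⟩ := hell.exists_le
  have hcm' : ∀ ξ, c ≤ symbol μ mm ξ := fun ξ =>
    le_trans (by nlinarith [sq_nonneg ‖ξ‖]) (hcm ξ)
  -- The reflected band removes at most `2ε / c` from a fibre integral; this must fit into the gap
  -- `v - w`.
  set ε := min r (c * (v - w) / 2) with hεd
  have hε : 0 < ε := lt_min hr (by have := sub_pos.2 hw; positivity)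
  have hm0 : ∀ ξ, symbol μ mm (mirror 1 ξ) = symbol μ mm ξ := symbol_mirror μ mm 1
  have hbi : Integrable fun ξ => (band ε).indicator 1 ξ / symbol μ mm ξ := by
    refine (hell.integrable_indicator_band ε).congr (ae_of_all _ fun ξ => ?_)
    by_cases hξ : ξ ∈ band ε <;> simp [hξ]
  have hbi' : Integrable fun ξ => (band ε).indicator 1 (mirror 1 ξ) / symbol μ mm ξ := by
    have := ((mirror 1).measurePreserving.integrable_comp_emb (measurableEmbedding_mirror 1)).2 hbi
    refine this.congr (ae_of_all _ fun ξ => ?_)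
    simp only [Function.comp, hm0]
  have hi : Integrable fun ξ => oddBand ε ξ / symbol μ mm ξ := by
    simp only [oddBand, sub_div]
    exact hbi.sub hbi'
  refine (half_formModel hell hsym lam).infSpectrum_neg_of_trial (n := 2) two_pos hlam
    rfl hε (w := w) (η := oddBand ε) (fun ξ => ?_) hi (fun ψ hψ => ?_) ?_ (fun s hs' => ?_) hlw
  · rw [oddBand]
    by_cases h1 : ξ ∈ band ε <;> by_cases h2 : mirror 1 ξ ∈ band ε <;> simp [h1, h2]
  · have hm : ∀ i, ∀ᵐ ξ, ψ (mirror i ξ) = -1 * ψ ξ := fun i => by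
      filter_upwards [hψ, (mirror i).measurePreserving.quasiMeasurePreserving.ae hψ] with ξ h1 h2
      have h3 : oddBand ε (mirror i ξ) = -oddBand ε ξ := by
        fin_cases i
        · exact oddBand_mirror_zero ε ξ
        · exact oddBand_mirror_one ε ξ
      rw [h1, h2, symbol_mirror, h3, neg_div, Complex.ofReal_neg, neg_one_mul]
    refine ⟨mem_isoSpace_iff_ae.2 ?_, mem_isoSpace_iff_ae.2 (hm 0), mem_isoSpace_iff_ae.2 (hm 1)⟩
    filter_upwards [hψ, exchangeIso.measurePreserving.quasiMeasurePreserving.ae hψ] with ξ h1 h2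
    rw [h1, h2, symbol_exchangeIso hsym, one_mul, exchangeIso_apply, oddBand_exchange]
  · have h1 : ∫ ξ in band ε, oddBand ε ξ / symbol μ mm ξ =
        ∫ ξ, (band ε).indicator 1 ξ * (oddBand ε ξ / symbol μ mm ξ) := by
      rw [← integral_indicator (measurableSet_band ε)]
      congr 1
      ext ξ
      by_cases hξ : ξ ∈ band ε <;> simp [hξ]
    -- Reflection changes the sign of `oddBand`, so the second half of the square equals the first;
    -- this yields `n = 2`.
    have h2 : ∫ ξ, (band ε).indicator 1 (mirror 1 ξ) * (oddBand ε ξ / symbol μ mm ξ) =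
        -∫ ξ, (band ε).indicator 1 ξ * (oddBand ε ξ / symbol μ mm ξ) := by
      rw [← (mirror 1).measurePreserving.integral_comp (measurableEmbedding_mirror 1),
        ← integral_neg]
      congr 1
      ext ξ
      rw [mirror_mirror, hm0, oddBand_mirror_one]
      ring
    have hbd : ∀ x : Plane, ‖(band ε).indicator (1 : Plane → ℝ) x‖ ≤ 1 := fun x => by
      by_cases hx : x ∈ band ε <;> simp [hx]
    have hmb : Measurable ((band ε).indicator (1 : Plane → ℝ)) :=
      measurable_one.indicator (measurableSet_band ε)
    have e : ∀ ξ, oddBand ε ξ * (oddBand ε ξ / symbol μ mm ξ) =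
        (band ε).indicator 1 ξ * (oddBand ε ξ / symbol μ mm ξ) -
          (band ε).indicator 1 (mirror 1 ξ) * (oddBand ε ξ / symbol μ mm ξ) := fun ξ => by
      rw [← sub_mul]; rfl
    simp only [e]
    have hi2 : Integrable fun ξ =>
        (band ε).indicator 1 (mirror 1 ξ) * (oddBand ε ξ / symbol μ mm ξ) :=
      hi.bdd_mul (hmb.comp (mirror 1).continuous.measurable).aestronglyMeasurable
        (ae_of_all _ fun ξ => hbd _)
    rw [integral_sub (hi.bdd_mul hmb.aestronglyMeasurable (ae_of_all _ hbd)) hi2, h2, h1]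
    ring
  · have hsr : |s| ≤ r := (abs_le.2 hs').trans (min_le_left _ _)
    have hint := hell.integrable_inv_shear s
    have h1 : ∫ t, ((symbol μ mm (shear (s, t)))⁻¹ - (Set.Icc (-ε) ε).indicator (fun _ => c⁻¹) t) =
        (∫ t, (symbol μ mm (shear (s, t)))⁻¹) - 2 * ε * c⁻¹ := by
      rw [integral_sub hint (by
        rw [integrable_indicator_iff measurableSet_Icc]; simp),
        integral_indicator measurableSet_Icc]
      simp [Measure.real, hε.le, two_mul]
    have h2 : 2 * ε * c⁻¹ ≤ v - w := by
      rw [← div_eq_mul_inv, div_le_iff₀ hc0]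
      have := min_le_right r (c * (v - w) / 2)
      linarith
    have h3 := hs s hsr
    have hle : ∀ t, (symbol μ mm (shear (s, t)))⁻¹ - (Set.Icc (-ε) ε).indicator (fun _ => c⁻¹) t ≤
        oddBand ε (shear (s, t)) / symbol μ mm (shear (s, t)) := fun t => by
      have hinv := inv_anti₀ hc0 (hcm' (shear (s, t)))
      rw [oddBand, Set.indicator_of_mem (shear_mem_band.2 hs'), sub_div, Pi.one_apply, one_div]
      refine sub_le_sub_left ?_ _
      by_cases h4 : mirror 1 (shear (s, t)) ∈ band ε
      · have h5 : t ∈ Set.Icc (-ε) ε := by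
          simp only [band, Set.mem_ofPred_eq, mirror_apply] at h4
          simp only [Fin.isValue, zero_ne_one, if_false, if_true, shear_apply_zero,
            shear_apply_one, abs_le] at h4
          constructor <;> linarith [h4.1, h4.2, hs'.1, hs'.2]
        rw [Set.indicator_of_mem h4, Set.indicator_of_mem h5, Pi.one_apply, one_div]
        exact hinv
      · rw [Set.indicator_of_notMem h4, zero_div]
        exact Set.indicator_nonneg (fun _ _ => inv_nonneg.2 hc0.le) _
    have h6 : Integrable fun t => oddBand ε (shear (s, t)) / symbol μ mm (shear (s, t)) := by
      have hmb : Measurable ((band ε).indicator (1 : Plane → ℝ)) :=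
        measurable_one.indicator (measurableSet_band ε)
      have hmo : Measurable (oddBand ε) := hmb.sub (hmb.comp (mirror 1).continuous.measurable)
      refine hint.bdd_mul (c := 1) (f := fun t => oddBand ε (shear (s, t)))
        (hmo.comp (shear.measurable.comp measurable_prodMk_left)).aestronglyMeasurable
        (ae_of_all _ fun t => ?_)
      rw [oddBand]
      by_cases h1 : shear (s, t) ∈ band ε <;> by_cases h2 : mirror 1 (shear (s, t)) ∈ band ε <;>
        simp [h1, h2]
    refine le_trans (by linarith) (h1.ge.trans (integral_mono (hint.sub ?_) h6 hle))
    rw [integrable_indicator_iff measurableSet_Icc]; simp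

end Half

/-! ### Continuity of the symbols -/

section Continuity

variable {μ T : ℝ}

lemma continuous_symbol_dFun (μ : ℝ) (hT : 0 < T) (t : ℝ) :
    Continuous fun s => symbol μ (dFun T) (shear (s, t)) := by
  have := continuous_dispersion μ hT
  simp only [symbol_dFun, shear_apply_zero, shear_apply_one]
  fun_prop

lemma symbol_dFun_zero (t : ℝ) : symbol μ (dFun T) (shear (0, t)) = dispersion μ T t := by
  rw [symbol_dFun, shear_apply_zero, shear_apply_one, zero_sub, dispersion_neg, add_halves]

lemma symbol_lFun_zero (t : ℝ) : symbol μ (lFun T) (shear (0, t)) = dispersion μ T t := by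
  rw [symbol, shear_apply_zero, shear_apply_one, zero_sub, mul_neg, neg_sq, lFun_self, dispersion]

/-- Near `s = 0` both energies are close to the same nonzero `b`, so the quotient branch applies and
its denominator is close to `2 tanh (b / 2T) ≠ 0`. -/
lemma continuousAt_symbol_lFun (hT : 0 < T) {t : ℝ} (ht : (2 * Real.pi * t) ^ 2 ≠ μ) :
    ContinuousAt (fun s => symbol μ (lFun T) (shear (s, t))) 0 := by
  set b := (2 * Real.pi * t) ^ 2 - μ with hb
  have hb0 : b ≠ 0 := sub_ne_zero.2 ht
  have ha : ContinuousAt (fun s : ℝ => (2 * Real.pi * (s - t)) ^ 2 - μ) 0 := by fun_prop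
  have ha0 : (2 * Real.pi * (0 - t)) ^ 2 - μ = b := by rw [hb]; ring
  have hne : ∀ᶠ s in 𝓝 (0 : ℝ), (2 * Real.pi * (s - t)) ^ 2 - μ + b ≠ 0 := by
    refine ContinuousAt.eventually_ne (ha.add continuousAt_const) ?_
    rw [ha0, ← two_mul]
    exact mul_ne_zero two_ne_zero hb0
  have hq : ContinuousAt (fun s : ℝ => ((2 * Real.pi * (s - t)) ^ 2 - μ + b) /
      (Real.tanh (((2 * Real.pi * (s - t)) ^ 2 - μ) / (2 * T)) + Real.tanh (b / (2 * T)))) 0 := by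
    refine (ha.add continuousAt_const).div
      ((continuous_tanh.continuousAt.comp (ha.div_const _)).add continuousAt_const) ?_
    change Real.tanh (((2 * Real.pi * (0 - t)) ^ 2 - μ) / (2 * T)) + _ ≠ 0
    rw [ha0, ← two_mul]
    refine mul_ne_zero two_ne_zero fun h0 => ?_
    rw [← Real.tanh_zero] at h0
    have := strictMono_tanh.injective h0
    rw [div_eq_zero_iff] at this
    rcases this with h | h
    · exact hb0 h
    · linarith
  refine hq.congr ?_
  filter_upwards [hne] with s hs
  rw [symbol, shear_apply_zero, shear_apply_one, lFun, if_neg hs]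

lemma ae_continuousAt_symbol_lFun (hT : 0 < T) :
    ∀ᵐ t, ContinuousAt (fun s => symbol μ (lFun T) (shear (s, t))) 0 := by
  have hfin : {t : ℝ | (2 * Real.pi * t) ^ 2 = μ}.Finite := by
    refine Set.Finite.subset (Set.toFinite {√μ / (2 * Real.pi), -√μ / (2 * Real.pi)}) ?_
    intro t ht
    have ht' : (2 * Real.pi * t) ^ 2 = μ := ht
    have hμ : 0 ≤ μ := ht' ▸ sq_nonneg _
    have hp := Real.pi_pos
    rw [← Real.sq_sqrt hμ, sq_eq_sq_iff_eq_or_eq_neg] at ht'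
    rcases ht' with h | h
    · left; rw [← h]; field_simp
    · right; rw [Set.mem_singleton_iff, ← h]; field_simp
  filter_upwards [hfin.countable.ae_notMem volume] with t ht
  exact continuousAt_symbol_lFun hT ht

lemma lineInf_dFun_neg (hμ : 0 ≤ μ) (hT : 0 < T) {lam : ℝ} (hlam : 0 < lam)
    (h : 1 < lam * gapInt μ T) : lineInf μ (dFun T) lam < 0 := by
  refine lineInf_neg (isElliptic_dFun hμ hT) (dFun_comm T)
    (ae_of_all _ fun t => (continuous_symbol_dFun μ hT t).continuousAt) hlam ?_
  simpa only [symbol_dFun_zero, gapInt] using h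

lemma lineInf_lFun_neg (hμ : 0 ≤ μ) (hT : 0 < T) {lam : ℝ} (hlam : 0 < lam)
    (h : 1 < lam * gapInt μ T) : lineInf μ (lFun T) lam < 0 := by
  refine lineInf_neg (isElliptic_lFun hμ hT) lFun_comm (ae_continuousAt_symbol_lFun hT) hlam ?_
  simpa only [symbol_lFun_zero, gapInt] using h

lemma halfInf_dFun_neg (hμ : 0 ≤ μ) (hT : 0 < T) {lam : ℝ} (hlam : 0 < lam)
    (h : 1 < lam * gapInt μ T) : halfInf μ (dFun T) lam < 0 := by
  refine halfInf_neg (isElliptic_dFun hμ hT) (dFun_comm T)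
    (ae_of_all _ fun t => (continuous_symbol_dFun μ hT t).continuousAt) hlam ?_
  simpa only [symbol_dFun_zero, gapInt] using h

end Continuity

/-! ### An upper bound on the trace of functions that are odd in each momentum -/

section OddBound

lemma quasiMeasurePreserving_sum :
    Measure.QuasiMeasurePreserving (fun ξ : Plane => ξ 0 + ξ 1) volume volume :=
  Measure.quasiMeasurePreserving_fst.comp
    (measurePreserving_shear.symm shear).quasiMeasurePreserving

lemma mirror_one_zero (ξ : Plane) : mirror 1 ξ 0 = ξ 0 := by simp [mirror_apply]

lemma mirror_one_one (ξ : Plane) : mirror 1 ξ 1 = -ξ 1 := by simp [mirror_apply]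

lemma integral_comp_sub_two_mul (u : ℝ → ℂ) (s : ℝ) :
    ∫ t, u (s - 2 * t) = (2 : ℂ)⁻¹ * ∫ t, u t := by
  rw [Measure.integral_comp_mul_left (fun x => u (s - x)) 2, integral_sub_left_eq_self u volume s,
    abs_of_pos (by norm_num), Complex.real_smul]
  norm_num

/-- In the variables `p + q` and `p - q` the integral factors into `|∫ u|² / 2`. Where it diverges
it is zero by convention. -/
lemma re_integral_conj_mul_nonneg (u : ℝ → ℂ) :
    0 ≤ (∫ ξ : Plane, starRingEnd ℂ (u (ξ 0 + ξ 1)) * u (ξ 0 - ξ 1)).re := by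
  by_cases hi : Integrable fun ξ : Plane => starRingEnd ℂ (u (ξ 0 + ξ 1)) * u (ξ 0 - ξ 1)
  · rw [integral_shear hi]
    have h : ∀ s, ∫ t, starRingEnd ℂ (u (shear (s, t) 0 + shear (s, t) 1)) *
        u (shear (s, t) 0 - shear (s, t) 1) =
        starRingEnd ℂ (u s) * ((2 : ℂ)⁻¹ * ∫ t, u t) := fun s => by
      rw [← integral_comp_sub_two_mul u s, ← integral_const_mul]
      congr 1
      ext t
      have e1 : s - t + t = s := by ring
      have e2 : s - t - t = s - 2 * t := by ring
      rw [shear_apply_zero, shear_apply_one, e1, e2]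
    simp only [h]
    rw [integral_mul_const, integral_conj, mul_left_comm, ← Complex.normSq_eq_conj_mul_self]
    have h2 : (2 : ℂ)⁻¹ * (Complex.normSq (∫ t, u t) : ℂ) =
        ((2⁻¹ * Complex.normSq (∫ t, u t) : ℝ) : ℂ) := by push_cast; rfl
    rw [h2, Complex.ofReal_re]
    have := Complex.normSq_nonneg (∫ t, u t)
    positivity
  · rw [integral_undef hi, Complex.zero_re]

variable {k : ℝ → ℝ} {c : ℝ}

/-- The reciprocal of `k (s / 2) + k (s' / 2) - 2 c`, for `s = p + q` and `s' = p - q`. -/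
def pairKernel (k : ℝ → ℝ) (c : ℝ) (ξ : Plane) : ℝ :=
  (k ((ξ 0 + ξ 1) / 2) + k ((ξ 0 - ξ 1) / 2) - 2 * c)⁻¹

lemma pairKernel_mirror (ξ : Plane) : pairKernel k c (mirror 1 ξ) = pairKernel k c ξ := by
  rw [pairKernel, pairKernel, mirror_one_zero, mirror_one_one, sub_neg_eq_add, ← sub_eq_add_neg,
    add_comm (k _)]

lemma pairKernel_pos (hc : 0 < c) (hk : ∀ x, 2 * c ≤ k x) (ξ : Plane) : 0 < pairKernel k c ξ := by
  have h1 := hk ((ξ 0 + ξ 1) / 2)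
  have h2 := hk ((ξ 0 - ξ 1) / 2)
  exact inv_pos.2 (by linarith)

lemma measurable_pairKernel (hkc : Continuous k) : Measurable (pairKernel k c) := by
  have h1 := hkc.measurable
  have h2 := measurable_coord
  unfold pairKernel
  fun_prop

lemma pairKernel_eq_integral (hc : 0 < c) (hk : ∀ x, 2 * c ≤ k x) (ξ : Plane) :
    pairKernel k c ξ = ∫ τ in Set.Ioi (0 : ℝ),
      Real.exp (-(k ((ξ 0 + ξ 1) / 2) + k ((ξ 0 - ξ 1) / 2) - 2 * c) * τ) := by
  have h1 := hk ((ξ 0 + ξ 1) / 2)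
  have h2 := hk ((ξ 0 - ξ 1) / 2)
  rw [integral_exp_mul_Ioi (by linarith), mul_zero, Real.exp_zero, pairKernel, neg_div_neg_eq,
    one_div]

/-- Writing the reciprocal as a Laplace integral in `τ` makes the kernel a superposition of products
of one function evaluated at `p + q` and at `p - q`; each `τ` contributes a nonnegative amount. -/
lemma re_integral_pairKernel_nonneg (hc : 0 < c) (hkc : Continuous k) (hk : ∀ x, 2 * c ≤ k x)
    {G : ℝ → ℂ}
    (hi : Integrable fun ξ : Plane =>
      (pairKernel k c ξ : ℂ) * (starRingEnd ℂ (G (ξ 0 + ξ 1)) * G (ξ 0 - ξ 1)))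
    (hGm : AEStronglyMeasurable fun ξ : Plane => starRingEnd ℂ (G (ξ 0 + ξ 1)) * G (ξ 0 - ξ 1)) :
    0 ≤ (∫ ξ : Plane,
      (pairKernel k c ξ : ℂ) * (starRingEnd ℂ (G (ξ 0 + ξ 1)) * G (ξ 0 - ξ 1))).re := by
  set E : Plane → ℝ → ℝ := fun ξ τ =>
    Real.exp (-(k ((ξ 0 + ξ 1) / 2) + k ((ξ 0 - ξ 1) / 2) - 2 * c) * τ) with hE
  set g : Plane → ℂ := fun ξ => starRingEnd ℂ (G (ξ 0 + ξ 1)) * G (ξ 0 - ξ 1) with hg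
  have hEi : ∀ ξ, IntegrableOn (E ξ) (Set.Ioi 0) := fun ξ => by
    have h1 := hk ((ξ 0 + ξ 1) / 2)
    have h2 := hk ((ξ 0 - ξ 1) / 2)
    exact integrableOn_exp_mul_Ioi (by linarith) 0
  have hEc : Measurable fun z : Plane × ℝ => E z.1 z.2 := by
    have h1 := hkc.measurable
    have h2 := measurable_coord
    simp only [hE]
    fun_prop
  have hint : Integrable (Function.uncurry fun (ξ : Plane) (τ : ℝ) => (E ξ τ : ℂ) * g ξ)
      (volume.prod (volume.restrict (Set.Ioi 0))) := by
    refine (integrable_prod_iff ?_).2 ⟨ae_of_all _ fun ξ => ?_, ?_⟩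
    · exact (Complex.measurable_ofReal.comp hEc).aestronglyMeasurable.mul hGm.comp_fst
    · have h : Integrable (fun τ => (E ξ τ : ℂ)) (volume.restrict (Set.Ioi 0)) := (hEi ξ).ofReal
      exact h.mul_const (g ξ)
    · refine hi.norm.congr (ae_of_all _ fun ξ => ?_)
      have e : ∀ τ, ‖(E ξ τ : ℂ) * g ξ‖ = E ξ τ * ‖g ξ‖ := fun τ => by
        rw [norm_mul, Complex.norm_real, Real.norm_of_nonneg (Real.exp_pos _).le]
      simp only [Function.uncurry, e]
      rw [integral_mul_const, ← pairKernel_eq_integral hc hk, norm_mul, Complex.norm_real,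
        Real.norm_of_nonneg (pairKernel_pos hc hk ξ).le]
  have e1 : ∀ ξ, (pairKernel k c ξ : ℂ) * g ξ = ∫ τ in Set.Ioi (0 : ℝ), (E ξ τ : ℂ) * g ξ :=
    fun ξ => by
      rw [integral_mul_const, pairKernel_eq_integral hc hk]
      congr 1
      exact integral_ofReal.symm
  rw [integral_congr_ae (ae_of_all _ e1), integral_integral_swap hint]
  have hre : (∫ τ in Set.Ioi (0 : ℝ), ∫ ξ, (E ξ τ : ℂ) * g ξ).re =
      ∫ τ in Set.Ioi (0 : ℝ), (∫ ξ, (E ξ τ : ℂ) * g ξ).re :=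
    (integral_re hint.integral_prod_right).symm
  rw [hre]
  refine integral_nonneg fun τ => ?_
  have h := re_integral_conj_mul_nonneg
    fun s => (Real.exp (-(k (s / 2) - c) * τ) : ℂ) * G s
  refine h.trans_eq ?_
  congr 2
  ext ξ
  have e2 : E ξ τ = Real.exp (-(k ((ξ 0 + ξ 1) / 2) - c) * τ) *
      Real.exp (-(k ((ξ 0 - ξ 1) / 2) - c) * τ) := by
    rw [← Real.exp_add]
    simp only [hE]
    congr 1
    ring
  rw [e2, map_mul, Complex.conj_ofReal, Complex.ofReal_mul]
  ring

/-- Because `k ≥ 2c`, the kernel is at most `1 / k ((p - q) / 2)`. On the fibre `p + q = s` this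
argument is `s / 2 - t`, so integration over `t` gives the integral of `1 / k`. -/
lemma integrable_pairKernel_mul_sq (hc : 0 < c) (hkc : Continuous k) (hk : ∀ x, 2 * c ≤ k x)
    (hki : Integrable fun x => (k x)⁻¹) {G : ℝ → ℂ} (hG : MemLp G 2) :
    (Integrable fun ξ : Plane => pairKernel k c ξ * ‖G (ξ 0 + ξ 1)‖ ^ 2) ∧
      ∫ ξ : Plane, pairKernel k c ξ * ‖G (ξ 0 + ξ 1)‖ ^ 2 ≤ (∫ x, (k x)⁻¹) * ∫ s, ‖G s‖ ^ 2 := by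
  have hw0 : ∀ ξ, 0 ≤ pairKernel k c ξ := fun ξ => (pairKernel_pos hc hk ξ).le
  have hwm := measurable_pairKernel (c := c) hkc
  have hk0 : ∀ x, 0 < k x := fun x => by linarith [hk x]
  have hGm : AEStronglyMeasurable fun ξ : Plane => G (ξ 0 + ξ 1) :=
    hG.1.comp_quasiMeasurePreserving quasiMeasurePreserving_sum
  have hm : AEStronglyMeasurable fun ξ : Plane => pairKernel k c ξ * ‖G (ξ 0 + ξ 1)‖ ^ 2 :=
    hwm.aestronglyMeasurable.mul (hGm.norm.pow 2)
  have hG2 : ∫⁻ s, ‖G s‖ₑ ^ 2 = ENNReal.ofReal (∫ s, ‖G s‖ ^ 2) := by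
    have := lintegral_mul_sq_eq (f := G) (w := fun _ => (1 : ℝ)) (ν := volume)
      (fun _ => zero_le_one) (by simpa using integrable_sq_of_memLp hG)
    simpa using this
  have hrow : ∀ s, ∫⁻ t, ENNReal.ofReal (pairKernel k c (shear (s, t))) ≤
      ENNReal.ofReal (∫ x, (k x)⁻¹) := fun s => by
    rw [← integral_sub_left_eq_self (fun x => (k x)⁻¹) volume (s / 2),
      ofReal_integral_eq_lintegral_ofReal (hki.comp_sub_left (s / 2))
        (ae_of_all _ fun t => inv_nonneg.2 (hk0 _).le)]
    refine lintegral_mono fun t => ENNReal.ofReal_le_ofReal ?_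
    have e1 : (shear (s, t) 0 + shear (s, t) 1) / 2 = s / 2 := by simp
    have e2 : (shear (s, t) 0 - shear (s, t) 1) / 2 = s / 2 - t := by simp; ring
    rw [pairKernel, e1, e2]
    exact inv_anti₀ (hk0 _) (by linarith [hk (s / 2)])
  have hle : ∫⁻ ξ : Plane, ENNReal.ofReal (pairKernel k c ξ) * ‖G (ξ 0 + ξ 1)‖ₑ ^ 2 ≤
      ENNReal.ofReal ((∫ x, (k x)⁻¹) * ∫ s, ‖G s‖ ^ 2) := by
    have hmE : AEMeasurable fun ξ : Plane =>
        ENNReal.ofReal (pairKernel k c ξ) * ‖G (ξ 0 + ξ 1)‖ₑ ^ 2 :=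
      hwm.ennreal_ofReal.aemeasurable.mul (hGm.enorm.pow_const 2)
    rw [← lintegral_shear _ hmE, ENNReal.ofReal_mul (integral_nonneg fun x =>
      inv_nonneg.2 (hk0 x).le), ← hG2, ← lintegral_const_mul'' _ (hG.1.enorm.pow_const 2)]
    refine lintegral_mono fun s => ?_
    have e : ∀ t, shear (s, t) 0 + shear (s, t) 1 = s := fun t => by simp
    simp only [e]
    have hms : Measurable fun t => ENNReal.ofReal (pairKernel k c (shear (s, t))) :=
      (hwm.comp (shear.measurable.comp measurable_prodMk_left)).ennreal_ofReal
    rw [lintegral_mul_const _ hms]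
    gcongr
    exact hrow s
  have hen : ∀ ξ : Plane, ‖pairKernel k c ξ * ‖G (ξ 0 + ξ 1)‖ ^ 2‖ₑ =
      ENNReal.ofReal (pairKernel k c ξ) * ‖G (ξ 0 + ξ 1)‖ₑ ^ 2 := fun ξ => by
    rw [enorm_mul, enorm_pow, enorm_norm, Real.enorm_of_nonneg (hw0 ξ)]
  have hi : Integrable fun ξ : Plane => pairKernel k c ξ * ‖G (ξ 0 + ξ 1)‖ ^ 2 := by
    refine ⟨hm, ?_⟩
    rw [HasFiniteIntegral]
    simp only [hen]
    exact hle.trans_lt ENNReal.ofReal_lt_top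
  refine ⟨hi, ?_⟩
  rw [lintegral_mul_sq_eq hw0 hi] at hle
  exact (ENNReal.ofReal_le_ofReal_iff (mul_nonneg (integral_nonneg fun x => inv_nonneg.2 (hk0 x).le)
    (integral_nonneg fun s => sq_nonneg _))).1 hle

/-- Oddness lets `ψ` be paired with `G(p + q) - G(p - q)` instead of `G(p + q)`. This doubles the
pairing but, as the cross term is nonnegative, at most doubles the weighted norm squared of the test
function. Cauchy-Schwarz then gains the factor 2 that compensates the doubled coupling. -/
theorem two_mul_integral_fibre_le (hc : 0 < c) (hkc : Continuous k) (hk : ∀ x, 2 * c ≤ k x)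
    (hki : Integrable fun x => (k x)⁻¹) {m : Plane → ℝ} (hm : IsElliptic m)
    (hle : ∀ ξ : Plane, k ((ξ 0 + ξ 1) / 2) + k ((ξ 0 - ξ 1) / 2) - 2 * c ≤ m ξ)
    {ψ : L2Plane} (hodd : ∀ᵐ ξ, ψ (mirror 1 ξ) = -ψ ξ)
    (hψ : Integrable fun ξ => m ξ * ‖ψ ξ‖ ^ 2) :
    2 * ∫ s, ‖fibre ψ s‖ ^ 2 ≤ (∫ x, (k x)⁻¹) * ∫ ξ, m ξ * ‖ψ ξ‖ ^ 2 := by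
  set G := fibre ψ with hGd
  have hG : MemLp G 2 := hm.memLp_fibre' hψ
  set w := pairKernel k c with hw
  set N := ∫ x, (k x)⁻¹ with hN
  set Y := ∫ s, ‖G s‖ ^ 2 with hY
  have hw0 : ∀ ξ, 0 < w ξ := pairKernel_pos hc hk
  have hwm : Measurable w := measurable_pairKernel hkc
  have hwM : ∀ ξ, (w ξ)⁻¹ ≤ m ξ := fun ξ => by rw [hw, pairKernel, inv_inv]; exact hle ξ
  set a : Plane → ℂ := fun ξ => G (ξ 0 + ξ 1) with ha
  set b : Plane → ℂ := fun ξ => G (ξ 0 - ξ 1) with hb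
  have hab : ∀ ξ, a (mirror 1 ξ) = b ξ := fun ξ => by
    simp only [ha, hb, mirror_one_zero, mirror_one_one, sub_eq_add_neg]
  have hba : ∀ ξ, b (mirror 1 ξ) = a ξ := fun ξ => by
    simp only [ha, hb, mirror_one_zero, mirror_one_one, sub_neg_eq_add]
  have hmir := (mirror 1).measurePreserving
  have hemb := measurableEmbedding_mirror 1
  have ham : AEStronglyMeasurable a :=
    hG.1.comp_quasiMeasurePreserving quasiMeasurePreserving_sum
  have hbm : AEStronglyMeasurable b :=
    (ham.comp_measurePreserving hmir).congr (ae_of_all _ hab)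
  have hψm := Lp.aestronglyMeasurable ψ
  obtain ⟨hai, haN⟩ := integrable_pairKernel_mul_sq hc hkc hk hki hG
  have ebw : ∀ ξ, w (mirror 1 ξ) * ‖a (mirror 1 ξ)‖ ^ 2 = w ξ * ‖b ξ‖ ^ 2 := fun ξ => by
    rw [hab, hw, pairKernel_mirror]
  have hbi : Integrable fun ξ => w ξ * ‖b ξ‖ ^ 2 :=
    ((hmir.integrable_comp_emb hemb).2 hai).congr (ae_of_all _ ebw)
  have hbe : ∫ ξ, w ξ * ‖b ξ‖ ^ 2 = ∫ ξ, w ξ * ‖a ξ‖ ^ 2 := by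
    rw [← hmir.integral_comp hemb (fun ξ => w ξ * ‖a ξ‖ ^ 2)]
    exact integral_congr_ae (ae_of_all _ fun ξ => (ebw ξ).symm)
  -- the cross term
  have hcm : AEStronglyMeasurable fun ξ => starRingEnd ℂ (a ξ) * b ξ := ham.star.mul hbm
  have hci : Integrable fun ξ => (w ξ : ℂ) * (starRingEnd ℂ (a ξ) * b ξ) := by
    refine (hai.add hbi).mono'
      ((Complex.measurable_ofReal.comp hwm).aestronglyMeasurable.mul hcm) (ae_of_all _ fun ξ => ?_)
    rw [norm_mul, norm_mul, Complex.norm_real, Real.norm_of_nonneg (hw0 ξ).le, RCLike.norm_conj,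
      Pi.add_apply, ← mul_add]
    refine mul_le_mul_of_nonneg_left ?_ (hw0 ξ).le
    nlinarith [sq_nonneg (‖a ξ‖ - ‖b ξ‖), sq_nonneg ‖a ξ‖, sq_nonneg ‖b ξ‖]
  have hcross := re_integral_pairKernel_nonneg hc hkc hk hci hcm
  have hdsq : ∀ ξ, w ξ * ‖a ξ - b ξ‖ ^ 2 = w ξ * ‖a ξ‖ ^ 2 + w ξ * ‖b ξ‖ ^ 2 -
      2 * ((w ξ : ℂ) * (starRingEnd ℂ (a ξ) * b ξ)).re := fun ξ => by
    rw [Complex.re_ofReal_mul, ← Complex.normSq_eq_norm_sq, ← Complex.normSq_eq_norm_sq,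
      ← Complex.normSq_eq_norm_sq, Complex.normSq_apply, Complex.normSq_apply,
      Complex.normSq_apply]
    simp
    ring
  have hsum : Integrable fun ξ => w ξ * ‖a ξ‖ ^ 2 + w ξ * ‖b ξ‖ ^ 2 := hai.add hbi
  have hcr : Integrable fun ξ => 2 * ((w ξ : ℂ) * (starRingEnd ℂ (a ξ) * b ξ)).re :=
    hci.re.const_mul 2
  have hdi : Integrable fun ξ => w ξ * ‖a ξ - b ξ‖ ^ 2 := by
    simp only [hdsq]
    exact hsum.sub hcr
  have hdN : ∫ ξ, w ξ * ‖a ξ - b ξ‖ ^ 2 ≤ 2 * N * Y := by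
    simp only [hdsq]
    rw [integral_sub hsum hcr, integral_add hai hbi, hbe, integral_const_mul]
    have : ∫ ξ, ((w ξ : ℂ) * (starRingEnd ℂ (a ξ) * b ξ)).re =
        (∫ ξ, (w ξ : ℂ) * (starRingEnd ℂ (a ξ) * b ξ)).re := integral_re hci
    rw [this]
    linarith
  -- the pairing with `ψ`
  have hyoung : ∀ r : ℝ, 0 < r → ∀ (z : ℂ) (ξ : Plane),
      2 * (‖z‖ * ‖ψ ξ‖) ≤ r * (w ξ * ‖z‖ ^ 2) + r⁻¹ * (m ξ * ‖ψ ξ‖ ^ 2) := fun r hr z ξ => by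
    have h1 : r⁻¹ * ((w ξ)⁻¹ * ‖ψ ξ‖ ^ 2) ≤ r⁻¹ * (m ξ * ‖ψ ξ‖ ^ 2) := by
      have := hwM ξ
      gcongr
    refine le_trans ?_ (add_le_add_right h1 _)
    have h2 := hw0 ξ
    have h3 : r * (w ξ * ‖z‖ ^ 2) + r⁻¹ * ((w ξ)⁻¹ * ‖ψ ξ‖ ^ 2) - 2 * (‖z‖ * ‖ψ ξ‖) =
        (r * w ξ) * (‖z‖ - (r * w ξ)⁻¹ * ‖ψ ξ‖) ^ 2 := by
      field_simp
      ring
    have h4 : 0 ≤ (r * w ξ) * (‖z‖ - (r * w ξ)⁻¹ * ‖ψ ξ‖) ^ 2 := by positivity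
    linarith
  have hpi : Integrable fun ξ => starRingEnd ℂ (a ξ) * ψ ξ := by
    refine (hai.add hψ).mono' (ham.star.mul hψm) (ae_of_all _ fun ξ => ?_)
    have h1 := hyoung 1 one_pos (a ξ) ξ
    have h2 : 0 ≤ ‖a ξ‖ * ‖ψ ξ‖ := by positivity
    rw [norm_mul, RCLike.norm_conj, Pi.add_apply]
    linarith
  have epb : ∀ᵐ ξ, starRingEnd ℂ (a (mirror 1 ξ)) * ψ (mirror 1 ξ) =
      -(starRingEnd ℂ (b ξ) * ψ ξ) := by
    filter_upwards [hodd] with ξ hξ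
    rw [hξ, hab, mul_neg]
  have hpbi : Integrable fun ξ => starRingEnd ℂ (b ξ) * ψ ξ := by
    have := (((hmir.integrable_comp_emb hemb).2 hpi).congr epb).neg
    refine this.congr (ae_of_all _ fun ξ => ?_)
    simp
  have hpb : ∫ ξ, starRingEnd ℂ (b ξ) * ψ ξ = -∫ ξ, starRingEnd ℂ (a ξ) * ψ ξ := by
    rw [← hmir.integral_comp hemb (fun ξ => starRingEnd ℂ (a ξ) * ψ ξ), integral_congr_ae epb,
      integral_neg, neg_neg]
  have hpa : ∫ ξ, starRingEnd ℂ (a ξ) * ψ ξ = (Y : ℂ) := by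
    rw [integral_shear hpi, hY]
    refine Eq.trans ?_ integral_ofReal
    refine integral_congr_ae (ae_of_all _ fun s => ?_)
    have e : ∀ t, a (shear (s, t)) = G s := fun t => by simp [ha]
    simp only [e]
    rw [integral_const_mul]
    change starRingEnd ℂ (G s) * G s = _
    rw [← Complex.normSq_eq_conj_mul_self, Complex.normSq_eq_norm_sq]
    rfl
  -- Pairing with `G(p + q)` gives `Y`; pairing with its reflection gives `-Y`.
  have h2Y : 2 * Y = (∫ ξ, starRingEnd ℂ (a ξ - b ξ) * ψ ξ).re := by
    simp only [map_sub, sub_mul]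
    rw [integral_sub hpi hpbi, hpb, hpa]
    simp [two_mul]
  have hNpos : 0 < N := by
    have hk0 : ∀ x, 0 < k x := fun x => by linarith [hk x]
    rw [hN, integral_pos_iff_support_of_nonneg (fun x => inv_nonneg.2 (hk0 x).le) hki]
    have : (Function.support fun x => (k x)⁻¹) = Set.univ := by
      ext x
      simpa using (hk0 x).ne'
    rw [this]
    simp
  have hfin : 2 * (2 * Y) ≤ N⁻¹ * (2 * N * Y) + N * ∫ ξ, m ξ * ‖ψ ξ‖ ^ 2 := by
    calc 2 * (2 * Y) ≤ 2 * ∫ ξ, ‖a ξ - b ξ‖ * ‖ψ ξ‖ := by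
          rw [h2Y]
          refine mul_le_mul_of_nonneg_left ?_ zero_le_two
          refine (Complex.re_le_norm _).trans ((norm_integral_le_integral_norm _).trans_eq ?_)
          simp only [norm_mul, RCLike.norm_conj]
      _ = ∫ ξ, 2 * (‖a ξ - b ξ‖ * ‖ψ ξ‖) := (integral_const_mul _ _).symm
      _ ≤ ∫ ξ, (N⁻¹ * (w ξ * ‖a ξ - b ξ‖ ^ 2) + N * (m ξ * ‖ψ ξ‖ ^ 2)) := by
          refine integral_mono_of_nonneg (ae_of_all _ fun ξ => by positivity)
            ((hdi.const_mul _).add (hψ.const_mul _)) (ae_of_all _ fun ξ => ?_)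
          -- With `r = N⁻¹` the first term is at most `2 Y`, which is absorbed on the left.
          have := hyoung N⁻¹ (inv_pos.2 hNpos) (a ξ - b ξ) ξ
          rwa [inv_inv] at this
      _ = N⁻¹ * (∫ ξ, w ξ * ‖a ξ - b ξ‖ ^ 2) + N * ∫ ξ, m ξ * ‖ψ ξ‖ ^ 2 := by
          rw [integral_add (hdi.const_mul _) (hψ.const_mul _), integral_const_mul,
            integral_const_mul]
      _ ≤ _ := by gcongr
  have : N⁻¹ * (2 * N * Y) = 2 * Y := by field_simp
  linarith

end OddBound

/-! ### The half-line above the critical temperature -/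

section HalfLine

variable {μ T : ℝ}

/-- Since `kFun` is 1-Lipschitz, removing `μ` changes it by at most `μ`, and `μ ≤ (μ / 2T) kFun`
because `kFun ≥ 2T`. -/
lemma dispersion_le (hμ : 0 ≤ μ) (hT : 0 < T) (t : ℝ) :
    dispersion μ T t ≤ (1 + μ / (2 * T)) * dispersion 0 T t := by
  have h1 := (abs_le.1 (abs_kFun_sub_le hT ((2 * Real.pi * t) ^ 2 - μ)
    ((2 * Real.pi * t) ^ 2 - 0))).2
  have h2 := two_mul_le_kFun hT ((2 * Real.pi * t) ^ 2 - 0)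
  have h3 : |(2 * Real.pi * t) ^ 2 - μ - ((2 * Real.pi * t) ^ 2 - 0)| = μ := by
    rw [sub_sub_sub_cancel_left, zero_sub, abs_neg, abs_of_nonneg hμ]
  have h4 : μ ≤ μ / (2 * T) * kFun T ((2 * Real.pi * t) ^ 2 - 0) := by
    rw [div_mul_eq_mul_div, le_div_iff₀ (by positivity)]
    gcongr
  rw [h3] at h1
  rw [dispersion, dispersion]
  linarith

lemma le_dispersion (hμ : 0 ≤ μ) (hT : 0 < T) (t : ℝ) :
    (1 - μ / (2 * T)) * dispersion 0 T t ≤ dispersion μ T t := by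
  have h1 := (abs_le.1 (abs_kFun_sub_le hT ((2 * Real.pi * t) ^ 2 - μ)
    ((2 * Real.pi * t) ^ 2 - 0))).1
  have h2 := two_mul_le_kFun hT ((2 * Real.pi * t) ^ 2 - 0)
  have h3 : |(2 * Real.pi * t) ^ 2 - μ - ((2 * Real.pi * t) ^ 2 - 0)| = μ := by
    rw [sub_sub_sub_cancel_left, zero_sub, abs_neg, abs_of_nonneg hμ]
  have h4 : μ ≤ μ / (2 * T) * kFun T ((2 * Real.pi * t) ^ 2 - 0) := by
    rw [div_mul_eq_mul_div, le_div_iff₀ (by positivity)]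
    gcongr
  rw [h3] at h1
  rw [dispersion, dispersion]
  linarith

lemma gapInt_zero_le (hμ : 0 ≤ μ) (hT : 0 < T) :
    gapInt 0 T ≤ (1 + μ / (2 * T)) * gapInt μ T := by
  rw [gapInt, gapInt, ← integral_const_mul]
  refine integral_mono (integrable_inv_dispersion le_rfl hT)
    ((integrable_inv_dispersion hμ hT).const_mul _) fun t => ?_
  have h1 := dispersion_pos (μ := μ) hT t
  have h2 := dispersion_pos (μ := 0) hT t
  have h3 := dispersion_le hμ hT t
  simp only
  rw [← div_eq_mul_inv, inv_eq_one_div, div_le_div_iff₀ h2 h1]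
  linarith

/-- `kFun` is homogeneous of degree one in temperature and energy together, and at `μ = 0` the
energy is quadratic in the momentum, so `t` scales with `√c`. -/
lemma gapInt_zero_mul (T : ℝ) {c : ℝ} (hc : 0 < c) :
    gapInt 0 (c * T) = (√c)⁻¹ * gapInt 0 T := by
  have hs := Real.sqrt_pos.2 hc
  have hsq := Real.sq_sqrt hc.le
  have e : ∀ t, (dispersion 0 (c * T) t)⁻¹ = c⁻¹ * (dispersion 0 T (t / √c))⁻¹ := fun t => by
    rw [dispersion, dispersion, ← mul_inv, ← kFun_mul hc]
    congr 2
    rw [sub_zero, sub_zero]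
    field_simp
    rw [hsq]
  rw [gapInt]
  simp only [e]
  rw [integral_const_mul, Measure.integral_comp_div (fun t => (dispersion 0 T t)⁻¹) (√c),
    abs_of_pos hs, smul_eq_mul, ← mul_assoc, gapInt]
  congr 1
  field_simp
  exact hsq

/-- This supplies the lower bound on the symbol required in `two_mul_integral_fibre_le`, with `c =
T`. The argument uses that the energy is a pure square, hence `μ = 0`. -/
lemma dispersion_add_le (hT : 0 < T) (x y : ℝ) :
    dispersion 0 T x + dispersion 0 T y - 2 * T ≤
      dispersion 0 T (x + y) / 2 + dispersion 0 T (x - y) / 2 := by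
  have hr : 0 < √(2 * T) := Real.sqrt_pos.2 (by positivity)
  have hsq : √(2 * T) ^ 2 = 2 * T := Real.sq_sqrt (by positivity)
  have h := xcoth_sq_add_le (2 * Real.pi * x / √(2 * T)) (2 * Real.pi * y / √(2 * T))
  have e : ∀ z, dispersion 0 T z = 2 * T * xcoth ((2 * Real.pi * z / √(2 * T)) ^ 2) := fun z => by
    rw [dispersion, kFun_eq hT, sub_zero, div_pow, hsq]
  have e1 : 2 * Real.pi * x / √(2 * T) + 2 * Real.pi * y / √(2 * T) =
      2 * Real.pi * (x + y) / √(2 * T) := by ring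
  have e2 : 2 * Real.pi * x / √(2 * T) - 2 * Real.pi * y / √(2 * T) =
      2 * Real.pi * (x - y) / √(2 * T) := by ring
  rw [e1, e2] at h
  rw [e, e, e, e]
  nlinarith

/-- The symbol is at least `θ = 1 - μ / 2T` times the one at `μ = 0`, for which the odd trace bound
has constant `gapInt 0 T`; the hypothesis `lam * gapInt 0 T < θ` leaves a positive margin. -/
lemma halfInf_pos (hμ : 0 ≤ μ) (hT : μ < 2 * T) {lam : ℝ} (hlam : 0 < lam)
    (h : lam * gapInt 0 T < 1 - μ / (2 * T)) : 0 < halfInf μ (dFun T) lam := by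
  have hT0 : 0 < T := by linarith
  set θ := 1 - μ / (2 * T) with hθ
  have hθ0 : 0 < θ := by rw [hθ, sub_pos, div_lt_one (by positivity)]; exact hT
  have hle : ∀ ξ, θ * symbol 0 (dFun T) ξ ≤ symbol μ (dFun T) ξ := fun ξ => by
    have h0 := le_dispersion hμ hT0 (ξ 0)
    have h1 := le_dispersion hμ hT0 (ξ 1)
    rw [symbol_dFun, symbol_dFun]
    linarith
  have hell := isElliptic_dFun (μ := 0) le_rfl hT0
  refine (half_formModel (isElliptic_dFun hμ hT0) (dFun_comm T) lam).infSpectrum_pos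
    (δ := 1 - lam * gapInt 0 T / θ) (by rw [sub_pos, div_lt_one hθ0]; exact h) fun ψ hψ hi => ?_
  have hi0 : Integrable fun ξ => symbol 0 (dFun T) ξ * ‖ψ ξ‖ ^ 2 := by
    refine (hi.const_mul θ⁻¹).mono' ?_ (ae_of_all _ fun ξ => ?_)
    · exact hell.measurable.aestronglyMeasurable.mul
        ((Lp.aestronglyMeasurable ψ).norm.pow 2)
    · rw [Real.norm_of_nonneg (mul_nonneg (hell.pos ξ).le (sq_nonneg _)), ← mul_assoc]
      refine mul_le_mul_of_nonneg_right ?_ (sq_nonneg _)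
      rw [le_inv_mul_iff₀ hθ0]
      exact hle ξ
  have h1 : θ * ∫ ξ, symbol 0 (dFun T) ξ * ‖ψ ξ‖ ^ 2 ≤
      ∫ ξ, symbol μ (dFun T) ξ * ‖ψ ξ‖ ^ 2 := by
    rw [← integral_const_mul]
    refine integral_mono (hi0.const_mul _) hi fun ξ => ?_
    simp only
    rw [← mul_assoc]
    exact mul_le_mul_of_nonneg_right (hle ξ) (sq_nonneg _)
  have h2 := two_mul_integral_fibre_le hT0 (continuous_dispersion 0 hT0)
    (fun x => two_mul_le_kFun hT0 _) (integrable_inv_dispersion le_rfl hT0) hell (fun ξ => ?_)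
    (odd_of_mem_halfSpace hψ 1) hi0
  · have h3 : (1 - (1 - lam * gapInt 0 T / θ)) * ∫ ξ, symbol μ (dFun T) ξ * ‖ψ ξ‖ ^ 2 =
        lam * gapInt 0 T * (θ⁻¹ * ∫ ξ, symbol μ (dFun T) ξ * ‖ψ ξ‖ ^ 2) := by
      rw [sub_sub_cancel]; ring
    rw [h3]
    rw [← le_inv_mul_iff₀ hθ0] at h1
    have h4 := gapInt_nonneg (μ := 0) hT0
    calc 2 * lam * ∫ s, ‖fibre ψ s‖ ^ 2 = lam * (2 * ∫ s, ‖fibre ψ s‖ ^ 2) := by ring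
      _ ≤ lam * (gapInt 0 T * ∫ ξ, symbol 0 (dFun T) ξ * ‖ψ ξ‖ ^ 2) :=
        mul_le_mul_of_nonneg_left h2 hlam.le
      _ ≤ _ := by
        rw [mul_assoc]
        gcongr
  · have := dispersion_add_le hT0 ((ξ 0 + ξ 1) / 2) ((ξ 0 - ξ 1) / 2)
    rw [symbol_dFun]
    convert! this using 3 <;> ring_nf

end HalfLine

/-! ### The critical temperature -/

/-- The critical temperature of the line, where `lam * gapInt μ T = 1`. -/
def criticalTemp (μ lam : ℝ) : ℝ := sSup {T | 0 < T ∧ 1 < lam * gapInt μ T}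

section CriticalTemp

variable {μ lam T : ℝ}

lemma gapInt_pos (hμ : 0 ≤ μ) (hT : 0 < T) : 0 < gapInt μ T :=
  (gapInt_nonneg (by linarith)).trans_lt (gapInt_strictAnti hμ hT (lt_add_one T))

lemma bddAbove_subcritical (hμ : 0 ≤ μ) (hlam : 0 < lam) :
    BddAbove {T | 0 < T ∧ 1 < lam * gapInt μ T} := by
  obtain ⟨T₀, h0, h1⟩ := exists_gapInt_lt hμ (inv_pos.2 hlam)
  refine ⟨T₀, fun T hT => ?_⟩
  by_contra! hlt
  have h2 := gapInt_strictAnti hμ h0 hlt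
  have h3 := (lt_inv_mul_iff₀ hlam).1 ((h2.trans h1).trans_eq (mul_one _).symm)
  exact lt_asymm hT.2 h3

lemma le_criticalTemp (hμ : 0 ≤ μ) (hlam : 0 < lam) (hT : 0 < T) (h : 1 < lam * gapInt μ T) :
    T ≤ criticalTemp μ lam :=
  le_csSup (bddAbove_subcritical hμ hlam) ⟨hT, h⟩

lemma nonempty_subcritical (hμ : 0 ≤ μ) (hlam : 0 < lam) :
    {T | 0 < T ∧ 1 < lam * gapInt μ T}.Nonempty := by
  obtain ⟨T, hT, h⟩ := exists_lt_gapInt hμ (1 / lam)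
  exact ⟨T, hT, (div_lt_iff₀' hlam).1 h⟩

lemma criticalTemp_pos (hμ : 0 ≤ μ) (hlam : 0 < lam) : 0 < criticalTemp μ lam := by
  obtain ⟨T, hT, h⟩ := nonempty_subcritical hμ hlam
  exact hT.trans_le (le_criticalTemp hμ hlam hT h)

lemma one_lt_of_lt_criticalTemp (hμ : 0 ≤ μ) (hlam : 0 < lam) (hT : 0 < T)
    (h : T < criticalTemp μ lam) : 1 < lam * gapInt μ T := by
  obtain ⟨T', h1, h2⟩ := exists_lt_of_lt_csSup (nonempty_subcritical hμ hlam) h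
  exact h1.2.trans (mul_lt_mul_of_pos_left (gapInt_strictAnti hμ hT h2) hlam)

lemma lt_one_of_criticalTemp_lt (hμ : 0 ≤ μ) (hlam : 0 < lam) (h : criticalTemp μ lam < T) :
    lam * gapInt μ T < 1 := by
  obtain ⟨T', h1, h2⟩ := exists_between h
  have h0 := (criticalTemp_pos hμ hlam).trans h1
  refine (mul_lt_mul_of_pos_left (gapInt_strictAnti hμ h0 h2) hlam).trans_le ?_
  by_contra! hcon
  exact (le_criticalTemp hμ hlam h0 hcon).not_gt h1

/-- The sign is known strictly below and strictly above the critical temperature. What happens at it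
is irrelevant for the infimum. -/
theorem lineTl_eq (hμ : 0 ≤ μ) (hlam : 0 < lam) : lineTl μ lam = criticalTemp μ lam := by
  have hc := criticalTemp_pos hμ hlam
  have hmem : ∀ T, criticalTemp μ lam < T → T ∈ {T | 0 < T ∧ 0 ≤ lineInf μ (lFun T) lam} :=
    fun T h => ⟨hc.trans h, (lineInf_pos hμ (hc.trans h) hlam (isElliptic_lFun hμ (hc.trans h))
      lFun_comm (dFun_le_lFun (hc.trans h)) (lt_one_of_criticalTemp_lt hμ hlam h)).le⟩
  refine csInf_eq_of_forall_ge_of_forall_gt_exists_lt ⟨_, hmem _ (lt_add_one _)⟩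
    (fun T hT => ?_) fun w hw => ?_
  · by_contra! h
    exact (lineInf_lFun_neg hμ hT.1 hlam (one_lt_of_lt_criticalTemp hμ hlam hT.1 h)).not_ge hT.2
  · obtain ⟨T, h1, h2⟩ := exists_between hw
    exact ⟨T, hmem T h1, h2⟩

theorem lineTu_eq (hμ : 0 ≤ μ) (hlam : 0 < lam) : lineTu μ lam = criticalTemp μ lam := by
  have hc := criticalTemp_pos hμ hlam
  have hmem : ∀ T, 0 < T → T < criticalTemp μ lam →
      T ∈ {T | 0 < T ∧ lineInf μ (dFun T) lam ≤ 0} := fun T h0 h =>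
    ⟨h0, (lineInf_dFun_neg hμ h0 hlam (one_lt_of_lt_criticalTemp hμ hlam h0 h)).le⟩
  refine csSup_eq_of_forall_le_of_forall_lt_exists_gt
    ⟨_, hmem _ (half_pos hc) (half_lt_self hc)⟩ (fun T hT => ?_) fun w hw => ?_
  · by_contra! h
    exact (lineInf_pos hμ hT.1 hlam (isElliptic_dFun hμ hT.1) (dFun_comm T) (fun _ _ => le_rfl)
      (lt_one_of_criticalTemp_lt hμ hlam h)).not_ge hT.2
  · obtain ⟨T, h1, h2⟩ := exists_between (max_lt hw hc)
    exact ⟨T, hmem T ((le_max_right _ _).trans_lt h1) h2, (le_max_left _ _).trans_lt h1⟩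

lemma eventually_le_criticalTemp (hμ : 0 ≤ μ) (M : ℝ) :
    ∀ᶠ lam in atTop, M ≤ criticalTemp μ lam := by
  have hM : 0 < max M 1 := one_pos.trans_le (le_max_right _ _)
  have hg := gapInt_pos hμ hM
  filter_upwards [eventually_gt_atTop 0, eventually_gt_atTop (1 / gapInt μ (max M 1))] with lam h0 h
  exact (le_max_left _ _).trans (le_criticalTemp hμ h0 hM ((div_lt_iff₀ hg).1 h))

/-- Above the critical temperature of the line by a fixed factor, there is no bound state on the
half-line, provided the coupling is strong. -/
lemma halfInf_pos_of_lt (hμ : 0 ≤ μ) (hlam : 0 < lam) {c : ℝ} (hc : 1 < c)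
    (hM : μ ≤ (1 - (√c)⁻¹) * criticalTemp μ lam) (h : c * criticalTemp μ lam < T) :
    0 < halfInf μ (dFun T) lam := by
  have hTc := criticalTemp_pos hμ hlam
  have hc0 : 0 < c := one_pos.trans hc
  set q := (√c)⁻¹ with hq
  have hq0 : 0 < q := inv_pos.2 (Real.sqrt_pos.2 hc0)
  have hq1 : q < 1 := inv_lt_one_of_one_lt₀ (by rw [Real.lt_sqrt zero_le_one]; linarith)
  have hT' : criticalTemp μ lam < T / c := by rwa [lt_div_iff₀' hc0]
  set T' := T / c with hT'd
  have hT'0 := hTc.trans hT'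
  have hTT' : T = c * T' := by rw [hT'd]; field_simp
  have hlt : T' < T := by rw [hTT']; exact lt_mul_of_one_lt_left hT'0 hc
  have hT0 := hT'0.trans hlt
  have hμT : μ ≤ (1 - q) * T' :=
    hM.trans (mul_le_mul_of_nonneg_left hT'.le (by linarith))
  have h1 : μ / (2 * T') ≤ (1 - q) / 2 := by
    rw [div_le_div_iff₀ (by positivity) two_pos]
    linarith
  have h2 : μ / (2 * T) ≤ μ / (2 * T') := by gcongr
  have h3 : lam * gapInt 0 T ≤ q * (1 + μ / (2 * T')) := by
    rw [hTT', gapInt_zero_mul T' hc0, ← hq]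
    have h4 := gapInt_zero_le hμ hT'0
    have h5 := (lt_one_of_criticalTemp_lt hμ hlam hT').le
    have h6 : 0 ≤ μ / (2 * T') := by positivity
    calc lam * (q * gapInt 0 T') ≤ lam * (q * ((1 + μ / (2 * T')) * gapInt μ T')) := by gcongr
      _ = q * (1 + μ / (2 * T')) * (lam * gapInt μ T') := by ring
      _ ≤ q * (1 + μ / (2 * T')) * 1 := by gcongr
      _ = _ := mul_one _
  refine halfInf_pos hμ (by nlinarith) hlam ?_
  -- The bounds reduce the claim to `q (1 + (1 - q) / 2) < 1 - (1 - q) / 2`, that is, `(1 - q)² >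
  -- 0`.
  nlinarith

/-- Boundedness has to be assumed, because the supremum of an unbounded set of reals is 0 by
convention; for strong coupling it comes from `halfInf_pos_of_lt`. -/
lemma criticalTemp_le_halfTu (hμ : 0 ≤ μ) (hlam : 0 < lam)
    (hb : BddAbove {T | 0 < T ∧ halfInf μ (dFun T) lam ≤ 0}) :
    criticalTemp μ lam ≤ halfTu μ lam := by
  refine le_of_forall_lt fun w hw => ?_
  obtain ⟨T, h1, h2⟩ := exists_between (max_lt hw (criticalTemp_pos hμ hlam))
  have hT : 0 < T := (le_max_right _ _).trans_lt h1
  refine ((le_max_left _ _).trans_lt h1).trans_le (le_csSup hb ⟨hT, ?_⟩)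
  exact (halfInf_dFun_neg hμ hT hlam (one_lt_of_lt_criticalTemp hμ hlam hT h2)).le

theorem tendsto_halfTu (hμ : 0 ≤ μ) :
    Tendsto (fun lam => (halfTu μ lam - criticalTemp μ lam) / criticalTemp μ lam) atTop (𝓝 0) := by
  refine Metric.tendsto_nhds.2 fun ε hε => ?_
  have hc : 1 < 1 + ε / 2 := by linarith
  have hq : 0 < 1 - (√(1 + ε / 2))⁻¹ := by
    rw [sub_pos]
    exact inv_lt_one_of_one_lt₀ (by rw [Real.lt_sqrt zero_le_one]; linarith)
  filter_upwards [eventually_gt_atTop 0,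
    eventually_le_criticalTemp hμ (μ / (1 - (√(1 + ε / 2))⁻¹))] with lam hlam hM
  have hTc := criticalTemp_pos hμ hlam
  rw [div_le_iff₀' hq] at hM
  have hub : ∀ T ∈ {T | 0 < T ∧ halfInf μ (dFun T) lam ≤ 0},
      T ≤ (1 + ε / 2) * criticalTemp μ lam := fun T hT => by
    by_contra! h
    exact (halfInf_pos_of_lt hμ hlam hc hM h).not_ge hT.2
  have h1 := criticalTemp_le_halfTu hμ hlam ⟨_, hub⟩
  have h2 : halfTu μ lam ≤ (1 + ε / 2) * criticalTemp μ lam :=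
    Real.sSup_le hub (by positivity)
  rw [Real.dist_eq, sub_zero, abs_of_nonneg (div_nonneg (sub_nonneg.2 h1) hTc.le),
    div_lt_iff₀ hTc]
  nlinarith

end CriticalTemp

end BCS

end

theorem theorem1p3 (μ : ℝ) (hμ : 0 < μ) :
    ∃ Tc : ℝ → ℝ,
      (∀ lam : ℝ, 0 < lam →
        0 < Tc lam ∧ BCS.lineTl μ lam = Tc lam ∧ BCS.lineTu μ lam = Tc lam) ∧
      Tendsto (fun lam : ℝ => (BCS.halfTu μ lam - Tc lam) / Tc lam) atTop (𝓝 0) :=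
  ⟨BCS.criticalTemp μ, fun _ hlam => ⟨BCS.criticalTemp_pos hμ.le hlam, BCS.lineTl_eq hμ.le hlam,
    BCS.lineTu_eq hμ.le hlam⟩, BCS.tendsto_halfTu hμ.le⟩
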